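/- Let $d\ge 2$. Let $\mathcal R\subset\mathbb R^d$ be a root system (a finite, possibly empty, set, normalized so that $\langle v,v\rangle=2$ for all $v\in\mathcal R$ and mapped into itself by every reflection $\sigma_v x=x-\frac{2\langle x,v\rangle}{\|v\|^2}v$, $v\in\mathcal R$), let $G\subset O(d)$ be the finite reflection group generated by the $\sigma_v$, $v\in\mathcal R$, and let $\mathcal R_+$ be a positive subsystem of $\mathcal R$ (the roots lying on one side of a hyperplane through $0$ that contains no root). Let $\kappa:\mathcal R\to[0,\infty)$, $v\mapsto\kappa_v$, be $G$-invariant, and put $$h_\kappa(x)=\prod_{v\in\mathcal R_+}|\langle x,v\rangle|^{\kappa_v},\qquad |\kappa|=\sum_{v\in\mathcal R_+}\kappa_v,\qquad \lambda_\kappa=\frac{d-2}2+|\kappa| .$$ Let $\sigma$ be the surface measure on the unit sphere $\mathbb S^{d-1}$ of $\mathbb R^d$, and let $L^2(h_\kappa^2;\mathbb S^{d-1})$ be the space of complex-valued functions that are square-integrable with respect to $h_\kappa^2\,d\sigma$. Let $\Pi_n^d$ be the space of restrictions to $\mathbb S^{d-1}$ of polynomials of total degree at most $n$ in $d$ variables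 ($\Pi_{-1}^d=\{0\}$), let $\mathcal H_n^d(h_\kappa^2)$ (the spherical $h$-harmonics of degree $n$) be the orthogonal complement of $\Pi_{n-1}^d$ in $\Pi_n^d$ with respect to the inner product of $L^2(h_\kappa^2;\mathbb S^{d-1})$, and let $\mathrm{proj}_n:L^2(h_\kappa^2;\mathbb S^{d-1})\to\mathcal H_n^d(h_\kappa^2)$ be the orthogonal projection. For $f\in L^2(h_\kappa^2;\mathbb S^{d-1})$, the function $\sqrt{-\Delta_{\kappa,0}}\,f$ is the element $g$ of $L^2(h_\kappa^2;\mathbb S^{d-1})$, if there is one, such that $$\mathrm{proj}_n\, g=\bigl(n(n+2\lambda_\kappa)\bigr)^{1/2}\,\mathrm{proj}_n f\qquad\text{for all } n=0,1,2,\dots$$ **Theorem.** There is a constant $C_{d,\kappa}>0$, depending only on $d$ and $\kappa$ (with its domain $\mathcal R$), such that for every $f\in C^1(\mathbb S^{d-1})$ (real- or complex-valued) with $$\int_{\mathbb S^{d-1}} f\,h_\kappa^2\,d\sigma=0\qquad\text{and}\qquad \int_{\mathbb S^{d-1}}|f|^2h_\kappa^2\,d\sigma=1,$$ the function $\sqrt{-\Delta_{\kappa,0}}\,f$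 exists in $L^2(h_\kappa^2;\mathbb S^{d-1})$ and is unique, the minimum below is attained, and $$\Bigl[\min_{y\in\mathbb S^{d-1}}\int_{\mathbb S^{d-1}}(1-\langle x,y\rangle)|f(x)|^2h_\kappa^2(x)\,d\sigma(x)\Bigr]\Bigl[\int_{\mathbb S^{d-1}}\bigl|\sqrt{-\Delta_{\kappa,0}}\,f(x)\bigr|^2h_\kappa^2(x)\,d\sigma(x)\Bigr]\ge C_{d,\kappa}.$$ The minimum is over all $y\in\mathbb S^{d-1}$, and $f$ is not required to be $G$-invariant. -/

import Mathlib

open MeasureTheory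
open scoped NNReal RealInnerProductSpace Manifold ContDiff

namespace DunklSphere

/-- The Euclidean space `ℝ^d`. -/
abbrev Space (d : ℕ) : Type := EuclideanSpace ℝ (Fin d)

/-- The unit sphere `S^{d-1}` of `ℝ^d`. -/
abbrev Sph (d : ℕ) : Type := Metric.sphere (0 : Space d) 1

/-- The reflection `σ_v` in the hyperplane perpendicular to `v`
(for `v ≠ 0`, `σ_v x = x - 2 ⟪x, v⟫ / ‖v‖² • v`). -/
noncomputable def refl {d : ℕ} (v : Space d) : Space d ≃ₗᵢ[ℝ] Space d :=
  (ℝ ∙ v)ᗮ.reflection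

theorem refl_apply {d : ℕ} (v x : Space d) :
    refl v x = x - (2 * ⟪x, v⟫ / ‖v‖ ^ 2) • v := by
  rw [refl, Submodule.reflection_orthogonal_apply, Submodule.reflection_singleton_apply,
    real_inner_comm]
  simp only [RCLike.ofReal_real_eq_id, id_eq, neg_sub, two_smul, ← add_smul]
  congr 2
  ring

/-- A (reduced, possibly empty) root system, normalized so that `⟪v, v⟫ = 2` for every root. -/
def IsRootSystem {d : ℕ} (R : Finset (Space d)) : Prop :=
  (∀ v ∈ R, ⟪v, v⟫ = 2) ∧ ∀ u ∈ R, ∀ v ∈ R, refl u v ∈ R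

/-- The finite reflection group of a root system: the subgroup of `O(d)` generated by the
reflections `σ_v`, `v ∈ R`. -/
noncomputable def reflectionGroup {d : ℕ} (R : Finset (Space d)) : Subgroup (Space d ≃ₗᵢ[ℝ] Space d) :=
  Subgroup.closure (refl '' (R : Set (Space d)))

/-- `P` is a positive subsystem of `R`: the roots lying strictly on one side of a hyperplane
that contains no root. -/
def IsPositiveSubsystem {d : ℕ} (R P : Finset (Space d)) : Prop :=
  ∃ u : Space d, (∀ v ∈ R, ⟪u, v⟫ ≠ 0) ∧ ∀ v, v ∈ P ↔ v ∈ R ∧ 0 < ⟪u, v⟫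

/-- `κ` is a multiplicity function: it is invariant under the reflection group on the roots.
Only the values of `κ` on `R` are ever used. -/
def IsMultiplicity {d : ℕ} (R : Finset (Space d)) (κ : Space d → ℝ≥0) : Prop :=
  ∀ g ∈ reflectionGroup R, ∀ v ∈ R, κ (g v) = κ v

/-- The weight `h_κ(x) = ∏_{v ∈ R₊} |⟪x, v⟫| ^ κ_v`. -/
noncomputable def weight {d : ℕ} (P : Finset (Space d)) (κ : Space d → ℝ≥0) (x : Space d) : ℝ :=
  ∏ v ∈ P, |⟪x, v⟫| ^ (κ v : ℝ)

/-- `λ_κ = (d - 2) / 2 + |κ|` with `|κ| = ∑_{v ∈ R₊} κ_v`. -/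
noncomputable def lam {d : ℕ} (P : Finset (Space d)) (κ : Space d → ℝ≥0) : ℝ :=
  ((d : ℝ) - 2) / 2 + ∑ v ∈ P, (κ v : ℝ)

/-- The measure `h_κ² dσ` on the sphere, `σ` being the surface measure. -/
noncomputable def wMeasure {d : ℕ} (P : Finset (Space d)) (κ : Space d → ℝ≥0) :
    Measure (Sph d) :=
  ((volume : Measure (Space d)).toSphere).withDensity
    fun x => ENNReal.ofReal (weight P κ (x : Space d) ^ 2)

theorem continuous_weight {d : ℕ} (P : Finset (Space d)) (κ : Space d → ℝ≥0) :
    Continuous (weight P κ) := by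
  unfold weight
  refine continuous_finsetProd _ fun v _ => ?_
  exact Continuous.rpow_const (by fun_prop) fun x => Or.inr (κ v).2

instance instIsFiniteMeasureWMeasure {d : ℕ} (P : Finset (Space d)) (κ : Space d → ℝ≥0) :
    IsFiniteMeasure (wMeasure P κ) := by
  have hc : Continuous fun x : Sph d => weight P κ (x : Space d) ^ 2 :=
    ((continuous_weight P κ).comp continuous_subtype_val).pow 2
  have hi : Integrable (fun x : Sph d => weight P κ (x : Space d) ^ 2)
      (volume : Measure (Space d)).toSphere :=
    hc.integrable_of_hasCompactSupport (HasCompactSupport.of_compactSpace _)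
  exact isFiniteMeasure_withDensity_ofReal hi.2

/-- The Hilbert space `L²(h_κ²; S^{d-1})` of complex-valued functions. -/
abbrev L2 {d : ℕ} (P : Finset (Space d)) (κ : Space d → ℝ≥0) : Type :=
  Lp ℂ 2 (wMeasure P κ)

/-- The class in `L²(h_κ²; S^{d-1})` of a continuous function. -/
noncomputable def toL2 {d : ℕ} (P : Finset (Space d)) (κ : Space d → ℝ≥0) :
    C(Sph d, ℂ) →ₗ[ℂ] L2 P κ :=
  (ContinuousMap.toLp (E := ℂ) 2 (wMeasure P κ) ℂ).toLinearMap

/-- The coordinate function `x ↦ x_i` on the sphere. -/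
noncomputable def coord {d : ℕ} (i : Fin d) : C(Sph d, ℂ) where
  toFun x := (((x : Space d) i : ℝ) : ℂ)
  continuous_toFun := by fun_prop

/-- Restriction of a polynomial in `d` variables to the sphere. -/
noncomputable def restrictPoly (d : ℕ) : MvPolynomial (Fin d) ℂ →ₐ[ℂ] C(Sph d, ℂ) :=
  MvPolynomial.aeval coord

/-- The space `Π_n^d` of spherical polynomials of degree at most `n`, as a subspace of
`L²(h_κ²; S^{d-1})`. -/
noncomputable def sphPoly {d : ℕ} (P : Finset (Space d)) (κ : Space d → ℝ≥0) (n : ℕ) :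
    Submodule ℂ (L2 P κ) :=
  (MvPolynomial.restrictTotalDegree (Fin d) ℂ n).map
    (toL2 P κ ∘ₗ (restrictPoly d).toLinearMap)

/-- The space `H_n^d(h_κ²)` of spherical `h`-harmonics of degree `n`: the orthogonal complement
of `Π_{n-1}^d` in `Π_n^d` (with `Π_{-1}^d = 0`). -/
noncomputable def hHarmonic {d : ℕ} (P : Finset (Space d)) (κ : Space d → ℝ≥0) :
    ℕ → Submodule ℂ (L2 P κ)
  | 0 => sphPoly P κ 0
  | n + 1 => sphPoly P κ (n + 1) ⊓ (sphPoly P κ n)ᗮ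

instance instFiniteDimensionalSphPoly {d : ℕ} (P : Finset (Space d)) (κ : Space d → ℝ≥0)
    (n : ℕ) : FiniteDimensional ℂ (sphPoly P κ n) := by
  unfold sphPoly
  infer_instance

instance instFiniteDimensionalHHarmonic {d : ℕ} (P : Finset (Space d)) (κ : Space d → ℝ≥0)
    (n : ℕ) : FiniteDimensional ℂ (hHarmonic P κ n) := by
  cases n with
  | zero => exact instFiniteDimensionalSphPoly P κ 0
  | succ n => exact Submodule.finiteDimensional_inf_left _ _

/-- The orthogonal projection `proj_n(h_κ²) : L²(h_κ²; S^{d-1}) → H_n^d(h_κ²)`. -/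
noncomputable def proj {d : ℕ} (P : Finset (Space d)) (κ : Space d → ℝ≥0) (n : ℕ) :
    L2 P κ →L[ℂ] L2 P κ :=
  (hHarmonic P κ n).starProjection

/-- `g = (-Δ_{κ,0})^α f` in the distributional sense:
`proj_n g = (n (n + 2 λ_κ))^α proj_n f` for every `n`. -/
def IsFracPow {d : ℕ} (P : Finset (Space d)) (κ : Space d → ℝ≥0) (α : ℝ) (f g : L2 P κ) : Prop :=
  ∀ n : ℕ, proj P κ n g =
    ((((n : ℝ) * (n + 2 * lam P κ)) ^ α : ℝ) : ℂ) • proj P κ n f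

end DunklSphere

/-! Put `gap y x = 1 - ⟪x, y⟫`, which is `‖x - y‖² / 2` on the sphere. The heart of the proof is an
inequality for functions concentrated near a point. Integrating by parts `∇F · ∇gap` against `h_κ²
dσ`, with `F = |f|²` times a cutoff around `y`, gives `∫ (∇F · ∇gap + F B) = 0`, where `B = (d - 1 +
2|κ|) ⟪x, y⟫ - 2 ∑ κ_v ⟪y, v⟫ / ⟪x, v⟫` (`integral_gap_identity`). Near `y` a quotient is `0` if `v
⊥ y`, and close to `1` if `y` is far from the mirror of `v`. In that situation `B` is at least about
`d - 1`, so `B ≥ 1/2`. Since `|∇gap|² ≤ 2 gap`, Cauchy–Schwarz yields `local_uncertainty`. A center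
that is close to a mirror without lying on it is first moved onto the mirror, at the price of a
bounded factor in the scale (`exists_scale`).

The gradient must then be compared with the spectrally defined square root. The Dirichlet form
`energy` of the weight contains, besides the gradient, nonnegative jump terms `κ_v |f - f ∘ σ_v|² /
⟪x, v⟫²`, so it dominates `∫ |∇f|²`. On polynomials of degree at most `n` it is represented by
multiplication by `eig n = n (n + 2 λ_κ)` up to polynomials of lower degree (`exists_triangular`).
Symmetry of the form removes the lower part on `H_n` (`exists_eigen`). Hence partial sums of the
expansion of `f` have energy `∑ eig n ‖proj_n f‖²`, and Bessel's inequality for the form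
(`sum_eig_le`) gives the existence of `g`; uniqueness is the completeness of the `h`-harmonics.

Finally the local inequality is applied to the partial sums, whose gradients are controlled by
`‖g‖²`, and passes to the limit. If `f` is not concentrated anywhere, the spectral gap `‖g‖ ≥ ‖f‖ =
1` suffices; only there is the mean-zero condition needed. -/

namespace DunklSphere

/-! ### Rotations of the sphere and angular derivatives. -/

section Rotation

variable {d : ℕ}

/-- The action of a linear isometry on the unit sphere. -/
noncomputable def sphMap (U : Space d ≃ₗᵢ[ℝ] Space d) (x : Sph d) : Sph d :=
  ⟨U x, by simp⟩

@[simp]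
theorem coe_sphMap (U : Space d ≃ₗᵢ[ℝ] Space d) (x : Sph d) :
    ((sphMap U x : Sph d) : Space d) = U x := rfl

theorem continuous_sphMap (U : Space d ≃ₗᵢ[ℝ] Space d) : Continuous (sphMap U) := by
  unfold sphMap
  fun_prop

theorem measurableEmbedding_sphMap (U : Space d ≃ₗᵢ[ℝ] Space d) :
    MeasurableEmbedding (sphMap U) := by
  refine (continuous_sphMap U).measurableEmbedding fun x y h => ?_
  have := congrArg (fun z : Sph d => (z : Space d)) h
  simpa [Subtype.ext_iff] using this

-- The measure `toSphere` is a multiple of the volume of the cone over a set; linear isometries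
-- carry cones to cones and preserve volume.
open scoped Pointwise in
theorem measurePreserving_sphMap (U : Space d ≃ₗᵢ[ℝ] Space d) :
    MeasurePreserving (sphMap U) (volume : Measure (Space d)).toSphere
      (volume : Measure (Space d)).toSphere := by
  refine ⟨(continuous_sphMap U).measurable, ?_⟩
  ext s hs
  rw [Measure.map_apply (continuous_sphMap U).measurable hs,
    Measure.toSphere_apply' _ hs,
    Measure.toSphere_apply' _ ((continuous_sphMap U).measurable hs)]
  congr 1
  have h := (U.measurePreserving).measure_preimage_equiv
    (f := U.toHomeomorph.toMeasurableEquiv) (Set.Ioo (0 : ℝ) 1 • ((↑) '' s : Set (Space d)))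
  rw [← h]
  congr 1
  ext x
  simp only [Set.mem_smul, Set.mem_image, Set.mem_preimage]
  constructor
  · rintro ⟨r, hr, _, ⟨y, hy, rfl⟩, rfl⟩
    exact ⟨r, hr, _, ⟨_, hy, rfl⟩, by simp⟩
  · rintro ⟨r, hr, _, ⟨y, hy, rfl⟩, h⟩
    refine ⟨r, hr, _, ⟨sphMap U.symm y, ?_, rfl⟩, ?_⟩
    · convert hy
      simp [Subtype.ext_iff]
    · have h' : r • (y : Space d) = U x := h
      apply U.injective
      simp [h']

theorem integral_comp_sphMap (U : Space d ≃ₗᵢ[ℝ] Space d) (F : Sph d → ℂ) :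
    ∫ x, F (sphMap U x) ∂(volume : Measure (Space d)).toSphere =
      ∫ x, F x ∂(volume : Measure (Space d)).toSphere :=
  (measurePreserving_sphMap U).integral_comp (measurableEmbedding_sphMap U) F

/-- The vector field generating the rotations of the `(i, j)`-plane. -/
noncomputable def rotGen (i j : Fin d) (x : Space d) : Space d :=
  x i • EuclideanSpace.single j (1 : ℝ) - x j • EuclideanSpace.single i (1 : ℝ)

/-- The angular derivative `x_i ∂_j f - x_j ∂_i f`. -/
noncomputable def angD (i j : Fin d) (f : Space d → ℂ) (x : Space d) : ℂ :=
  fderiv ℝ f x (rotGen i j x)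

/-- The rotation by the angle `t` in the `(i, j)`-plane. -/
noncomputable def rotMap (i j : Fin d) (t : ℝ) : Space d →ₗ[ℝ] Space d where
  toFun x := x + ((Real.cos t - 1) * x i - Real.sin t * x j) • EuclideanSpace.single i (1 : ℝ) +
    (Real.sin t * x i + (Real.cos t - 1) * x j) • EuclideanSpace.single j (1 : ℝ)
  map_add' x y := by
    simp only [PiLp.add_apply]
    module
  map_smul' c x := by
    simp only [PiLp.smul_apply, smul_eq_mul, RingHom.id_apply]
    module

theorem norm_rotMap {i j : Fin d} (hij : i ≠ j) (t : ℝ) (x : Space d) :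
    ‖rotMap i j t x‖ = ‖x‖ := by
  have h : ‖rotMap i j t x‖ ^ 2 = ‖x‖ ^ 2 := by
    rw [← real_inner_self_eq_norm_sq, ← real_inner_self_eq_norm_sq]
    simp only [rotMap, LinearMap.coe_mk, AddHom.coe_mk, inner_add_left, inner_add_right,
      inner_smul_left, inner_smul_right, EuclideanSpace.inner_single_left,
      EuclideanSpace.inner_single_right, PiLp.single_apply, hij, hij.symm]
    simp
    linear_combination (x i ^ 2 + x j ^ 2) * Real.sin_sq_add_cos_sq t
  exact (sq_eq_sq₀ (norm_nonneg _) (norm_nonneg _)).1 h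

/-- The rotation in the `(i, j)`-plane as a linear isometry. -/
noncomputable def rotIso {i j : Fin d} (hij : i ≠ j) (t : ℝ) : Space d ≃ₗᵢ[ℝ] Space d :=
  (⟨rotMap i j t, norm_rotMap hij t⟩ : Space d →ₗᵢ[ℝ] Space d).toLinearIsometryEquiv rfl

theorem rotIso_apply {i j : Fin d} (hij : i ≠ j) (t : ℝ) (x : Space d) :
    rotIso hij t x = x + ((Real.cos t - 1) * x i - Real.sin t * x j) •
      EuclideanSpace.single i (1 : ℝ) +
      (Real.sin t * x i + (Real.cos t - 1) * x j) • EuclideanSpace.single j (1 : ℝ) := rfl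

theorem hasDerivAt_rotIso {i j : Fin d} (hij : i ≠ j) (x : Space d) (t : ℝ) :
    HasDerivAt (fun t => rotIso hij t x) (rotGen i j (rotIso hij t x)) t := by
  simp only [rotIso_apply]
  have hc := Real.hasDerivAt_cos t
  have hs := Real.hasDerivAt_sin t
  have h1 := ((((hc.sub_const 1).mul_const (x i)).sub (hs.mul_const (x j))).smul_const
    (EuclideanSpace.single i (1 : ℝ)))
  have h2 := ((((hs.mul_const (x i))).add ((hc.sub_const 1).mul_const (x j))).smul_const
    (EuclideanSpace.single j (1 : ℝ)))
  refine ((h1.const_add x).add h2).congr_deriv ?_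
  simp only [rotGen, PiLp.add_apply, PiLp.smul_apply, PiLp.single_apply, hij, hij.symm,
    smul_eq_mul, if_true, if_false]
  module

theorem continuous_rotGen (i j : Fin d) : Continuous (rotGen i j) := by
  unfold rotGen
  fun_prop

theorem continuous_angD (i j : Fin d) {f : Space d → ℂ} (hf : ContDiff ℝ 1 f) :
    Continuous (angD i j f) :=
  (hf.continuous_fderiv one_ne_zero).clm_apply (continuous_rotGen i j)

theorem integrable_toSphere {E : Type*} [NormedAddCommGroup E] {F : Sph d → E}
    (hF : Continuous F) : Integrable F (volume : Measure (Space d)).toSphere :=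
  hF.integrable_of_hasCompactSupport (HasCompactSupport.of_compactSpace _)

theorem exists_bound_sph {E : Type*} [NormedAddCommGroup E] {F : Space d → E}
    (hF : Continuous F) : ∃ C : ℝ, 0 ≤ C ∧ ∀ x : Sph d, ‖F x‖ ≤ C := by
  obtain ⟨C, hC⟩ := (isCompact_sphere (0 : Space d) 1).exists_bound_of_continuousOn
    hF.continuousOn
  exact ⟨max C 0, le_max_right _ _, fun x => (hC x x.2).trans (le_max_left _ _)⟩

/-- The integral of `f` composed with a rotation does not depend on the angle; differentiate at
angle `0` under the integral sign. Every integration by parts below comes from this fact. -/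
theorem integral_angD (i j : Fin d) {f : Space d → ℂ} (hf : ContDiff ℝ 1 f) :
    ∫ x : Sph d, angD i j f x ∂(volume : Measure (Space d)).toSphere = 0 := by
  by_cases hij : i = j
  · subst hij
    simp [angD, rotGen]
  obtain ⟨C, -, hC⟩ := exists_bound_sph (continuous_angD i j hf)
  have key := hasDerivAt_integral_of_dominated_loc_of_deriv_le
    (μ := (volume : Measure (Space d)).toSphere) (x₀ := (0 : ℝ)) (s := Set.univ)
    (F := fun t (x : Sph d) => f (rotIso hij t x))
    (F' := fun t (x : Sph d) => angD i j f (rotIso hij t x)) (bound := fun _ => C)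
    Filter.univ_mem ?_ ?_ ?_ ?_ (integrable_const C) ?_
  · have h0 := key.2
    have hconst : (fun t => ∫ x : Sph d, f (rotIso hij t x)
        ∂(volume : Measure (Space d)).toSphere) =
        fun _ => ∫ x : Sph d, f x ∂(volume : Measure (Space d)).toSphere := by
      funext t
      exact integral_comp_sphMap (rotIso hij t) (fun x => f x)
    rw [hconst] at h0
    have h1 := h0.unique (hasDerivAt_const _ _)
    rw [← h1]
    simp [rotIso_apply]
  · refine Filter.Eventually.of_forall fun t => Continuous.aestronglyMeasurable ?_
    have := hf.continuous
    fun_prop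
  · apply integrable_toSphere
    have := hf.continuous
    fun_prop
  · refine Continuous.aestronglyMeasurable ?_
    have := continuous_angD i j hf
    fun_prop
  · refine Filter.Eventually.of_forall fun x t _ => ?_
    exact hC (sphMap (rotIso hij t) x)
  · refine Filter.Eventually.of_forall fun x t _ => ?_
    exact ((hf.differentiable one_ne_zero) _).hasFDerivAt.comp_hasDerivAt t
      (hasDerivAt_rotIso hij x t)

end Rotation

/-! ### Polynomials as functions and their differential operators. -/

section Polynomials

variable {d : ℕ}

open MvPolynomial

/-- The value at a real point of a polynomial with complex coefficients. -/
noncomputable def ev (p : MvPolynomial (Fin d) ℂ) (x : Space d) : ℂ :=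
  eval (fun i => ((x i : ℝ) : ℂ)) p

@[simp] theorem ev_add (p q : MvPolynomial (Fin d) ℂ) (x : Space d) :
    ev (p + q) x = ev p x + ev q x := by simp [ev]

@[simp] theorem ev_sub (p q : MvPolynomial (Fin d) ℂ) (x : Space d) :
    ev (p - q) x = ev p x - ev q x := by simp [ev]

@[simp] theorem ev_neg (p : MvPolynomial (Fin d) ℂ) (x : Space d) :
    ev (-p) x = -ev p x := by simp [ev]

@[simp] theorem ev_mul (p q : MvPolynomial (Fin d) ℂ) (x : Space d) :
    ev (p * q) x = ev p x * ev q x := by simp [ev]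

@[simp] theorem ev_C (c : ℂ) (x : Space d) : ev (C c) x = c := by simp [ev]

@[simp] theorem ev_zero (x : Space d) : ev 0 x = 0 := by simp [ev]

@[simp] theorem ev_one (x : Space d) : ev 1 x = 1 := by simp [ev]

@[simp] theorem ev_X (i : Fin d) (x : Space d) : ev (X i) x = ((x i : ℝ) : ℂ) := by simp [ev]

@[simp] theorem ev_sum {ι : Type*} (s : Finset ι) (p : ι → MvPolynomial (Fin d) ℂ) (x : Space d) :
    ev (∑ i ∈ s, p i) x = ∑ i ∈ s, ev (p i) x := by simp [ev]

theorem restrictPoly_apply (p : MvPolynomial (Fin d) ℂ) (x : Sph d) :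
    restrictPoly d p x = ev p x := by
  induction p using MvPolynomial.induction_on with
  | C a => simp [restrictPoly, Algebra.algebraMap_eq_smul_one]
  | add p q hp hq => simp [hp, hq]
  | mul_X p i hp =>
    have : restrictPoly d (X i) x = ((x : Space d) i : ℝ) := by simp [restrictPoly, coord]
    rw [map_mul, ContinuousMap.mul_apply, hp, this, ev_mul, ev_X]

/-- The directional derivative `∂_v p`. -/
noncomputable def dirP (v : Space d) (p : MvPolynomial (Fin d) ℂ) : MvPolynomial (Fin d) ℂ :=
  ∑ i, C ((v i : ℝ) : ℂ) * pderiv i p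

/-- The Euler operator `x ⬝ ∇ p`. -/
noncomputable def eulP (p : MvPolynomial (Fin d) ℂ) : MvPolynomial (Fin d) ℂ :=
  ∑ i, X i * pderiv i p

/-- The angular derivative `x_i ∂_j p - x_j ∂_i p`. -/
noncomputable def angP (i j : Fin d) (p : MvPolynomial (Fin d) ℂ) : MvPolynomial (Fin d) ℂ :=
  X i * pderiv j p - X j * pderiv i p

/-- The spherical Laplacian `∑_{i < j} (x_i ∂_j - x_j ∂_i)² p`. -/
noncomputable def sphLapP (p : MvPolynomial (Fin d) ℂ) : MvPolynomial (Fin d) ℂ :=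
  C (1 / 2) * ∑ i, ∑ j, angP i j (angP i j p)

theorem dirP_mul_X (v : Space d) (p : MvPolynomial (Fin d) ℂ) (i : Fin d) :
    dirP v (p * X i) = dirP v p * X i + p * C ((v i : ℝ) : ℂ) := by
  simp only [dirP, Derivation.leibniz, smul_eq_mul, mul_add, Finset.sum_add_distrib,
    Finset.sum_mul]
  rw [add_comm]
  congr 1
  · exact Finset.sum_congr rfl fun j _ => by ring
  · rw [Finset.sum_eq_single i]
    · simp [mul_comm]
    · intro j _ hj
      simp [pderiv_X, hj.symm]
    · simp

theorem hasFDerivAt_coordC (i : Fin d) (x : Space d) :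
    HasFDerivAt (fun x : Space d => ((x i : ℝ) : ℂ))
      (Complex.ofRealCLM.comp (EuclideanSpace.proj i : Space d →L[ℝ] ℝ)) x :=
  (Complex.ofRealCLM.comp (EuclideanSpace.proj i : Space d →L[ℝ] ℝ)).hasFDerivAt

theorem contDiff_ev (p : MvPolynomial (Fin d) ℂ) {n : ℕ∞ω} : ContDiff ℝ n (ev p) := by
  induction p using MvPolynomial.induction_on with
  | C a =>
    have : ev (C a) = fun _ : Space d => a := by funext y; simp
    rw [this]
    exact contDiff_const
  | add p q hp hq =>
    have : ev (p + q) = fun x => ev p x + ev q x := by funext y; simp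
    rw [this]
    exact hp.add hq
  | mul_X p i hp =>
    have : ev (p * X i) = fun x => ev p x * ((x i : ℝ) : ℂ) := by funext y; simp
    rw [this]
    exact hp.mul (Complex.ofRealCLM.comp (EuclideanSpace.proj i : Space d →L[ℝ] ℝ)).contDiff

theorem fderiv_ev (p : MvPolynomial (Fin d) ℂ) (x w : Space d) :
    fderiv ℝ (ev p) x w = ev (dirP w p) x := by
  induction p using MvPolynomial.induction_on with
  | C a =>
    have : ev (C a) = fun _ : Space d => a := by funext y; simp
    simp [this, dirP]
  | add p q hp hq =>
    have : ev (p + q) = ev p + ev q := by funext y; simp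
    rw [this, fderiv_add ((contDiff_ev p).differentiable one_ne_zero x)
      ((contDiff_ev q).differentiable one_ne_zero x)]
    simp [hp, hq, dirP, mul_add, Finset.sum_add_distrib]
  | mul_X p i hp =>
    have : ev (p * X i) = ev p * fun x : Space d => ((x i : ℝ) : ℂ) := by funext y; simp
    have h := ((contDiff_ev p (n := 1)).differentiable one_ne_zero x).hasFDerivAt.mul
      (hasFDerivAt_coordC i x)
    rw [this, h.fderiv, dirP_mul_X]
    simp [hp]
    ring

theorem angD_ev (i j : Fin d) (p : MvPolynomial (Fin d) ℂ) (x : Space d) :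
    angD i j (ev p) x = ev (angP i j p) x := by
  simp only [angD, fderiv_ev, rotGen, dirP, angP, ev_sum, ev_mul, ev_C, ev_sub, ev_X,
    PiLp.sub_apply, PiLp.smul_apply, PiLp.single_apply, smul_eq_mul]
  simp [sub_mul, Finset.sum_sub_distrib, apply_ite Complex.ofReal]

theorem sum_ofReal_sq (x : Sph d) : ∑ i, (((x : Space d) i : ℝ) : ℂ) ^ 2 = 1 := by
  have h := x.2
  rw [mem_sphere_zero_iff_norm, EuclideanSpace.norm_eq, Real.sqrt_eq_one] at h
  simp only [Real.norm_eq_abs, sq_abs] at h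
  exact_mod_cast h

theorem ofReal_inner (x v : Space d) :
    ((⟪x, v⟫ : ℝ) : ℂ) = ∑ i, ((x i : ℝ) : ℂ) * ((v i : ℝ) : ℂ) := by
  rw [PiLp.inner_apply]
  push_cast
  refine Finset.sum_congr rfl fun i _ => ?_
  simp [mul_comm]

/-- The factor `1 / 2` makes each pair `i < j` count once. For `x` on the unit sphere the right side
is the product of the tangential parts of `a` and `b`. -/
theorem lagrange_identity (x a b : Fin d → ℂ) :
    1 / 2 * ∑ i, ∑ j, (x i * a j - x j * a i) * (x i * b j - x j * b i) =
      (∑ i, x i ^ 2) * (∑ i, a i * b i) - (∑ i, x i * a i) * (∑ i, x i * b i) := by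
  have h : ∀ i j, (x i * a j - x j * a i) * (x i * b j - x j * b i) =
      x i ^ 2 * (a j * b j) - (x i * b i) * (x j * a j) - (x i * a i) * (x j * b j)
        + (a i * b i) * x j ^ 2 := fun i j => by ring
  simp only [h, Finset.sum_add_distrib, Finset.sum_sub_distrib, ← Finset.mul_sum,
    ← Finset.sum_mul]
  ring

theorem ev_dirP (v : Space d) (p : MvPolynomial (Fin d) ℂ) (x : Space d) :
    ev (dirP v p) x = ∑ i, ((v i : ℝ) : ℂ) * ev (pderiv i p) x := by
  simp [dirP]

theorem ev_eulP (p : MvPolynomial (Fin d) ℂ) (x : Space d) :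
    ev (eulP p) x = ∑ i, ((x i : ℝ) : ℂ) * ev (pderiv i p) x := by
  simp [eulP]

theorem ev_angP (i j : Fin d) (p : MvPolynomial (Fin d) ℂ) (x : Space d) :
    ev (angP i j p) x = ((x i : ℝ) : ℂ) * ev (pderiv j p) x - ((x j : ℝ) : ℂ) * ev (pderiv i p) x := by
  simp [angP]

/-- The second factor is the angular derivative of `⟪x, v⟫`, so this is the contraction of the
tangential gradient of `p` with the term that `v` contributes to the logarithmic derivative of the
weight. -/
theorem sum_angP_mul (p : MvPolynomial (Fin d) ℂ) (v : Space d) (x : Sph d) :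
    1 / 2 * ∑ i, ∑ j, ev (angP i j p) x *
      (((x : Space d) i : ℝ) * ((v j : ℝ) : ℂ) - ((x : Space d) j : ℝ) * ((v i : ℝ) : ℂ)) =
      ev (dirP v p) x - ((⟪(x : Space d), v⟫ : ℝ) : ℂ) * ev (eulP p) x := by
  simp only [ev_angP]
  rw [lagrange_identity, sum_ofReal_sq, ev_dirP, ev_eulP, ofReal_inner, one_mul,
    mul_comm (∑ i, _ * ev (pderiv i p) x)]
  simp only [mul_comm (ev (pderiv _ p) x)]

end Polynomials

/-! ### A smooth approximation of the weight. -/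

section RegularizedWeight

variable {d : ℕ}

/-- The regularized weight `∏_{v ∈ R₊} (⟪x, v⟫² + ε) ^ κ_v`. -/
noncomputable def regW (P : Finset (Space d)) (κ : Space d → ℝ≥0) (ε : ℝ) (x : Space d) : ℝ :=
  ∏ v ∈ P, (⟪x, v⟫ ^ 2 + ε) ^ (κ v : ℝ)

theorem regW_zero (P : Finset (Space d)) (κ : Space d → ℝ≥0) (x : Space d) :
    regW P κ 0 x = weight P κ x ^ 2 := by
  rw [regW, weight, ← Finset.prod_pow]
  refine Finset.prod_congr rfl fun v _ => ?_
  rw [add_zero, ← sq_abs, ← Real.rpow_natCast, ← Real.rpow_natCast, ← Real.rpow_mul (abs_nonneg _),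
    ← Real.rpow_mul (abs_nonneg _), mul_comm]

theorem regW_nonneg (P : Finset (Space d)) (κ : Space d → ℝ≥0) {ε : ℝ} (hε : 0 ≤ ε)
    (x : Space d) : 0 ≤ regW P κ ε x :=
  Finset.prod_nonneg fun v _ => by positivity

theorem regW_mono (P : Finset (Space d)) (κ : Space d → ℝ≥0) {ε δ : ℝ} (hε : 0 ≤ ε) (h : ε ≤ δ)
    (x : Space d) : regW P κ ε x ≤ regW P κ δ x :=
  Finset.prod_le_prod (fun v _ => by positivity) fun v _ =>
    Real.rpow_le_rpow (by positivity) (by linarith) (κ v).2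

theorem continuous_regW_left (P : Finset (Space d)) (κ : Space d → ℝ≥0) (x : Space d) :
    Continuous fun ε => regW P κ ε x := by
  unfold regW
  refine continuous_finsetProd _ fun v _ => ?_
  exact Continuous.rpow_const (by fun_prop) fun x => Or.inr (κ v).2

theorem continuous_regW (P : Finset (Space d)) (κ : Space d → ℝ≥0) (ε : ℝ) :
    Continuous (regW P κ ε) := by
  unfold regW
  refine continuous_finsetProd _ fun v _ => ?_
  exact Continuous.rpow_const (by fun_prop) fun x => Or.inr (κ v).2

/-- This is the purpose of `ε`: for small `κ_v` the weight `h_κ²` itself is not differentiable on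
the mirrors. -/
theorem contDiff_regW (P : Finset (Space d)) (κ : Space d → ℝ≥0) {ε : ℝ} (hε : 0 < ε) :
    ContDiff ℝ 1 (regW P κ ε) := by
  unfold regW
  refine contDiff_prod fun v _ => ?_
  refine ContDiff.rpow_const_of_ne ?_ fun x => by positivity
  exact ((contDiff_id.inner ℝ contDiff_const).pow 2).add contDiff_const

theorem hasFDerivAt_regW (P : Finset (Space d)) (κ : Space d → ℝ≥0) {ε : ℝ} (hε : 0 < ε)
    (x w : Space d) :
    fderiv ℝ (regW P κ ε) x w =
      regW P κ ε x * ∑ v ∈ P, 2 * (κ v : ℝ) * (⟪x, v⟫ / (⟪x, v⟫ ^ 2 + ε)) * ⟪w, v⟫ := by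
  classical
  have hv : ∀ v ∈ P, HasFDerivAt (fun x : Space d => (⟪x, v⟫ ^ 2 + ε) ^ (κ v : ℝ))
      (((κ v : ℝ) * (⟪x, v⟫ ^ 2 + ε) ^ ((κ v : ℝ) - 1)) •
        ((2 * ⟪x, v⟫) • innerSL ℝ v)) x := by
    intro v _
    have h1 : HasFDerivAt (fun x : Space d => ⟪x, v⟫) (innerSL ℝ v) x := by
      have := (innerSL ℝ v).hasFDerivAt (x := x)
      refine this.congr_of_eventuallyEq (Filter.Eventually.of_forall fun y => ?_)
      simp [real_inner_comm]
    have h2 := (h1.pow 2).add_const ε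
    have h3 := h2.rpow_const (p := (κ v : ℝ)) (Or.inl (by positivity))
    refine h3.congr_fderiv ?_
    simp
  have h := HasFDerivAt.finsetProd hv
  have h' : fderiv ℝ (regW P κ ε) x = _ := h.fderiv
  rw [h']
  simp only [sum_apply, smul_apply, smul_eq_mul,
    Finset.mul_sum]
  refine Finset.sum_congr rfl fun v hvP => ?_
  rw [regW, ← Finset.mul_prod_erase P _ hvP]
  have hpos : 0 < ⟪x, v⟫ ^ 2 + ε := by positivity
  rw [Real.rpow_sub_one hpos.ne']
  simp [real_inner_comm]
  ring

theorem inner_rotGen (i j : Fin d) (x v : Space d) :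
    ⟪rotGen i j x, v⟫ = x i * v j - x j * v i := by
  simp [rotGen, inner_sub_left, inner_smul_left, EuclideanSpace.inner_single_left]

end RegularizedWeight

/-! ### Invariance of the weight under reflections. -/

section Symmetry

variable {d : ℕ} {R P : Finset (Space d)} {κ : Space d → ℝ≥0}

theorem refl_apply_of_root {v : Space d} (hv : ⟪v, v⟫ = 2) (x : Space d) :
    refl v x = x - ⟪x, v⟫ • v := by
  rw [refl_apply, ← real_inner_self_eq_norm_sq, hv]
  congr 2
  ring

theorem refl_self {v : Space d} (hv : ⟪v, v⟫ = 2) : refl v v = -v := by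
  rw [refl_apply_of_root hv, hv]
  module

theorem refl_refl (v x : Space d) : refl v (refl v x) = x :=
  Submodule.reflection_reflection _ _

theorem inner_refl (v x y : Space d) : ⟪refl v x, y⟫ = ⟪x, refl v y⟫ := by
  conv_lhs => rw [← refl_refl v y]
  exact (refl v).inner_map_map _ _

theorem inner_refl_self {v : Space d} (hv : ⟪v, v⟫ = 2) (x : Space d) :
    ⟪refl v x, v⟫ = -⟪x, v⟫ := by
  rw [inner_refl, refl_self hv, inner_neg_right]

theorem IsPositiveSubsystem.subset (hP : IsPositiveSubsystem R P) : P ⊆ R := by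
  obtain ⟨u, -, h⟩ := hP
  exact fun v hv => ((h v).1 hv).1

theorem IsRootSystem.neg_mem (hR : IsRootSystem R) {v : Space d} (hv : v ∈ R) : -v ∈ R := by
  have := hR.2 v hv v hv
  rwa [refl_self (hR.1 v hv)] at this

theorem IsMultiplicity.map_refl (hκ : IsMultiplicity R κ) {u v : Space d} (hu : u ∈ R)
    (hv : v ∈ R) : κ (refl u v) = κ v :=
  hκ _ (Subgroup.subset_closure ⟨u, hu, rfl⟩) v hv

/-- The map `v ↦ -v` exchanges `P` and `R \ P`. -/
theorem IsPositiveSubsystem.prod_eq_sq (hR : IsRootSystem R) (hP : IsPositiveSubsystem R P)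
    (Φ : Space d → ℝ) (hΦ : ∀ v ∈ R, Φ (-v) = Φ v) : ∏ v ∈ R, Φ v = (∏ v ∈ P, Φ v) ^ 2 := by
  classical
  have hsub := hP.subset
  obtain ⟨u, h0, h⟩ := hP
  have hcompl : ∏ v ∈ R \ P, Φ v = ∏ v ∈ P, Φ v := by
    refine Finset.prod_nbij' (fun v => -v) (fun v => -v) ?_ ?_ (fun v _ => neg_neg v)
      (fun v _ => neg_neg v) ?_
    · intro v hv
      rw [Finset.mem_sdiff, h] at hv
      rw [h, inner_neg_right]
      refine ⟨hR.neg_mem hv.1, ?_⟩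
      have h1 : ¬ 0 < ⟪u, v⟫ := fun h1 => hv.2 ⟨hv.1, h1⟩
      have h2 := h0 v hv.1
      rcases lt_trichotomy ⟪u, v⟫ 0 with h3 | h3 | h3
      · linarith
      · exact absurd h3 h2
      · exact absurd h3 h1
    · intro v hv
      rw [h] at hv
      rw [Finset.mem_sdiff, h, inner_neg_right]
      exact ⟨hR.neg_mem hv.1, fun h1 => by linarith [h1.2, hv.2]⟩
    · intro v hv
      exact (hΦ v (Finset.mem_sdiff.1 hv).1).symm
  rw [← Finset.prod_sdiff hsub, hcompl, sq]

/-- A reflection permutes `R` but not `P`. Invariance is therefore read off the product over `R`,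
which is the square of the weight, and nonnegativity allows the root to be taken. -/
theorem regW_refl (hR : IsRootSystem R) (hκ : IsMultiplicity R κ) (hP : IsPositiveSubsystem R P)
    {ε : ℝ} (hε : 0 ≤ ε) {u : Space d} (hu : u ∈ R) (x : Space d) :
    regW P κ ε (refl u x) = regW P κ ε x := by
  have hneg : ∀ v ∈ R, κ (-v) = κ v := fun v hv => by
    rw [← refl_self (hR.1 v hv), hκ.map_refl hv hv]
  have h : ∀ y : Space d, ∏ v ∈ R, (⟪y, v⟫ ^ 2 + ε) ^ (κ v : ℝ) = regW P κ ε y ^ 2 := fun y =>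
    hP.prod_eq_sq hR _ fun v hv => by rw [inner_neg_right, neg_sq, hneg v hv]
  have h2 : regW P κ ε (refl u x) ^ 2 = regW P κ ε x ^ 2 := by
    rw [← h, ← h]
    refine Finset.prod_nbij' (fun v => refl u v) (fun v => refl u v) (fun v hv => hR.2 u hu v hv)
      (fun v hv => hR.2 u hu v hv) (fun v _ => refl_refl u v) (fun v _ => refl_refl u v) ?_
    intro v hv
    rw [inner_refl, hκ.map_refl hu hv]
  exact (sq_eq_sq₀ (regW_nonneg P κ hε _) (regW_nonneg P κ hε _)).1 h2

theorem integral_wMeasure {E : Type*} [NormedAddCommGroup E] [NormedSpace ℝ E] (F : Sph d → E) :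
    ∫ x, F x ∂(wMeasure P κ) =
      ∫ x : Sph d, regW P κ 0 x • F x ∂(volume : Measure (Space d)).toSphere := by
  have hc : Continuous fun x : Sph d => weight P κ (x : Space d) ^ 2 :=
    ((continuous_weight P κ).comp continuous_subtype_val).pow 2
  rw [wMeasure, integral_withDensity_eq_integral_toReal_smul
    (hc.measurable.ennreal_ofReal) (Filter.Eventually.of_forall fun x => ENNReal.ofReal_lt_top)]
  refine integral_congr_ae (Filter.Eventually.of_forall fun x => ?_)
  simp only [regW_zero]
  rw [ENNReal.toReal_ofReal (sq_nonneg _)]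

theorem integral_wMeasure_refl (hR : IsRootSystem R) (hκ : IsMultiplicity R κ)
    (hP : IsPositiveSubsystem R P) {u : Space d} (hu : u ∈ R) (F : Space d → ℂ) :
    ∫ x : Sph d, F (refl u x) ∂(wMeasure P κ) = ∫ x : Sph d, F x ∂(wMeasure P κ) := by
  rw [integral_wMeasure, integral_wMeasure,
    ← integral_comp_sphMap (refl u) (fun x => regW P κ 0 x • F x)]
  simp only [coe_sphMap, regW_refl hR hκ hP le_rfl hu]

end Symmetry

/-! ### Integration by parts for the regularized weight. -/

section IntegrationByParts

variable {d : ℕ} {R P : Finset (Space d)} {κ : Space d → ℝ≥0}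

open MvPolynomial Filter Topology

/-- The tangential gradient product `∑_{i < j} D_ij f * D_ij p`. -/
noncomputable def gradProd (f g : Space d → ℂ) (x : Space d) : ℂ :=
  1 / 2 * ∑ i, ∑ j, angD i j f x * angD i j g x

theorem continuous_gradProd {f g : Space d → ℂ} (hf : ContDiff ℝ 1 f) (hg : ContDiff ℝ 1 g) :
    Continuous (gradProd f g) := by
  unfold gradProd
  refine continuous_const.mul (continuous_finsetSum _ fun i _ => continuous_finsetSum _ fun j _ => ?_)
  exact (continuous_angD i j hf).mul (continuous_angD i j hg)

theorem angD_mul_ev_mul_regW {f : Space d → ℂ} (hf : ContDiff ℝ 1 f)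
    (q : MvPolynomial (Fin d) ℂ) {ε : ℝ} (hε : 0 < ε) (i j : Fin d) (x : Space d) :
    angD i j (fun x => f x * ev q x * (regW P κ ε x : ℂ)) x =
      (regW P κ ε x : ℂ) * (angD i j f x * ev q x + f x * ev (angP i j q) x +
        ∑ v ∈ P, 2 * (κ v : ℂ) * ((⟪x, v⟫ / (⟪x, v⟫ ^ 2 + ε) : ℝ) : ℂ) *
          (f x * (ev q x * ((x i : ℂ) * (v j : ℂ) - (x j : ℂ) * (v i : ℂ))))) := by
  have h1 := (hf.differentiable one_ne_zero x).hasFDerivAt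
  have h2 := ((contDiff_ev q (n := 1)).differentiable one_ne_zero x).hasFDerivAt
  have h3 := ((contDiff_regW P κ hε).differentiable one_ne_zero x).hasFDerivAt
  have h4 : HasFDerivAt (fun x => (regW P κ ε x : ℂ)) _ x :=
    Complex.ofRealCLM.hasFDerivAt.comp x h3
  have h5 : HasFDerivAt (fun x => f x * ev q x * (regW P κ ε x : ℂ)) _ x := (h1.mul h2).mul h4
  rw [angD, h5.fderiv]
  simp only [add_apply, smul_apply, smul_eq_mul, ContinuousLinearMap.comp_apply,
    hasFDerivAt_regW P κ hε, inner_rotGen, Complex.ofRealCLM_apply, Pi.mul_apply]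
  rw [← angD_ev]
  simp only [angD]
  push_cast
  have hs : ∑ v ∈ P, 2 * (κ v : ℂ) * ((⟪x, v⟫ : ℂ) / ((⟪x, v⟫ : ℂ) ^ 2 + ε)) *
      (f x * (ev q x * ((x i : ℂ) * (v j : ℂ) - (x j : ℂ) * (v i : ℂ)))) =
      f x * ev q x * ∑ v ∈ P, 2 * (κ v : ℂ) * ((⟪x, v⟫ : ℂ) / ((⟪x, v⟫ : ℂ) ^ 2 + ε)) *
      ((x i : ℂ) * (v j : ℂ) - (x j : ℂ) * (v i : ℂ)) := by
    rw [Finset.mul_sum]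
    exact Finset.sum_congr rfl fun v _ => by ring
  rw [hs]
  ring

theorem sum_angD_mul_regW {f : Space d → ℂ} (hf : ContDiff ℝ 1 f)
    (p : MvPolynomial (Fin d) ℂ) {ε : ℝ} (hε : 0 < ε) (x : Sph d) :
    1 / 2 * ∑ i, ∑ j, angD i j (fun x => f x * ev (angP i j p) x * (regW P κ ε x : ℂ)) x =
      (regW P κ ε x : ℂ) * (gradProd f (ev p) x + f x * ev (sphLapP p) x +
        ∑ v ∈ P, 2 * (κ v : ℂ) * ((⟪(x : Space d), v⟫ / (⟪(x : Space d), v⟫ ^ 2 + ε) : ℝ) : ℂ) *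
          (f x * (ev (dirP v p) x - ((⟪(x : Space d), v⟫ : ℝ) : ℂ) * ev (eulP p) x))) := by
  simp only [angD_mul_ev_mul_regW hf _ hε, ← Finset.mul_sum, Finset.sum_add_distrib]
  rw [mul_left_comm]
  congr 1
  simp only [mul_add]
  congr 1
  · congr 1
    · simp only [gradProd, angD_ev]
    · simp [sphLapP]
      ring
  · have : ∀ i : Fin d, ∑ j, ∑ v ∈ P, 2 * (κ v : ℂ) *
        ((⟪(x : Space d), v⟫ / (⟪(x : Space d), v⟫ ^ 2 + ε) : ℝ) : ℂ) *
          (f x * (ev (angP i j p) x * (((x : Space d) i : ℂ) * (v j : ℂ) -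
            ((x : Space d) j : ℂ) * (v i : ℂ)))) =
        ∑ v ∈ P, ∑ j, 2 * (κ v : ℂ) *
        ((⟪(x : Space d), v⟫ / (⟪(x : Space d), v⟫ ^ 2 + ε) : ℝ) : ℂ) *
          (f x * (ev (angP i j p) x * (((x : Space d) i : ℂ) * (v j : ℂ) -
            ((x : Space d) j : ℂ) * (v i : ℂ)))) := fun i => Finset.sum_comm
    simp only [this]
    rw [Finset.sum_comm, Finset.mul_sum]
    refine Finset.sum_congr rfl fun v _ => ?_
    rw [← sum_angP_mul]
    simp only [Finset.mul_sum]
    refine Finset.sum_congr rfl fun i _ => Finset.sum_congr rfl fun j _ => ?_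
    ring

/-- The integrand is the sum over pairs of the angular derivatives of `f · D_ij p · W_ε`, each of
integral zero. -/
theorem integral_regW_grad {f : Space d → ℂ} (hf : ContDiff ℝ 1 f)
    (p : MvPolynomial (Fin d) ℂ) {ε : ℝ} (hε : 0 < ε) :
    ∫ x : Sph d, (regW P κ ε x : ℂ) * (gradProd f (ev p) x + f x * ev (sphLapP p) x +
        ∑ v ∈ P, 2 * (κ v : ℂ) * ((⟪(x : Space d), v⟫ / (⟪(x : Space d), v⟫ ^ 2 + ε) : ℝ) : ℂ) *
          (f x * (ev (dirP v p) x - ((⟪(x : Space d), v⟫ : ℝ) : ℂ) * ev (eulP p) x)))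
      ∂(volume : Measure (Space d)).toSphere = 0 := by
  simp only [← sum_angD_mul_regW hf p hε]
  have hcd : ∀ i j, ContDiff ℝ 1
      (fun x => f x * ev (angP i j p) x * (regW P κ ε x : ℂ)) := fun i j =>
    (hf.mul (contDiff_ev _)).mul (Complex.ofRealCLM.contDiff.comp (contDiff_regW P κ hε))
  have hint : ∀ i j, Integrable (fun x : Sph d => angD i j
      (fun x => f x * ev (angP i j p) x * (regW P κ ε x : ℂ)) x)
      (volume : Measure (Space d)).toSphere := fun i j =>
    integrable_toSphere ((continuous_angD i j (hcd i j)).comp continuous_subtype_val)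
  rw [integral_const_mul, integral_finsetSum _ fun i _ => integrable_finsetSum _ fun j _ => hint i j]
  simp only [integral_finsetSum _ fun j _ => hint _ j, integral_angD _ _ (hcd _ _)]
  simp

/-- Mean value inequality in the unit ball, with `x - σ_v x = ⟪x, v⟫ v`. -/
theorem exists_bound_sub_refl {f : Space d → ℂ} (hf : ContDiff ℝ 1 f) {v : Space d}
    (hv : ⟪v, v⟫ = 2) :
    ∃ K : ℝ, 0 ≤ K ∧ ∀ x : Sph d, ‖f x - f (refl v x)‖ ≤ K * |⟪(x : Space d), v⟫| := by
  obtain ⟨C, hC⟩ := (isCompact_closedBall (0 : Space d) 1).exists_bound_of_continuousOn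
    (hf.continuous_fderiv one_ne_zero).continuousOn
  have hC0 : 0 ≤ C := (norm_nonneg _).trans (hC 0 (by simp))
  refine ⟨C * ‖v‖, by positivity, fun x => ?_⟩
  have h := (convex_closedBall (0 : Space d) 1).norm_image_sub_le_of_norm_fderiv_le
    (𝕜 := ℝ) (f := f) (fun y _ => hf.differentiable one_ne_zero y) hC (x := refl v x) (y := x)
    (by simp) (by simp)
  rw [refl_apply_of_root hv] at h ⊢
  refine h.trans_eq ?_
  rw [sub_sub_cancel, norm_smul, Real.norm_eq_abs]
  ring

/-- The quotient is odd under `σ_u` and the weight is even. The difference on the right is `O(⟪x,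
u⟫)` for `F` of class `C¹`, which permits `ε → 0`; without it, `1 / ⟪x, u⟫` need not be integrable
against `h_κ²`. -/
theorem integral_regW_symm (hR : IsRootSystem R) (hκ : IsMultiplicity R κ)
    (hP : IsPositiveSubsystem R P) {u : Space d} (hu : u ∈ R) {ε : ℝ} (hε : 0 < ε)
    {F : Space d → ℂ} (hF : Continuous F) :
    ∫ x : Sph d, (regW P κ ε x : ℂ) *
        (2 * ((⟪(x : Space d), u⟫ / (⟪(x : Space d), u⟫ ^ 2 + ε) : ℝ) : ℂ) * F x)
        ∂(volume : Measure (Space d)).toSphere =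
      ∫ x : Sph d, (regW P κ ε x : ℂ) *
        (((⟪(x : Space d), u⟫ / (⟪(x : Space d), u⟫ ^ 2 + ε) : ℝ) : ℂ) * (F x - F (refl u x)))
        ∂(volume : Measure (Space d)).toSphere := by
  have hw := (continuous_regW P κ ε)
  have hq : Continuous fun x : Space d => ⟪x, u⟫ / (⟪x, u⟫ ^ 2 + ε) := by
    refine Continuous.div (by fun_prop) (by fun_prop) fun x => by positivity
  have hr : Continuous (refl u) := (refl u).continuous
  set G : Space d → ℂ := fun x => (regW P κ ε x : ℂ) *
    (((⟪x, u⟫ / (⟪x, u⟫ ^ 2 + ε) : ℝ) : ℂ) * F x) with hG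
  have hGc : Continuous G := by fun_prop
  have hsym := integral_comp_sphMap (refl u) (fun x : Sph d => G x)
  have h1 : ∀ x : Sph d, (regW P κ ε x : ℂ) *
        (2 * ((⟪(x : Space d), u⟫ / (⟪(x : Space d), u⟫ ^ 2 + ε) : ℝ) : ℂ) * F x) =
      G x + G x := fun x => by
    simp only [hG]; ring
  have h2 : ∀ x : Sph d, (regW P κ ε x : ℂ) *
        (((⟪(x : Space d), u⟫ / (⟪(x : Space d), u⟫ ^ 2 + ε) : ℝ) : ℂ) * (F x - F (refl u x))) =
      G x + G (sphMap (refl u) x) := fun x => by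
    simp only [hG, coe_sphMap, regW_refl hR hκ hP hε.le hu, inner_refl_self (hR.1 u hu), neg_sq,
      neg_div]
    push_cast
    ring
  have i1 : Integrable (fun x : Sph d => G x) (volume : Measure (Space d)).toSphere :=
    integrable_toSphere (hGc.comp continuous_subtype_val)
  have i2 : Integrable (fun x : Sph d => G (sphMap (refl u) x))
      (volume : Measure (Space d)).toSphere :=
    integrable_toSphere (hGc.comp (continuous_subtype_val.comp (continuous_sphMap _)))
  simp only [h1, h2]
  rw [integral_add i1 i1, integral_add i1 i2, hsym]

end IntegrationByParts

/-! ### The limit `ε → 0`, the Dirichlet form and Green's formula. -/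

section Energy

variable {d : ℕ} {R P : Finset (Space d)} {κ : Space d → ℝ≥0}

open MvPolynomial Filter Topology

theorem continuous_regQuot {ε : ℝ} (hε : 0 < ε) (v : Space d) :
    Continuous fun x : Space d => ⟪x, v⟫ / (⟪x, v⟫ ^ 2 + ε) :=
  Continuous.div (by fun_prop) (by fun_prop) fun x => by positivity

/-- The regularized integrand of the symmetrized integration by parts formula. -/
noncomputable def symIntegrand (P : Finset (Space d)) (κ : Space d → ℝ≥0) (f : Space d → ℂ)
    (p : MvPolynomial (Fin d) ℂ) (ε : ℝ) (x : Space d) : ℂ :=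
  gradProd f (ev p) x + f x * ev (sphLapP p) x +
    ∑ v ∈ P, (κ v : ℂ) *
      (((⟪x, v⟫ / (⟪x, v⟫ ^ 2 + ε) : ℝ) : ℂ) *
        (f x * ev (dirP v p) x - f (refl v x) * ev (dirP v p) (refl v x)) -
      2 * ((⟪x, v⟫ / (⟪x, v⟫ ^ 2 + ε) * ⟪x, v⟫ : ℝ) : ℂ) * (f x * ev (eulP p) x))

theorem continuous_refl (v : Space d) : Continuous (refl v) := (refl v).continuous

theorem integral_symIntegrand (hR : IsRootSystem R) (hκ : IsMultiplicity R κ)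
    (hP : IsPositiveSubsystem R P) {f : Space d → ℂ} (hf : ContDiff ℝ 1 f)
    (p : MvPolynomial (Fin d) ℂ) {ε : ℝ} (hε : 0 < ε) :
    ∫ x : Sph d, (regW P κ ε x : ℂ) * symIntegrand P κ f p ε x
      ∂(volume : Measure (Space d)).toSphere = 0 := by
  have hfc := hf.continuous
  have hw := continuous_regW P κ ε
  have hev : ∀ q : MvPolynomial (Fin d) ℂ, Continuous (ev q) := fun q =>
    (contDiff_ev q (n := 1)).continuous
  have hq := continuous_regQuot hε (d := d)
  have hg := continuous_gradProd hf (contDiff_ev p)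
  have hr := continuous_refl (d := d)
  have e1 := hev (sphLapP p)
  have e2 := hev (eulP p)
  have e3 := fun v => hev (dirP v p)
  have h0 := integral_regW_grad (P := P) (κ := κ) hf p hε
  set A : Space d → Space d → ℂ := fun v x => (regW P κ ε x : ℂ) *
    (2 * ((⟪x, v⟫ / (⟪x, v⟫ ^ 2 + ε) : ℝ) : ℂ) * (f x * ev (dirP v p) x)) with hA
  set B : Space d → Space d → ℂ := fun v x => (regW P κ ε x : ℂ) *
    (((⟪x, v⟫ / (⟪x, v⟫ ^ 2 + ε) : ℝ) : ℂ) *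
      (f x * ev (dirP v p) x - f (refl v x) * ev (dirP v p) (refl v x))) with hB
  have hAc : ∀ v, Continuous (A v) := fun v => by
    have := hq v; have := e3 v; have := hr v
    fun_prop
  have hBc : ∀ v, Continuous (B v) := fun v => by
    have := hq v; have := e3 v; have := hr v
    fun_prop
  have iA : ∀ v, Integrable (fun x : Sph d => A v x) (volume : Measure (Space d)).toSphere :=
    fun v => integrable_toSphere ((hAc v).comp continuous_subtype_val)
  have iB : ∀ v, Integrable (fun x : Sph d => B v x) (volume : Measure (Space d)).toSphere :=
    fun v => integrable_toSphere ((hBc v).comp continuous_subtype_val)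
  have hAB : ∀ v ∈ P, ∫ x : Sph d, A v x ∂(volume : Measure (Space d)).toSphere =
      ∫ x : Sph d, B v x ∂(volume : Measure (Space d)).toSphere := fun v hv =>
    integral_regW_symm hR hκ hP (hP.subset hv) hε (F := fun x => f x * ev (dirP v p) x)
      (hfc.mul (e3 v))
  have iAB : ∀ v, Integrable (fun x : Sph d => (κ v : ℂ) * (A v x - B v x))
      (volume : Measure (Space d)).toSphere := fun v => ((iA v).sub (iB v)).const_mul _
  have hdiff : ∫ x : Sph d, ∑ v ∈ P, (κ v : ℂ) * (A v x - B v x)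
      ∂(volume : Measure (Space d)).toSphere = 0 := by
    rw [integral_finsetSum _ fun v _ => iAB v]
    refine Finset.sum_eq_zero fun v hv => ?_
    rw [integral_const_mul, integral_sub (iA v) (iB v), hAB v hv, sub_self, mul_zero]
  have hI : Integrable (fun x : Sph d => (regW P κ ε x : ℂ) * (gradProd f (ev p) x +
      f x * ev (sphLapP p) x +
        ∑ v ∈ P, 2 * (κ v : ℂ) * ((⟪(x : Space d), v⟫ / (⟪(x : Space d), v⟫ ^ 2 + ε) : ℝ) : ℂ) *
          (f x * (ev (dirP v p) x - ((⟪(x : Space d), v⟫ : ℝ) : ℂ) * ev (eulP p) x))))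
      (volume : Measure (Space d)).toSphere := by
    refine integrable_toSphere (Continuous.comp (g := fun x : Space d => (regW P κ ε x : ℂ) *
      (gradProd f (ev p) x + f x * ev (sphLapP p) x +
        ∑ v ∈ P, 2 * (κ v : ℂ) * ((⟪(x : Space d), v⟫ / (⟪(x : Space d), v⟫ ^ 2 + ε) : ℝ) : ℂ) *
          (f x * (ev (dirP v p) x - ((⟪(x : Space d), v⟫ : ℝ) : ℂ) * ev (eulP p) x))))
          ?_ continuous_subtype_val)
    refine (Complex.continuous_ofReal.comp hw).mul ((hg.add (hfc.mul e1)).add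
      (continuous_finsetSum _ fun v _ => ?_))
    have := hq v; have := e3 v
    fun_prop
  have hD : Integrable (fun x : Sph d => ∑ v ∈ P, (κ v : ℂ) * (A v x - B v x))
      (volume : Measure (Space d)).toSphere :=
    integrable_finsetSum _ fun v _ => iAB v
  have key := integral_sub hI hD
  rw [h0, hdiff, sub_zero] at key
  rw [← key]
  congr 1
  funext x
  simp only [symIntegrand, hA, hB]
  rw [mul_add, mul_add _ _ (∑ v ∈ P, _), add_sub_assoc, Finset.mul_sum, Finset.mul_sum,
    ← Finset.sum_sub_distrib]
  congr 1
  refine Finset.sum_congr rfl fun v _ => ?_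
  push_cast
  ring

/-- At `a = 0` both sides are `0` by the convention `0 / 0 = 0`, so convergence holds on the mirrors
too. -/
theorem tendsto_regQuot (a : ℝ) :
    Tendsto (fun n : ℕ => a / (a ^ 2 + 1 / ((n : ℝ) + 1))) atTop (𝓝 (a / (a ^ 2 + 0))) := by
  by_cases ha : a = 0
  · simp [ha]
  · exact tendsto_const_nhds.div (tendsto_const_nhds.add tendsto_one_div_add_atTop_nhds_zero_nat)
      (by positivity)

theorem norm_regQuot_mul_le {a ε : ℝ} (hε : 0 ≤ ε) : |a / (a ^ 2 + ε)| * |a| ≤ 1 := by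
  rw [← abs_mul, div_mul_eq_mul_div, ← sq, abs_of_nonneg (by positivity)]
  exact div_le_one_of_le₀ (by linarith) (by positivity)

/-- The bound is uniform in `ε`, as dominated convergence requires: the factor `⟪x, v⟫` gained by
each difference cancels the singular quotient. -/
theorem exists_bound_symIntegrand (hR : IsRootSystem R)
    (hP : IsPositiveSubsystem R P) {f : Space d → ℂ} (hf : ContDiff ℝ 1 f)
    (p : MvPolynomial (Fin d) ℂ) :
    ∃ C : ℝ, 0 ≤ C ∧ ∀ ε, 0 ≤ ε → ∀ x : Sph d, ‖symIntegrand P κ f p ε x‖ ≤ C := by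
  have hev : ∀ q : MvPolynomial (Fin d) ℂ, Continuous (ev q) := fun q =>
    (contDiff_ev q (n := 1)).continuous
  obtain ⟨C0, hC0, h0⟩ := exists_bound_sph ((continuous_gradProd hf (contDiff_ev p)).add
    (hf.continuous.mul (hev (sphLapP p))))
  obtain ⟨C1, hC1, h1⟩ := exists_bound_sph (hf.continuous.mul (hev (eulP p)))
  have hK : ∀ v ∈ P, ∃ K : ℝ, 0 ≤ K ∧ ∀ x : Sph d, ‖f x * ev (dirP v p) x -
      f (refl v x) * ev (dirP v p) (refl v x)‖ ≤ K * |⟪(x : Space d), v⟫| := fun v hv =>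
    exists_bound_sub_refl (hf.mul (contDiff_ev (dirP v p))) (hR.1 v (hP.subset hv))
  choose! K hK0 hK using hK
  refine ⟨C0 + ∑ v ∈ P, (κ v : ℝ) * (K v + 2 * C1), ?_, fun ε hε x => ?_⟩
  · exact add_nonneg hC0 (Finset.sum_nonneg fun v hv =>
      mul_nonneg (κ v).2 (add_nonneg (hK0 v hv) (by positivity)))
  unfold symIntegrand
  refine (norm_add_le _ _).trans (add_le_add (h0 x) ((norm_sum_le _ _).trans
    (Finset.sum_le_sum fun v hv => ?_)))
  rw [norm_mul]
  refine mul_le_mul (by simp) ((norm_sub_le _ _).trans (add_le_add ?_ ?_)) (norm_nonneg _)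
    (κ v).2
  · rw [norm_mul, Complex.norm_real, Real.norm_eq_abs]
    calc _ ≤ |⟪(x : Space d), v⟫ / (⟪(x : Space d), v⟫ ^ 2 + ε)| *
          (K v * |⟪(x : Space d), v⟫|) := by gcongr; exact hK v hv x
      _ = K v * (|⟪(x : Space d), v⟫ / (⟪(x : Space d), v⟫ ^ 2 + ε)| * |⟪(x : Space d), v⟫|) := by
          ring
      _ ≤ K v * 1 := mul_le_mul_of_nonneg_left (norm_regQuot_mul_le hε) (hK0 v hv)
      _ = K v := mul_one _
  · rw [norm_mul, norm_mul, Complex.norm_real, Real.norm_eq_abs, abs_mul]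
    have h2 := norm_regQuot_mul_le (a := ⟪(x : Space d), v⟫) hε
    calc _ ≤ ‖(2 : ℂ)‖ * 1 * C1 := by gcongr; exact h1 x
      _ = 2 * C1 := by simp

theorem integral_symIntegrand_zero (hR : IsRootSystem R) (hκ : IsMultiplicity R κ)
    (hP : IsPositiveSubsystem R P) {f : Space d → ℂ} (hf : ContDiff ℝ 1 f)
    (p : MvPolynomial (Fin d) ℂ) :
    ∫ x : Sph d, symIntegrand P κ f p 0 x ∂(wMeasure P κ) = 0 := by
  have hfc := hf.continuous
  have hev : ∀ q : MvPolynomial (Fin d) ℂ, Continuous (ev q) := fun q =>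
    (contDiff_ev q (n := 1)).continuous
  have hg := continuous_gradProd hf (contDiff_ev p)
  have hr := continuous_refl (d := d)
  have e1 := hev (sphLapP p)
  have e2 := hev (eulP p)
  have e3 := fun v => hev (dirP v p)
  obtain ⟨C, hC, hCb⟩ := exists_bound_symIntegrand (κ := κ) hR hP hf p
  -- All `ε` used are at most `1`, and the regularized weight increases with `ε`, so its value at
  -- `1` is a majorant.
  obtain ⟨W, hW, hWb⟩ := exists_bound_sph (continuous_regW P κ 1)
  have hε : ∀ n : ℕ, (0 : ℝ) < 1 / ((n : ℝ) + 1) := fun n => by positivity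
  have hlim := tendsto_integral_of_dominated_convergence
    (μ := (volume : Measure (Space d)).toSphere)
    (F := fun (n : ℕ) (x : Sph d) => (regW P κ (1 / ((n : ℝ) + 1)) x : ℂ) *
      symIntegrand P κ f p (1 / ((n : ℝ) + 1)) x)
    (f := fun x : Sph d => (regW P κ 0 x : ℂ) * symIntegrand P κ f p 0 x)
    (fun _ => W * C) ?_ (integrable_const _) ?_ ?_
  · simp only [integral_symIntegrand hR hκ hP hf p (hε _)] at hlim
    rw [integral_wMeasure]
    simp only [Complex.real_smul]
    exact tendsto_nhds_unique hlim tendsto_const_nhds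
  · intro n
    have hq := continuous_regQuot (hε n) (d := d)
    have hw := continuous_regW P κ (1 / ((n : ℝ) + 1))
    refine Continuous.aestronglyMeasurable (Continuous.comp (g := fun x : Space d =>
      (regW P κ (1 / ((n : ℝ) + 1)) x : ℂ) * symIntegrand P κ f p (1 / ((n : ℝ) + 1)) x)
      ?_ continuous_subtype_val)
    unfold symIntegrand
    refine (Complex.continuous_ofReal.comp hw).mul ((hg.add (hfc.mul e1)).add
      (continuous_finsetSum _ fun v _ => ?_))
    have := hq v; have := e3 v; have := hr v
    fun_prop
  · intro n
    refine Eventually.of_forall fun x => ?_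
    rw [norm_mul, Complex.norm_real]
    refine mul_le_mul ?_ (hCb _ (hε n).le x) (norm_nonneg _) hW
    refine le_trans ?_ (hWb x)
    rw [Real.norm_of_nonneg (regW_nonneg P κ (hε n).le _),
      Real.norm_of_nonneg (regW_nonneg P κ zero_le_one _)]
    refine regW_mono P κ (hε n).le ?_ _
    rw [div_le_one (by positivity)]
    linarith [Nat.cast_nonneg (α := ℝ) n]
  · refine Eventually.of_forall fun x => ?_
    have hwl : Tendsto (fun n : ℕ => (regW P κ (1 / ((n : ℝ) + 1)) x : ℂ)) atTop
        (𝓝 (regW P κ 0 x : ℂ)) :=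
      (Complex.continuous_ofReal.tendsto _).comp
        (((continuous_regW_left P κ (x : Space d)).tendsto 0).comp
          tendsto_one_div_add_atTop_nhds_zero_nat)
    refine hwl.mul ?_
    unfold symIntegrand
    refine tendsto_const_nhds.add (tendsto_finsetSum _ fun v _ => tendsto_const_nhds.mul ?_)
    have h1 := (Complex.continuous_ofReal.tendsto _).comp (tendsto_regQuot ⟪(x : Space d), v⟫)
    have h2 := (Complex.continuous_ofReal.tendsto _).comp
      ((tendsto_regQuot ⟪(x : Space d), v⟫).mul_const ⟪(x : Space d), v⟫)
    exact (h1.mul_const _).sub ((h2.const_mul 2).mul_const _)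

/-- The weight vanishes on the mirror of `v` when `κ_v ≠ 0`, so nothing about the surface measure of
the mirror is needed. -/
theorem ae_inner_ne_zero {v : Space d} (hv : v ∈ P) (hκv : κ v ≠ 0) :
    ∀ᵐ x : Sph d ∂(wMeasure P κ), ⟪(x : Space d), v⟫ ≠ 0 := by
  have hc : Continuous fun x : Sph d => weight P κ (x : Space d) ^ 2 :=
    ((continuous_weight P κ).comp continuous_subtype_val).pow 2
  rw [wMeasure, ae_withDensity_iff hc.measurable.ennreal_ofReal]
  refine Eventually.of_forall fun x hx h0 => hx ?_
  have : weight P κ (x : Space d) = 0 := by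
    refine Finset.prod_eq_zero hv ?_
    rw [h0, abs_zero, Real.zero_rpow (by exact_mod_cast hκv)]
  simp [this]

theorem integrable_of_bound {F : Sph d → ℂ} (hF : Measurable F) {C : ℝ} (hC : ∀ x, ‖F x‖ ≤ C) :
    Integrable F (wMeasure P κ) :=
  Integrable.of_bound hF.aestronglyMeasurable C (Eventually.of_forall hC)

theorem integrable_of_continuous {F : Space d → ℂ} (hF : Continuous F) :
    Integrable (fun x : Sph d => F x) (wMeasure P κ) :=
  (hF.comp continuous_subtype_val).integrable_of_hasCompactSupport
    (HasCompactSupport.of_compactSpace _)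

/-- The difference quotient product `(f - f ∘ σ_v) (g - g ∘ σ_v) / ⟪x, v⟫²`. -/
noncomputable def jump (v : Space d) (f g : Space d → ℂ) (x : Space d) : ℂ :=
  (f x - f (refl v x)) * (g x - g (refl v x)) / ((⟪x, v⟫ : ℝ) : ℂ) ^ 2

theorem integrable_jump {v : Space d} (hv : ⟪v, v⟫ = 2) {f g : Space d → ℂ}
    (hf : ContDiff ℝ 1 f) (hg : ContDiff ℝ 1 g) :
    Integrable (fun x : Sph d => jump v f g x) (wMeasure P κ) := by
  obtain ⟨K, hK0, hK⟩ := exists_bound_sub_refl hf hv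
  obtain ⟨L, hL0, hL⟩ := exists_bound_sub_refl hg hv
  have hr := continuous_refl v
  have hfc := hf.continuous
  have hgc := hg.continuous
  refine integrable_of_bound (C := K * L) ?_ fun x => ?_
  · unfold jump
    refine Measurable.div ?_ ?_
    · exact Continuous.measurable (by fun_prop)
    · exact Continuous.measurable (by fun_prop)
  · rw [jump, norm_div, norm_mul, norm_pow, Complex.norm_real, Real.norm_eq_abs]
    refine div_le_of_le_mul₀ (by positivity) (by positivity) ?_
    calc _ ≤ (K * |⟪(x : Space d), v⟫|) * (L * |⟪(x : Space d), v⟫|) :=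
          mul_le_mul (hK x) (hL x) (norm_nonneg _) (by positivity)
      _ = _ := by ring

/-- The integrand of the Dirichlet form of the Dunkl Laplacian on the sphere. -/
noncomputable def carre (P : Finset (Space d)) (κ : Space d → ℝ≥0) (f g : Space d → ℂ)
    (x : Space d) : ℂ :=
  gradProd f g x + ∑ v ∈ P, (κ v : ℂ) * jump v f g x

theorem integrable_carre (hR : IsRootSystem R) (hP : IsPositiveSubsystem R P) {f g : Space d → ℂ}
    (hf : ContDiff ℝ 1 f) (hg : ContDiff ℝ 1 g) :
    Integrable (fun x : Sph d => carre P κ f g x) (wMeasure P κ) :=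
  (integrable_of_continuous (continuous_gradProd hf hg)).add
    (integrable_finsetSum _ fun v hv =>
      (integrable_jump (hR.1 v (hP.subset hv)) hf hg).const_mul _)

/-- The Dirichlet form. -/
noncomputable def energy (P : Finset (Space d)) (κ : Space d → ℝ≥0) (f g : Space d → ℂ) : ℂ :=
  ∫ x : Sph d, carre P κ f g x ∂(wMeasure P κ)

/-- The expansion `hs`, read at `x` and at `σ_v x`, gives two expressions for `p - p ∘ σ_v`.
Inserting each where it fits turns the integrand into `κ_v` times `(f s) ∘ σ_v - f s`, whose
integral vanishes by invariance. -/
theorem integral_jump (hR : IsRootSystem R) (hκ : IsMultiplicity R κ)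
    (hP : IsPositiveSubsystem R P) {f : Space d → ℂ} (hf : ContDiff ℝ 1 f)
    {v : Space d} (hv : v ∈ P) {p s : MvPolynomial (Fin d) ℂ}
    (hs : ∀ x : Space d, ev p (refl v x) =
      ev p x - ((⟪x, v⟫ : ℝ) : ℂ) * ev (dirP v p) x + ((⟪x, v⟫ : ℝ) : ℂ) ^ 2 * ev s x) :
    ∫ x : Sph d, (κ v : ℂ) * (((⟪(x : Space d), v⟫ / (⟪(x : Space d), v⟫ ^ 2 + 0) : ℝ) : ℂ) *
        (f x * ev (dirP v p) x - f (refl v x) * ev (dirP v p) (refl v x)) - jump v f (ev p) x -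
        2 * (f x * ev s x)) ∂(wMeasure P κ) = 0 := by
  have hvR := hR.1 v (hP.subset hv)
  have hev : ∀ q : MvPolynomial (Fin d) ℂ, Continuous (ev q) := fun q =>
    (contDiff_ev q (n := 1)).continuous
  have hfc := hf.continuous
  have es := hev s
  have hr := continuous_refl v
  have hsym := integral_wMeasure_refl hR hκ hP (hP.subset hv) (fun x => f x * ev s x)
  have i1 : Integrable (fun x : Sph d => f x * ev s x) (wMeasure P κ) :=
    integrable_of_continuous (F := fun x => f x * ev s x) (by fun_prop)
  have i2 : Integrable (fun x : Sph d => f (refl v x) * ev s (refl v x)) (wMeasure P κ) :=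
    integrable_of_continuous (F := fun x => f (refl v x) * ev s (refl v x)) (by fun_prop)
  have h0 : ∫ x : Sph d, (κ v : ℂ) * (f (refl v x) * ev s (refl v x) - f x * ev s x)
      ∂(wMeasure P κ) = 0 := by
    rw [integral_const_mul, integral_sub i2 i1, hsym, sub_self, mul_zero]
  rw [← h0]
  by_cases hκv : κ v = 0
  · simp [hκv]
  refine integral_congr_ae ?_
  filter_upwards [ae_inner_ne_zero hv hκv] with x hx
  have hx' : ((⟪(x : Space d), v⟫ : ℝ) : ℂ) ≠ 0 := by exact_mod_cast hx
  have h1 := hs x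
  have h2 := hs (refl v x)
  rw [refl_refl, inner_refl_self hvR] at h2
  congr 1
  rw [jump, add_zero]
  push_cast at h2 ⊢
  set l : ℂ := ((⟪(x : Space d), v⟫ : ℝ) : ℂ)
  field_simp
  linear_combination f x * h1 + f (refl v x) * h2

/-- Green's formula. The difference part of the Dunkl Laplacian, `2 ∂_v p / l - 2 (p - p ∘ σ_v) /
l²` with `l = ⟪x, v⟫`, is the polynomial `2 s_v`, so the right side contains no singular quotient.
-/
theorem energy_eq (hR : IsRootSystem R) (hκ : IsMultiplicity R κ)
    (hP : IsPositiveSubsystem R P) {f : Space d → ℂ} (hf : ContDiff ℝ 1 f)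
    {p : MvPolynomial (Fin d) ℂ} {s : Space d → MvPolynomial (Fin d) ℂ}
    (hs : ∀ v ∈ P, ∀ x : Space d, ev p (refl v x) =
      ev p x - ((⟪x, v⟫ : ℝ) : ℂ) * ev (dirP v p) x + ((⟪x, v⟫ : ℝ) : ℂ) ^ 2 * ev (s v) x) :
    energy P κ f (ev p) = ∫ x : Sph d, f x *
      ev (-(sphLapP p + ∑ v ∈ P, C (κ v : ℂ) * (2 * (s v - eulP p)))) x ∂(wMeasure P κ) := by
  have hfc := hf.continuous
  have hev : ∀ q : MvPolynomial (Fin d) ℂ, Continuous (ev q) := fun q =>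
    (contDiff_ev q (n := 1)).continuous
  have hr := continuous_refl (d := d)
  have h0 := integral_symIntegrand_zero hR hκ hP hf p
  have hj := fun v hv => integral_jump hR hκ hP hf hv (hs v hv)
  have iD : ∀ v ∈ P, Integrable (fun x : Sph d =>
      ((⟪(x : Space d), v⟫ / (⟪(x : Space d), v⟫ ^ 2 + 0) : ℝ) : ℂ) *
        (f x * ev (dirP v p) x - f (refl v x) * ev (dirP v p) (refl v x))) (wMeasure P κ) := by
    intro v hv
    obtain ⟨K, hK0, hK⟩ := exists_bound_sub_refl (hf.mul (contDiff_ev (dirP v p)))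
      (hR.1 v (hP.subset hv))
    have e := hev (dirP v p)
    have := hr v
    refine integrable_of_bound (C := K) ?_ fun x => ?_
    · refine Measurable.mul ?_ (Continuous.measurable (by fun_prop))
      refine Complex.measurable_ofReal.comp (Measurable.div ?_ ?_)
      · exact Continuous.measurable (by fun_prop)
      · exact Continuous.measurable (by fun_prop)
    · rw [norm_mul, Complex.norm_real, Real.norm_eq_abs]
      calc _ ≤ |⟪(x : Space d), v⟫ / (⟪(x : Space d), v⟫ ^ 2 + 0)| *
            (K * |⟪(x : Space d), v⟫|) := by gcongr; exact hK x
        _ = K * (|⟪(x : Space d), v⟫ / (⟪(x : Space d), v⟫ ^ 2 + 0)| * |⟪(x : Space d), v⟫|) := by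
            ring
        _ ≤ K * 1 := mul_le_mul_of_nonneg_left (norm_regQuot_mul_le le_rfl) hK0
        _ = K := mul_one _
  have is : ∀ v, Integrable (fun x : Sph d => f x * ev (s v) x) (wMeasure P κ) := fun v => by
    have := hev (s v)
    exact integrable_of_continuous (F := fun x => f x * ev (s v) x) (by fun_prop)
  have iT : ∀ v ∈ P, Integrable (fun x : Sph d =>
      (κ v : ℂ) * (((⟪(x : Space d), v⟫ / (⟪(x : Space d), v⟫ ^ 2 + 0) : ℝ) : ℂ) *
        (f x * ev (dirP v p) x - f (refl v x) * ev (dirP v p) (refl v x)) - jump v f (ev p) x -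
        2 * (f x * ev (s v) x))) (wMeasure P κ) := fun v hv =>
    (((iD v hv).sub (integrable_jump (hR.1 v (hP.subset hv)) hf (contDiff_ev p))).sub
      ((is v).const_mul 2)).const_mul _
  have hT : ∫ x : Sph d, ∑ v ∈ P,
      (κ v : ℂ) * (((⟪(x : Space d), v⟫ / (⟪(x : Space d), v⟫ ^ 2 + 0) : ℝ) : ℂ) *
        (f x * ev (dirP v p) x - f (refl v x) * ev (dirP v p) (refl v x)) - jump v f (ev p) x -
        2 * (f x * ev (s v) x)) ∂(wMeasure P κ) = 0 := by
    rw [integral_finsetSum _ iT]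
    exact Finset.sum_eq_zero hj
  have iR : Integrable (fun x : Sph d => f x *
      ev (-(sphLapP p + ∑ v ∈ P, C (κ v : ℂ) * (2 * (s v - eulP p)))) x) (wMeasure P κ) := by
    have := hev (-(sphLapP p + ∑ v ∈ P, C (κ v : ℂ) * (2 * (s v - eulP p))))
    exact integrable_of_continuous (F := fun x => f x *
      ev (-(sphLapP p + ∑ v ∈ P, C (κ v : ℂ) * (2 * (s v - eulP p)))) x) (by fun_prop)
  have iE := integrable_carre (κ := κ) hR hP hf (contDiff_ev p)
  have iER : Integrable (fun x : Sph d => carre P κ f (ev p) x - f x *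
      ev (-(sphLapP p + ∑ v ∈ P, C (κ v : ℂ) * (2 * (s v - eulP p)))) x) (wMeasure P κ) :=
    iE.sub iR
  rw [energy, ← sub_eq_zero, ← integral_sub iE iR, ← h0]
  have iT' := integrable_finsetSum P iT
  have hsum : ∀ᵐ x : Sph d ∂(wMeasure P κ), ∀ v ∈ P, (κ v : ℂ) *
      ((⟪(x : Space d), v⟫ / (⟪(x : Space d), v⟫ ^ 2 + 0) * ⟪(x : Space d), v⟫ : ℝ) : ℂ) =
      (κ v : ℂ) := by
    rw [Finset.eventually_all]
    intro v hv
    by_cases hκv : κ v = 0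
    · simp [hκv]
    filter_upwards [ae_inner_ne_zero hv hκv] with x hx
    have : ⟪(x : Space d), v⟫ / (⟪(x : Space d), v⟫ ^ 2 + 0) * ⟪(x : Space d), v⟫ = 1 := by
      rw [add_zero]
      field_simp
    rw [this]
    simp
  have hall : ∀ᵐ x : Sph d ∂(wMeasure P κ), symIntegrand P κ f p 0 x =
      (carre P κ f (ev p) x - f x *
        ev (-(sphLapP p + ∑ v ∈ P, C (κ v : ℂ) * (2 * (s v - eulP p)))) x) +
      ∑ v ∈ P, (κ v : ℂ) * (((⟪(x : Space d), v⟫ / (⟪(x : Space d), v⟫ ^ 2 + 0) : ℝ) : ℂ) *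
        (f x * ev (dirP v p) x - f (refl v x) * ev (dirP v p) (refl v x)) - jump v f (ev p) x -
        2 * (f x * ev (s v) x)) := by
    filter_upwards [hsum] with x hx
    have h2 : ∀ q : MvPolynomial (Fin d) ℂ, ev (2 * q) x = 2 * ev q x := fun q => by
      rw [two_mul, ev_add, two_mul]
    simp only [symIntegrand, carre, ev_neg, ev_add, ev_sum, ev_mul, ev_C, ev_sub, h2]
    have e : ∑ v ∈ P, (κ v : ℂ) *
        (((⟪(x : Space d), v⟫ / (⟪(x : Space d), v⟫ ^ 2 + 0) : ℝ) : ℂ) *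
        (f x * ev (dirP v p) x - f (refl v x) * ev (dirP v p) (refl v x)) -
        2 * ((⟪(x : Space d), v⟫ / (⟪(x : Space d), v⟫ ^ 2 + 0) * ⟪(x : Space d), v⟫ : ℝ) : ℂ) *
          (f x * ev (eulP p) x)) =
        ∑ v ∈ P, (κ v : ℂ) * jump v f (ev p) x +
        f x * ∑ v ∈ P, (κ v : ℂ) * (2 * (ev (s v) x - ev (eulP p) x)) +
        ∑ v ∈ P, (κ v : ℂ) * (((⟪(x : Space d), v⟫ / (⟪(x : Space d), v⟫ ^ 2 + 0) : ℝ) : ℂ) *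
        (f x * ev (dirP v p) x - f (refl v x) * ev (dirP v p) (refl v x)) - jump v f (ev p) x -
        2 * (f x * ev (s v) x)) := by
      rw [Finset.mul_sum, ← Finset.sum_add_distrib, ← Finset.sum_add_distrib]
      refine Finset.sum_congr rfl fun v hv => ?_
      linear_combination (-2 * (f x * ev (eulP p) x)) * hx v hv
    rw [e]
    ring
  rw [integral_congr_ae hall, integral_add iER iT', hT, add_zero]

end Energy

/-! ### The spherical Dunkl Laplacian is triangular with respect to degree. -/

section Triangular

variable {d : ℕ} {R P : Finset (Space d)} {κ : Space d → ℝ≥0}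

open MvPolynomial

/-- The space of polynomials of total degree less than `k`. -/
noncomputable def polyLT (d k : ℕ) : Submodule ℂ (MvPolynomial (Fin d) ℂ) :=
  restrictSupport ℂ {m | m.degree < k}

theorem mem_polyLT {k : ℕ} {p : MvPolynomial (Fin d) ℂ} :
    p ∈ polyLT d k ↔ ∀ m, coeff m p ≠ 0 → m.degree < k := by
  rw [polyLT, mem_restrictSupport_iff]
  exact ⟨fun h m hm => h (by simpa using hm), fun h m hm => h m (by simpa using hm)⟩

/-- The strict inequality in `polyLT` makes the index `0` play the role of `Π_{-1}`, so that all
degrees can be treated alike. -/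
theorem polyLT_zero : polyLT d 0 = ⊥ := by
  rw [eq_bot_iff]
  intro p hp
  rw [mem_polyLT] at hp
  rw [Submodule.mem_bot]
  ext m
  by_contra h
  exact absurd (hp m h) (Nat.not_lt_zero _)

theorem polyLT_mono {j k : ℕ} (h : j ≤ k) : polyLT d j ≤ polyLT d k :=
  restrictSupport_mono ℂ fun _ hm => lt_of_lt_of_le hm h

theorem polyLT_succ (n : ℕ) : polyLT d (n + 1) = restrictTotalDegree (Fin d) ℂ n := by
  rw [polyLT, restrictTotalDegree]
  congr 1
  ext m
  exact Nat.lt_succ_iff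

theorem mul_X_mem_polyLT {k : ℕ} {p : MvPolynomial (Fin d) ℂ} {i : Fin d} :
    p * X i ∈ polyLT d (k + 1) ↔ p ∈ polyLT d k := by
  simp only [polyLT, mem_restrictSupport_iff, support_mul_X]
  constructor
  · intro h m hm
    have := h (Finset.mem_coe.2 (Finset.mem_map_of_mem _ hm))
    simpa using this
  · intro h m hm
    obtain ⟨m', hm', rfl⟩ := Finset.mem_map.1 (Finset.mem_coe.1 hm)
    have := h hm'
    simpa using this

theorem C_mul_mem_polyLT {k : ℕ} {p : MvPolynomial (Fin d) ℂ} (c : ℂ) (hp : p ∈ polyLT d k) :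
    C c * p ∈ polyLT d k := by
  rw [C_mul']
  exact Submodule.smul_mem _ _ hp

theorem pderiv_mem_polyLT {k : ℕ} {p : MvPolynomial (Fin d) ℂ} (i : Fin d)
    (hp : p ∈ polyLT d (k + 1)) : pderiv i p ∈ polyLT d k := by
  rw [mem_polyLT] at hp ⊢
  intro m hm
  rw [coeff_pderiv] at hm
  have := hp _ (left_ne_zero_of_mul hm)
  simpa using this

theorem dirP_mem_polyLT {k : ℕ} {p : MvPolynomial (Fin d) ℂ} (v : Space d)
    (hp : p ∈ polyLT d (k + 1)) : dirP v p ∈ polyLT d k :=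
  Submodule.sum_mem _ fun i _ => C_mul_mem_polyLT _ (pderiv_mem_polyLT i hp)

/-- Taylor expansion along `σ_v x = x - ⟪x, v⟫ v`, one variable at a time. Monomials are used
because in an induction over all polynomials a degree bound on a sum does not pass to its summands;
`exists_triangular` extends the result by linearity. -/
theorem exists_taylor_monomial {v : Space d} (hv : ⟪v, v⟫ = 2) (m : Fin d →₀ ℕ) (a : ℂ) :
    ∀ k, monomial m a ∈ polyLT d (k + 1) → ∃ s ∈ polyLT d k, ∀ x : Space d,
      ev (monomial m a) (refl v x) = ev (monomial m a) x -
        ((⟪x, v⟫ : ℝ) : ℂ) * ev (dirP v (monomial m a)) x + ((⟪x, v⟫ : ℝ) : ℂ) ^ 2 * ev s x := by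
  refine MvPolynomial.induction_on_monomial (motive := fun p => ∀ k, p ∈ polyLT d (k + 1) →
    ∃ s ∈ polyLT d k, ∀ x : Space d, ev p (refl v x) = ev p x -
        ((⟪x, v⟫ : ℝ) : ℂ) * ev (dirP v p) x + ((⟪x, v⟫ : ℝ) : ℂ) ^ 2 * ev s x) ?_ ?_ m a
  · intro a k _
    exact ⟨0, Submodule.zero_mem _, fun x => by simp [dirP]⟩
  · intro p i ih k hp
    rw [mul_X_mem_polyLT] at hp
    cases k with
    | zero =>
      rw [polyLT_zero, Submodule.mem_bot] at hp
      subst hp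
      exact ⟨0, Submodule.zero_mem _, fun x => by simp [dirP]⟩
    | succ k =>
      obtain ⟨s, hs, h⟩ := ih k hp
      -- With `l = ⟪x, v⟫`, expand `(p - l ∂_v p + l² s)(x_i - l v_i)` and collect the terms from
      -- `l²` on; the cubic one is absorbed by writing one factor `l` as `∑ x_j v_j`.
      refine ⟨s * X i + C ((v i : ℝ) : ℂ) * dirP v p -
        ∑ j, C (((v i : ℝ) : ℂ) * ((v j : ℝ) : ℂ)) * (s * X j), ?_, fun x => ?_⟩
      · refine Submodule.sub_mem _ (Submodule.add_mem _ (mul_X_mem_polyLT.2 hs)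
          (C_mul_mem_polyLT _ (polyLT_mono (Nat.le_succ k) (dirP_mem_polyLT v hp)))) ?_
        exact Submodule.sum_mem _ fun j _ => C_mul_mem_polyLT _ (mul_X_mem_polyLT.2 hs)
      · have hx : ∑ j, ((v i : ℝ) : ℂ) * ((v j : ℝ) : ℂ) * (ev s x * ((x j : ℝ) : ℂ)) =
            ((v i : ℝ) : ℂ) * ((⟪x, v⟫ : ℝ) : ℂ) * ev s x := by
          rw [ofReal_inner, Finset.mul_sum, Finset.sum_mul]
          exact Finset.sum_congr rfl fun j _ => by ring
        have hxi : ((refl v x i : ℝ) : ℂ) = (x i : ℝ) - ((⟪x, v⟫ : ℝ) : ℂ) * ((v i : ℝ) : ℂ) := by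
          rw [refl_apply_of_root hv]
          simp
        rw [dirP_mul_X]
        simp only [ev_mul, ev_add, ev_sub, ev_sum, ev_X, ev_C, h, hx, hxi]
        ring

/-- The Laplacian. -/
noncomputable def lapP (p : MvPolynomial (Fin d) ℂ) : MvPolynomial (Fin d) ℂ :=
  ∑ i, pderiv i (pderiv i p)

theorem lapP_mem_polyLT {k : ℕ} {p : MvPolynomial (Fin d) ℂ}
    (hp : p ∈ polyLT d (k + 1)) : lapP p ∈ polyLT d k :=
  Submodule.sum_mem _ fun i _ => pderiv_mem_polyLT i (polyLT_mono (Nat.le_succ k)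
    (pderiv_mem_polyLT i hp))

theorem pderiv_pderiv_comm (i j : Fin d) (p : MvPolynomial (Fin d) ℂ) :
    pderiv i (pderiv j p) = pderiv j (pderiv i p) := by
  ext m
  simp only [coeff_pderiv]
  by_cases h : i = j
  · subst h; rfl
  · simp [h, Ne.symm h, add_right_comm]
    ring

theorem eulP_eulP (p : MvPolynomial (Fin d) ℂ) :
    eulP (eulP p) = eulP p + ∑ i, ∑ j, X i * X j * pderiv i (pderiv j p) := by
  classical
  have h : ∀ i j : Fin d, X i * pderiv i (X j * pderiv j p) =
      (if i = j then X i * pderiv j p else 0) + X i * X j * pderiv i (pderiv j p) := by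
    intro i j
    rw [Derivation.leibniz, pderiv_X, Pi.single_apply]
    by_cases hij : i = j
    · subst hij
      simp
      ring
    · simp [hij, Ne.symm hij]
      ring
  have h' : ∀ i : Fin d, X i * pderiv i (eulP p) =
      ∑ j, ((if i = j then X i * pderiv j p else 0) + X i * X j * pderiv i (pderiv j p)) := by
    intro i
    rw [eulP, map_sum, Finset.mul_sum]
    exact Finset.sum_congr rfl fun j _ => h i j
  rw [eulP, Finset.sum_congr rfl fun i _ => h' i]
  simp only [Finset.sum_add_distrib]
  congr 1
  simp [eulP]

theorem sum_angP_angP (p : MvPolynomial (Fin d) ℂ) :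
    ∑ i, ∑ j, angP i j (angP i j p) =
      2 * ((∑ i, X i ^ 2) * lapP p - eulP (eulP p) - ((d : MvPolynomial (Fin d) ℂ) - 2) * eulP p) := by
  classical
  have h : ∀ i j : Fin d, angP i j (angP i j p) =
      (if i = j then X i * pderiv i p else 0) + (if i = j then X i * pderiv i p else 0) +
      X i ^ 2 * pderiv j (pderiv j p) + X j ^ 2 * pderiv i (pderiv i p)
      - X i * pderiv i p - X j * pderiv j p
      - X i * X j * pderiv i (pderiv j p) - X j * X i * pderiv j (pderiv i p) := by
    intro i j
    simp only [angP, map_sub, Derivation.leibniz, smul_eq_mul, pderiv_X, Pi.single_apply]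
    rw [pderiv_pderiv_comm j i]
    by_cases hij : i = j
    · subst hij
      simp
      ring
    · simp [hij, Ne.symm hij]
      ring
  simp only [h, Finset.sum_add_distrib, Finset.sum_sub_distrib]
  rw [eulP_eulP]
  have e1 : ∑ i : Fin d, ∑ j : Fin d, (if i = j then X i * pderiv i p else 0) = eulP p := by
    simp [eulP]
  have e2 : ∑ i : Fin d, ∑ j : Fin d, X i ^ 2 * pderiv j (pderiv j p) =
      (∑ i, X i ^ 2) * lapP p := by
    simp only [lapP, Finset.mul_sum, Finset.sum_mul]
    exact Finset.sum_comm
  have e3 : ∑ i : Fin d, ∑ j : Fin d, X j ^ 2 * pderiv i (pderiv i p) =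
      (∑ i, X i ^ 2) * lapP p := by
    rw [Finset.sum_comm, e2]
  have e4 : ∑ i : Fin d, ∑ _j : Fin d, X i * pderiv i p =
      (d : MvPolynomial (Fin d) ℂ) * eulP p := by
    simp [eulP, Finset.mul_sum]
  have e5 : ∑ _i : Fin d, ∑ j : Fin d, X j * pderiv j p =
      (d : MvPolynomial (Fin d) ℂ) * eulP p := by
    simp [eulP]
  have e6 : ∑ i : Fin d, ∑ j : Fin d, X j * X i * pderiv j (pderiv i p) =
      ∑ i : Fin d, ∑ j : Fin d, X i * X j * pderiv i (pderiv j p) := Finset.sum_comm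
  rw [e1, e2, e3, e4, e5, e6]
  ring

theorem ev_sphLapP (p : MvPolynomial (Fin d) ℂ) (x : Sph d) :
    ev (sphLapP p) x = ev (lapP p) x - ev (eulP (eulP p)) x - ((d : ℂ) - 2) * ev (eulP p) x := by
  have h : ev (∑ i : Fin d, (X i : MvPolynomial (Fin d) ℂ) ^ 2) (x : Space d) = 1 := by
    rw [← sum_ofReal_sq x]
    simp [sq]
  have h2 : ev ((d : MvPolynomial (Fin d) ℂ) - 2) (x : Space d) = (d : ℂ) - 2 := by
    simp [ev]
  have h3 : ev (2 : MvPolynomial (Fin d) ℂ) (x : Space d) = 2 := by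
    simp [ev]
  rw [sphLapP, sum_angP_angP]
  simp only [ev_mul, ev_C, ev_sub (_ - _) _, ev_sub (_ * _) _, h, h2, h3]
  ring

theorem eulP_monomial (m : Fin d →₀ ℕ) (a : ℂ) :
    eulP (monomial m a) = C (m.degree : ℂ) * monomial m a := by
  rw [eulP, (isHomogeneous_monomial a rfl).sum_X_mul_pderiv, nsmul_eq_mul]
  simp

theorem eulP_C_mul (c : ℂ) (p : MvPolynomial (Fin d) ℂ) : eulP (C c * p) = C c * eulP p := by
  simp only [eulP, pderiv_C_mul, Finset.mul_sum]
  exact Finset.sum_congr rfl fun j _ => by ring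

/-- The eigenvalue `n (n + 2 λ_κ)`. -/
noncomputable def eig (P : Finset (Space d)) (κ : Space d → ℝ≥0) (n : ℕ) : ℝ :=
  (n : ℝ) * (n + 2 * lam P κ)

theorem ofReal_eig (n : ℕ) : ((eig P κ n : ℝ) : ℂ) =
    n * (n + (d - 2) + 2 * ∑ v ∈ P, (κ v : ℂ)) := by
  simp only [eig, lam]
  push_cast
  ring

theorem eulP_add (p q : MvPolynomial (Fin d) ℂ) : eulP (p + q) = eulP p + eulP q := by
  simp [eulP, mul_add, Finset.sum_add_distrib]

theorem dirP_add (v : Space d) (p q : MvPolynomial (Fin d) ℂ) :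
    dirP v (p + q) = dirP v p + dirP v q := by
  simp [dirP, mul_add, Finset.sum_add_distrib]

theorem dirP_C_mul (v : Space d) (c : ℂ) (p : MvPolynomial (Fin d) ℂ) :
    dirP v (C c * p) = C c * dirP v p := by
  simp only [dirP, pderiv_C_mul, Finset.mul_sum]
  exact Finset.sum_congr rfl fun j _ => by ring

theorem lapP_add (p q : MvPolynomial (Fin d) ℂ) : lapP (p + q) = lapP p + lapP q := by
  simp [lapP, Finset.sum_add_distrib]

theorem lapP_C_mul (c : ℂ) (p : MvPolynomial (Fin d) ℂ) : lapP (C c * p) = C c * lapP p := by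
  simp only [lapP, pderiv_C_mul, Finset.mul_sum]

/-- On a monomial of degree `m` the Euler operator is multiplication by `m`, so its contributions
add up to `m² + (d - 2) m + 2|κ| m = eig m`. The Laplacian and the remainders `s_v` have lower
degree and go into `q`. -/
theorem exists_triangular (hR : IsRootSystem R) (hP : IsPositiveSubsystem R P) {n : ℕ}
    {p : MvPolynomial (Fin d) ℂ} (hp : p ∈ polyLT d (n + 1)) :
    ∃ s : Space d → MvPolynomial (Fin d) ℂ,
      (∀ v ∈ P, ∀ x : Space d, ev p (refl v x) =
        ev p x - ((⟪x, v⟫ : ℝ) : ℂ) * ev (dirP v p) x + ((⟪x, v⟫ : ℝ) : ℂ) ^ 2 * ev (s v) x) ∧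
      ∃ q ∈ polyLT d n, ∀ x : Sph d,
        ev (-(sphLapP p + ∑ v ∈ P, C (κ v : ℂ) * (2 * (s v - eulP p)))) x =
          (eig P κ n : ℂ) * ev p x - ev q x := by
  have h2 : ∀ (q : MvPolynomial (Fin d) ℂ) (x : Space d), ev (2 * q) x = 2 * ev q x := fun q x => by
    rw [two_mul, ev_add, two_mul]
  rw [polyLT, restrictSupport_eq_span] at hp
  induction hp using Submodule.span_induction with
  | zero =>
    refine ⟨fun _ => 0, fun v _ x => by simp [dirP], 0, Submodule.zero_mem _, fun x => ?_⟩
    simp [ev_sphLapP, eulP, lapP]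
  | add p p' _ _ hp hp' =>
    obtain ⟨s, hs, q, hq, h⟩ := hp
    obtain ⟨s', hs', q', hq', h'⟩ := hp'
    refine ⟨fun v => s v + s' v, fun v hv x => ?_, q + q', Submodule.add_mem _ hq hq',
      fun x => ?_⟩
    · simp only [ev_add, dirP_add, hs v hv, hs' v hv]
      ring
    · have h1 := h x
      have h1' := h' x
      simp only [ev_neg, ev_add, ev_sum, ev_mul, ev_sub, ev_C, h2, ev_sphLapP, eulP_add, lapP_add,
        mul_sub, mul_add, Finset.sum_add_distrib, Finset.sum_sub_distrib] at h1 h1' ⊢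
      linear_combination h1 + h1'
  | smul c p _ hp =>
    obtain ⟨s, hs, q, hq, h⟩ := hp
    rw [← C_mul']
    refine ⟨fun v => C c * s v, fun v hv x => ?_, C c * q, C_mul_mem_polyLT c hq,
      fun x => ?_⟩
    · simp only [ev_mul, ev_C, dirP_C_mul, hs v hv]
      ring
    · have h1 := h x
      simp only [ev_neg, ev_add, ev_sum, ev_mul, ev_sub, ev_C, h2, ev_sphLapP, eulP_C_mul,
        lapP_C_mul] at h1 ⊢
      have e : ∑ v ∈ P, (κ v : ℂ) * (2 * (c * ev (s v) x - c * ev (eulP p) x)) =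
          c * ∑ v ∈ P, (κ v : ℂ) * (2 * (ev (s v) x - ev (eulP p) x)) := by
        rw [Finset.mul_sum]
        exact Finset.sum_congr rfl fun v _ => by ring
      rw [e]
      linear_combination c * h1
  | mem p hp =>
    obtain ⟨m, hm, rfl⟩ := hp
    have hm' : m.degree < n + 1 := hm
    have hmem : (monomial m (1 : ℂ)) ∈ polyLT d (m.degree + 1) := by
      rw [polyLT, monomial_mem_restrictSupport]
      exact Or.inl (Nat.lt_succ_self m.degree)
    have hT : ∀ v ∈ P, ∃ s ∈ polyLT d m.degree, ∀ x : Space d,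
        ev (monomial m (1 : ℂ)) (refl v x) = ev (monomial m (1 : ℂ)) x -
        ((⟪x, v⟫ : ℝ) : ℂ) * ev (dirP v (monomial m (1 : ℂ))) x +
          ((⟪x, v⟫ : ℝ) : ℂ) ^ 2 * ev s x := fun v hv =>
      exists_taylor_monomial (hR.1 v (hP.subset hv)) m 1 _ hmem
    choose! s hs hs' using hT
    refine ⟨s, hs', C ((eig P κ n : ℂ) - (eig P κ m.degree : ℂ)) * monomial m 1 +
      (lapP (monomial m 1) + ∑ v ∈ P, C (2 * (κ v : ℂ)) * s v), ?_, fun x => ?_⟩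
    · have hle : m.degree ≤ n := Nat.lt_succ_iff.1 hm'
      refine Submodule.add_mem _ ?_ (Submodule.add_mem _
        (polyLT_mono hle (lapP_mem_polyLT hmem))
        (Submodule.sum_mem _ fun v hv => C_mul_mem_polyLT _ (polyLT_mono hle (hs v hv))))
      -- In top degree the factor `eig n - eig m.degree` vanishes; in lower degree the monomial
      -- itself is admissible in `q`.
      rcases hle.eq_or_lt with h | h
      · rw [h, sub_self, C_0, zero_mul]
        exact Submodule.zero_mem _
      · exact C_mul_mem_polyLT _ (polyLT_mono h hmem)
    · simp only [ev_neg, ev_add, ev_sum, ev_mul, ev_sub, ev_C, h2, ev_sphLapP, eulP_C_mul,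
        eulP_monomial]
      have e1 : ∑ v ∈ P, (κ v : ℂ) * (2 * (ev (s v) x -
          (m.degree : ℂ) * ev (monomial m (1 : ℂ)) x)) =
          ∑ v ∈ P, 2 * (κ v : ℂ) * ev (s v) x -
          2 * (∑ v ∈ P, (κ v : ℂ)) * ((m.degree : ℂ) * ev (monomial m (1 : ℂ)) x) := by
        rw [Finset.mul_sum, Finset.sum_mul, ← Finset.sum_sub_distrib]
        exact Finset.sum_congr rfl fun v _ => by ring
      rw [e1, ofReal_eig m.degree]
      ring

theorem exists_energy_eq (hR : IsRootSystem R) (hκ : IsMultiplicity R κ)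
    (hP : IsPositiveSubsystem R P) {n : ℕ} {p : MvPolynomial (Fin d) ℂ}
    (hp : p ∈ polyLT d (n + 1)) :
    ∃ q ∈ polyLT d n, ∀ f : Space d → ℂ, ContDiff ℝ 1 f →
      energy P κ f (ev p) =
        ∫ x : Sph d, f x * ((eig P κ n : ℂ) * ev p x - ev q x) ∂(wMeasure P κ) := by
  obtain ⟨s, hs, q, hq, h⟩ := exists_triangular (κ := κ) hR hP hp
  refine ⟨q, hq, fun f hf => ?_⟩
  rw [energy_eq hR hκ hP hf hs]
  simp only [h]

end Triangular

/-! ### Orthogonal decomposition of `L²` into `h`-harmonics. -/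

section HilbertSum

variable {d : ℕ} {P : Finset (Space d)} {κ : Space d → ℝ≥0}

open MvPolynomial Filter Topology

/-- The class in `L²` of a polynomial. -/
noncomputable def cls (P : Finset (Space d)) (κ : Space d → ℝ≥0) :
    MvPolynomial (Fin d) ℂ →ₗ[ℂ] L2 P κ :=
  toL2 P κ ∘ₗ (restrictPoly d).toLinearMap

/-- The classes of the polynomials of degree less than `k`. -/
noncomputable def subLT (P : Finset (Space d)) (κ : Space d → ℝ≥0) (k : ℕ) :
    Submodule ℂ (L2 P κ) :=
  (polyLT d k).map (cls P κ)

theorem subLT_zero : subLT P κ 0 = ⊥ := by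
  rw [subLT, polyLT_zero, Submodule.map_bot]

theorem subLT_succ (n : ℕ) : subLT P κ (n + 1) = sphPoly P κ n := by
  rw [subLT, polyLT_succ]
  rfl

theorem subLT_mono {j k : ℕ} (h : j ≤ k) : subLT P κ j ≤ subLT P κ k :=
  Submodule.map_mono (polyLT_mono h)

theorem hHarmonic_eq (n : ℕ) : hHarmonic P κ n = subLT P κ (n + 1) ⊓ (subLT P κ n)ᗮ := by
  cases n with
  | zero => simp [hHarmonic, subLT_succ, subLT_zero]
  | succ n => simp [hHarmonic, subLT_succ]

instance instFiniteDimensionalSubLT (k : ℕ) : FiniteDimensional ℂ (subLT P κ k) := by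
  cases k with
  | zero => rw [subLT_zero]; infer_instance
  | succ n => rw [subLT_succ]; infer_instance

theorem orthogonalFamily_hHarmonic :
    OrthogonalFamily ℂ (fun n => hHarmonic P κ n) fun n => (hHarmonic P κ n).subtypeₗᵢ := by
  have key : ∀ i j, i < j → ∀ v ∈ hHarmonic P κ i, ∀ w ∈ hHarmonic P κ j, inner ℂ v w = 0 := by
    intro i j hij v hv w hw
    rw [hHarmonic_eq] at hv hw
    exact (Submodule.mem_orthogonal _ _).1 hw.2 v (subLT_mono hij hv.1)
  intro i j hij v w
  rcases lt_or_gt_of_ne hij with h | h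
  · exact key i j h v v.2 w w.2
  · exact inner_eq_zero_symm.1 (key j i h w w.2 v v.2)

theorem proj_mem (n : ℕ) (u : L2 P κ) : proj P κ n u ∈ hHarmonic P κ n :=
  Submodule.starProjection_apply_mem _ _

theorem proj_of_mem {n : ℕ} {u : L2 P κ} (hu : u ∈ hHarmonic P κ n) : proj P κ n u = u :=
  Submodule.starProjection_eq_self_iff.2 hu

theorem inner_proj_proj {m n : ℕ} (h : m ≠ n) (u w : L2 P κ) :
    inner ℂ (proj P κ m u) (proj P κ n w) = 0 :=
  orthogonalFamily_hHarmonic h ⟨_, proj_mem m u⟩ ⟨_, proj_mem n w⟩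

theorem inner_proj_right (n : ℕ) (u : L2 P κ) :
    inner ℂ u (proj P κ n u) = ((‖proj P κ n u‖ ^ 2 : ℝ) : ℂ) := by
  have h := Submodule.starProjection_inner_eq_zero (K := hHarmonic P κ n) u _ (proj_mem n u)
  rw [inner_sub_left, sub_eq_zero] at h
  rw [h]
  exact (inner_self_eq_norm_sq_to_K (𝕜 := ℂ) _).trans (by simp [proj])

theorem proj_of_mem_of_ne {m n : ℕ} (h : m ≠ n) {u : L2 P κ} (hu : u ∈ hHarmonic P κ n) :
    proj P κ m u = 0 := by
  have h1 := inner_proj_right m u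
  rw [← proj_of_mem hu, inner_proj_proj h.symm, proj_of_mem hu] at h1
  have h2 : ‖proj P κ m u‖ ^ 2 = 0 := by exact_mod_cast h1.symm
  simpa using h2

theorem norm_sq_sum_proj (u : L2 P κ) (c : ℕ → ℂ) (s : Finset ℕ) :
    ‖∑ n ∈ s, c n • proj P κ n u‖ ^ 2 = ∑ n ∈ s, ‖c n • proj P κ n u‖ ^ 2 :=
  orthogonalFamily_hHarmonic.norm_sum
    (fun n => ⟨c n • proj P κ n u, Submodule.smul_mem _ _ (proj_mem n u)⟩) s

theorem bessel (u : L2 P κ) (s : Finset ℕ) : ∑ n ∈ s, ‖proj P κ n u‖ ^ 2 ≤ ‖u‖ ^ 2 := by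
  have h1 : ‖∑ n ∈ s, proj P κ n u‖ ^ 2 = ∑ n ∈ s, ‖proj P κ n u‖ ^ 2 := by
    simpa using norm_sq_sum_proj u (fun _ => 1) s
  have h2 : inner ℂ u (∑ n ∈ s, proj P κ n u) = ((∑ n ∈ s, ‖proj P κ n u‖ ^ 2 : ℝ) : ℂ) := by
    rw [inner_sum]
    push_cast
    exact Finset.sum_congr rfl fun n _ => by rw [inner_proj_right]; push_cast; rfl
  have h3 := norm_inner_le_norm (𝕜 := ℂ) u (∑ n ∈ s, proj P κ n u)
  rw [h2, Complex.norm_real, Real.norm_of_nonneg (Finset.sum_nonneg fun _ _ => sq_nonneg _),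
    ← h1] at h3
  rw [← h1]
  have h4 := norm_nonneg (∑ n ∈ s, proj P κ n u)
  have h5 := norm_nonneg u
  nlinarith

theorem summable_norm_sq_proj (u : L2 P κ) : Summable fun n => ‖proj P κ n u‖ ^ 2 :=
  summable_of_sum_le (fun _ => sq_nonneg _) (bessel u)

theorem exists_hasSum_smul_proj (u : L2 P κ) (c : ℕ → ℂ)
    (hc : Summable fun n => ‖c n • proj P κ n u‖ ^ 2) :
    ∃ g : L2 P κ, HasSum (fun n => c n • proj P κ n u) g ∧
      ∀ m, proj P κ m g = c m • proj P κ m u := by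
  have hs : Summable fun n => c n • proj P κ n u :=
    (orthogonalFamily_hHarmonic.summable_iff_norm_sq_summable
      (fun n => (⟨c n • proj P κ n u, Submodule.smul_mem _ _ (proj_mem n u)⟩ :
        hHarmonic P κ n))).2 hc
  refine ⟨_, hs.hasSum, fun m => ?_⟩
  have h := (hs.hasSum.mapL (proj P κ m))
  refine h.unique ?_
  convert hasSum_single m ?_ using 1
  · rw [map_smul, proj_of_mem (proj_mem m u)]
  · intro n hn
    rw [map_smul, proj_of_mem_of_ne hn.symm (proj_mem n u), smul_zero]

/-- Each polynomial space is the preceding one plus the harmonics of the new degree, so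
orthogonality propagates by induction. -/
theorem inner_eq_zero_of_proj_eq_zero {w : L2 P κ} (hw : ∀ n, proj P κ n w = 0) (k : ℕ) :
    ∀ v ∈ subLT P κ k, inner ℂ v w = 0 := by
  induction k with
  | zero =>
    intro v hv
    rw [subLT_zero, Submodule.mem_bot] at hv
    rw [hv, inner_zero_left]
  | succ k ih =>
    intro v hv
    set a := (subLT P κ k).starProjection v with ha
    have hak : a ∈ subLT P κ k := Submodule.starProjection_apply_mem _ _
    have hb : v - a ∈ hHarmonic P κ k := by
      rw [hHarmonic_eq]
      exact ⟨Submodule.sub_mem _ hv (subLT_mono (Nat.le_succ k) hak),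
        Submodule.sub_starProjection_mem_orthogonal _⟩
    have h1 : inner ℂ (v - a) w = 0 := by
      have h2 := (Submodule.starProjection_apply_eq_zero_iff (K := hHarmonic P κ k)).1 (hw k)
      exact (Submodule.mem_orthogonal _ _).1 h2 _ hb
    rw [← sub_add_cancel v a, inner_add_left, h1, ih a hak, add_zero]

theorem exists_mem_polyLT (p : MvPolynomial (Fin d) ℂ) : ∃ k, p ∈ polyLT d k :=
  ⟨p.totalDegree + 1, by rw [polyLT_succ, mem_restrictTotalDegree]⟩

/-- The polynomial with conjugate coefficients. -/
noncomputable def conjP (p : MvPolynomial (Fin d) ℂ) : MvPolynomial (Fin d) ℂ :=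
  MvPolynomial.map (starRingEnd ℂ) p

@[simp]
theorem ev_conjP (p : MvPolynomial (Fin d) ℂ) (x : Space d) :
    ev (conjP p) x = starRingEnd ℂ (ev p x) := by
  induction p using MvPolynomial.induction_on with
  | C a => simp [conjP]
  | add p q hp hq =>
    simp only [conjP, map_add, ev_add] at hp hq ⊢
    rw [hp, hq]
  | mul_X p i hp =>
    simp only [conjP, map_mul, map_X, ev_mul, ev_X] at hp ⊢
    rw [hp, Complex.conj_ofReal]

theorem conjP_mem_polyLT {k : ℕ} {p : MvPolynomial (Fin d) ℂ} (hp : p ∈ polyLT d k) :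
    conjP p ∈ polyLT d k := by
  rw [mem_polyLT] at hp ⊢
  intro m hm
  refine hp m fun h => hm ?_
  rw [conjP, coeff_map, h, map_zero]

/-- Stone–Weierstrass: the coordinates separate points, and conjugating coefficients realizes
complex conjugation. -/
theorem dense_range_restrictPoly :
    (restrictPoly d).range.topologicalClosure = ⊤ := by
  set A : StarSubalgebra ℂ C(Sph d, ℂ) :=
    { (restrictPoly d).range with
      star_mem' := by
        rintro _ ⟨p, rfl⟩
        refine ⟨conjP p, ?_⟩
        ext x
        change restrictPoly d (conjP p) x = star (restrictPoly d p) x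
        rw [restrictPoly_apply, ev_conjP, ContinuousMap.star_apply, restrictPoly_apply]
        rfl } with hA
  have h := ContinuousMap.starSubalgebra_topologicalClosure_eq_top_of_separatesPoints A ?_
  · rw [Algebra.eq_top_iff]
    intro f
    have : f ∈ A.topologicalClosure := by rw [h]; trivial
    exact this
  · intro x y hxy
    have : ∃ i, (x : Space d) i ≠ (y : Space d) i := by
      by_contra! hall
      exact hxy (Subtype.ext (PiLp.ext hall))
    obtain ⟨i, hi⟩ := this
    refine ⟨_, ⟨restrictPoly d (X i), ⟨X i, rfl⟩, rfl⟩, ?_⟩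
    change restrictPoly d (X i) x ≠ restrictPoly d (X i) y
    rw [restrictPoly_apply, restrictPoly_apply, ev_X, ev_X]
    exact_mod_cast hi

theorem eq_zero_of_proj_eq_zero {w : L2 P κ} (hw : ∀ n, proj P κ n w = 0) : w = 0 := by
  have h1 : ∀ p : MvPolynomial (Fin d) ℂ, inner ℂ (cls P κ p) w = 0 := by
    intro p
    obtain ⟨k, hk⟩ := exists_mem_polyLT p
    exact inner_eq_zero_of_proj_eq_zero hw k _ (Submodule.mem_map_of_mem hk)
  set T := ContinuousMap.toLp (E := ℂ) 2 (wMeasure P κ) ℂ with hT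
  have h2 : ∀ f : C(Sph d, ℂ), inner ℂ (T f) w = 0 := by
    have hcl : IsClosed {f : C(Sph d, ℂ) | inner ℂ (T f) w = 0} :=
      isClosed_eq (T.continuous.inner continuous_const) continuous_const
    intro f
    have hf : f ∈ (restrictPoly d).range.topologicalClosure := by
      rw [dense_range_restrictPoly]; trivial
    have hf' : f ∈ closure ((restrictPoly d).range : Set C(Sph d, ℂ)) := hf
    refine closure_minimal (t := {f : C(Sph d, ℂ) | inner ℂ (T f) w = 0}) ?_ hcl hf'
    rintro _ ⟨p, rfl⟩
    exact h1 p
  have hd : DenseRange T := ContinuousMap.toLp_denseRange ℂ (wMeasure P κ) ℂ (by norm_num)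
  have h3 : ∀ v : L2 P κ, inner ℂ v w = 0 := by
    intro v
    have hcl : IsClosed {v : L2 P κ | inner ℂ v w = 0} :=
      isClosed_eq (continuous_id.inner continuous_const) continuous_const
    exact hd.induction_on (p := fun v => inner ℂ v w = 0) v hcl h2
  exact inner_self_eq_zero.1 (h3 w)

theorem hasSum_proj (u : L2 P κ) : HasSum (fun n => proj P κ n u) u := by
  obtain ⟨g, hg, hg'⟩ := exists_hasSum_smul_proj u (fun _ => 1)
    (by simpa using summable_norm_sq_proj u)
  simp only [one_smul] at hg hg'
  have : g - u = 0 := eq_zero_of_proj_eq_zero fun n => by rw [map_sub, hg', sub_self]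
  rwa [sub_eq_zero.1 this] at hg

end HilbertSum

/-! ### Spectral expression of the Dirichlet form. -/

section SpectralEnergy

variable {d : ℕ} {R P : Finset (Space d)} {κ : Space d → ℝ≥0}

open MvPolynomial Filter Topology

/-- The pointwise complex conjugate of a function. -/
noncomputable def cj (f : Space d → ℂ) (x : Space d) : ℂ := starRingEnd ℂ (f x)

theorem contDiff_cj {f : Space d → ℂ} (hf : ContDiff ℝ 1 f) : ContDiff ℝ 1 (cj f) :=
  Complex.conjCLE.toContinuousLinearMap.contDiff.comp hf

theorem angD_cj {f : Space d → ℂ} (hf : ContDiff ℝ 1 f) (i j : Fin d) (x : Space d) :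
    angD i j (cj f) x = starRingEnd ℂ (angD i j f x) := by
  have h : HasFDerivAt (cj f) _ x := Complex.conjCLE.toContinuousLinearMap.hasFDerivAt.comp x
    (hf.differentiable one_ne_zero x).hasFDerivAt
  rw [angD, h.fderiv]
  rfl

theorem angD_add {f g : Space d → ℂ} (hf : ContDiff ℝ 1 f) (hg : ContDiff ℝ 1 g) (i j : Fin d)
    (x : Space d) : angD i j (f + g) x = angD i j f x + angD i j g x := by
  rw [angD, fderiv_add (hf.differentiable one_ne_zero x) (hg.differentiable one_ne_zero x)]
  rfl

theorem angD_neg {f : Space d → ℂ} (i j : Fin d)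
    (x : Space d) : angD i j (-f) x = -angD i j f x := by
  rw [angD, fderiv_neg]
  rfl

theorem carre_comm (f g : Space d → ℂ) (x : Space d) : carre P κ f g x = carre P κ g f x := by
  simp only [carre, gradProd, jump, mul_comm (f x - _), mul_comm (angD _ _ f x)]

theorem energy_comm (f g : Space d → ℂ) : energy P κ f g = energy P κ g f := by
  simp only [energy, carre_comm f g]

theorem carre_add_right {f g h : Space d → ℂ} (hg : ContDiff ℝ 1 g) (hh : ContDiff ℝ 1 h)
    (x : Space d) : carre P κ f (g + h) x = carre P κ f g x + carre P κ f h x := by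
  have e : ∀ v : Space d, jump v f (g + h) x = jump v f g x + jump v f h x := fun v => by
    simp only [jump, Pi.add_apply]
    ring
  simp only [carre, gradProd, angD_add hg hh, e, mul_add, Finset.sum_add_distrib]
  ring

theorem carre_neg_right {f g : Space d → ℂ}
    (x : Space d) : carre P κ f (-g) x = -carre P κ f g x := by
  have e : ∀ v : Space d, jump v f (-g) x = -jump v f g x := fun v => by
    simp only [jump, Pi.neg_apply]
    ring
  simp only [carre, gradProd, angD_neg, e, mul_neg, Finset.sum_neg_distrib]
  ring

theorem energy_add_right (hR : IsRootSystem R) (hP : IsPositiveSubsystem R P)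
    {f g h : Space d → ℂ} (hf : ContDiff ℝ 1 f) (hg : ContDiff ℝ 1 g) (hh : ContDiff ℝ 1 h) :
    energy P κ f (g + h) = energy P κ f g + energy P κ f h := by
  simp only [energy, carre_add_right hg hh]
  exact integral_add (integrable_carre hR hP hf hg) (integrable_carre hR hP hf hh)

theorem energy_neg_right (f g : Space d → ℂ) : energy P κ f (-g) = -energy P κ f g := by
  simp only [energy, carre_neg_right]
  exact integral_neg _

/-- The squared norm of the tangential gradient. -/
noncomputable def gradSq (f : Space d → ℂ) (x : Space d) : ℝ :=
  1 / 2 * ∑ i, ∑ j, ‖angD i j f x‖ ^ 2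

theorem gradSq_nonneg (f : Space d → ℂ) (x : Space d) : 0 ≤ gradSq f x := by
  unfold gradSq
  positivity

theorem gradProd_cj {f : Space d → ℂ} (hf : ContDiff ℝ 1 f) (x : Space d) :
    gradProd (cj f) f x = (gradSq f x : ℂ) := by
  simp only [gradProd, gradSq, angD_cj hf, Complex.conj_mul']
  push_cast
  rfl

/-- The density of the Dirichlet form on the diagonal. -/
noncomputable def carreSq (P : Finset (Space d)) (κ : Space d → ℝ≥0) (f : Space d → ℂ)
    (x : Space d) : ℝ :=
  gradSq f x + ∑ v ∈ P, (κ v : ℝ) * (‖f x - f (refl v x)‖ ^ 2 / ⟪x, v⟫ ^ 2)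

theorem gradSq_le_carreSq (f : Space d → ℂ) (x : Space d) : gradSq f x ≤ carreSq P κ f x :=
  le_add_of_nonneg_right (Finset.sum_nonneg fun v _ => by positivity)

theorem carre_cj {f : Space d → ℂ} (hf : ContDiff ℝ 1 f) (x : Space d) :
    carre P κ (cj f) f x = (carreSq P κ f x : ℂ) := by
  have e : ∀ v : Space d, jump v (cj f) f x =
      ((‖f x - f (refl v x)‖ ^ 2 / ⟪x, v⟫ ^ 2 : ℝ) : ℂ) := fun v => by
    rw [jump, cj, cj, ← map_sub, Complex.conj_mul']
    push_cast
    rfl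
  rw [carre, gradProd_cj hf, carreSq]
  simp only [e]
  push_cast
  rfl

theorem continuous_gradSq {f : Space d → ℂ} (hf : ContDiff ℝ 1 f) : Continuous (gradSq f) := by
  unfold gradSq
  refine continuous_const.mul (continuous_finsetSum _ fun i _ => continuous_finsetSum _ fun j _ => ?_)
  exact (continuous_angD i j hf).norm.pow 2

theorem integrable_carreSq (hR : IsRootSystem R) (hP : IsPositiveSubsystem R P)
    {f : Space d → ℂ} (hf : ContDiff ℝ 1 f) :
    Integrable (fun x : Sph d => carreSq P κ f x) (wMeasure P κ) := by
  have h := (integrable_carre (κ := κ) hR hP (contDiff_cj hf) hf).re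
  simpa only [carre_cj hf, RCLike.ofReal_re, RCLike.re_eq_complex_re, Complex.ofReal_re] using h

theorem energy_cj {f : Space d → ℂ} (hf : ContDiff ℝ 1 f) :
    energy P κ (cj f) f = ((∫ x : Sph d, carreSq P κ f x ∂(wMeasure P κ) : ℝ) : ℂ) := by
  simp only [energy, carre_cj hf]
  exact integral_ofReal

theorem integral_carreSq_nonneg (f : Space d → ℂ) :
    0 ≤ ∫ x : Sph d, carreSq P κ f x ∂(wMeasure P κ) :=
  integral_nonneg fun x => (gradSq_nonneg f x).trans (gradSq_le_carreSq f x)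

theorem inner_toL2 (f g : C(Sph d, ℂ)) :
    inner ℂ (toL2 P κ f) (toL2 P κ g) = ∫ x, starRingEnd ℂ (f x) * g x ∂(wMeasure P κ) := by
  refine (ContinuousMap.inner_toLp (wMeasure P κ) f g).trans ?_
  simp only [mul_comm]

theorem inner_toL2_cls (f : C(Sph d, ℂ)) (p : MvPolynomial (Fin d) ℂ) :
    inner ℂ (toL2 P κ f) (cls P κ p) = ∫ x, starRingEnd ℂ (f x) * ev p x ∂(wMeasure P κ) := by
  refine (inner_toL2 f (restrictPoly d p)).trans ?_
  simp only [restrictPoly_apply]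

theorem inner_cls (p q : MvPolynomial (Fin d) ℂ) :
    inner ℂ (cls P κ p) (cls P κ q) =
      ∫ x : Sph d, starRingEnd ℂ (ev p x) * ev q x ∂(wMeasure P κ) := by
  refine (inner_toL2 (restrictPoly d p) (restrictPoly d q)).trans ?_
  simp only [restrictPoly_apply]

theorem coeFn_cls (p : MvPolynomial (Fin d) ℂ) :
    ∀ᵐ x ∂(wMeasure P κ), cls P κ p x = ev p x := by
  have h := ContinuousMap.coeFn_toLp (E := ℂ) (p := 2) (𝕜 := ℂ) (wMeasure P κ) (restrictPoly d p)
  filter_upwards [h] with x hx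
  rw [← restrictPoly_apply]
  exact hx

theorem continuous_ev (p : MvPolynomial (Fin d) ℂ) : Continuous (ev p) :=
  (contDiff_ev p (n := 1)).continuous

/-- For `p` orthogonal to lower degrees, evaluate the symmetric form on `conj q` and `p` in two
ways, `q` being the lower-order remainder of `p`. Expanding the operator on `p` gives `-∫ |q|²`;
expanding it on `conj q`, whose degree it does not raise, gives `0`. Hence `q = 0` almost everywhere
and `p` is a weak eigenfunction. -/
theorem exists_eigen (hR : IsRootSystem R) (hκ : IsMultiplicity R κ)
    (hP : IsPositiveSubsystem R P) {n : ℕ} {h : L2 P κ} (hh : h ∈ hHarmonic P κ n) :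
    ∃ p : MvPolynomial (Fin d) ℂ, cls P κ p = h ∧ ∀ f : Space d → ℂ, ContDiff ℝ 1 f →
      energy P κ f (ev p) = (eig P κ n : ℂ) * ∫ x : Sph d, f x * ev p x ∂(wMeasure P κ) := by
  rw [hHarmonic_eq] at hh
  obtain ⟨⟨p, hp, rfl⟩, horth⟩ := hh
  have horth' : ∀ w ∈ polyLT d n, ∫ x : Sph d, ev p x * starRingEnd ℂ (ev w x)
      ∂(wMeasure P κ) = 0 := by
    intro w hw
    have h1 := (Submodule.mem_orthogonal _ _).1 horth (cls P κ w) (Submodule.mem_map_of_mem hw)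
    rw [inner_cls] at h1
    simpa only [mul_comm] using h1
  refine ⟨p, rfl, fun f hf => ?_⟩
  obtain ⟨q, hq, hqe⟩ := exists_energy_eq hR hκ hP hp
  have icont : ∀ {F : Space d → ℂ}, Continuous F →
      Integrable (fun x : Sph d => F x) (wMeasure P κ) := fun hF => integrable_of_continuous hF
  have hpc := continuous_ev p
  have hqc := continuous_ev q
  have hq0 : cls P κ q = 0 := by
    cases n with
    | zero =>
      rw [polyLT_zero, Submodule.mem_bot] at hq
      rw [hq, map_zero]
    | succ k =>
      obtain ⟨r, hr, hre⟩ := exists_energy_eq hR hκ hP (conjP_mem_polyLT hq)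
      have hrc := continuous_ev r
      have e1 := hqe _ (contDiff_ev (conjP q))
      have e2 := hre _ (contDiff_ev p)
      rw [energy_comm] at e2
      rw [e1] at e2
      have z1 : ∫ x : Sph d, ev p x * ev (conjP q) x ∂(wMeasure P κ) = 0 := by
        simpa only [ev_conjP] using horth' q hq
      have z2 : ∫ x : Sph d, ev p x * ev r x ∂(wMeasure P κ) = 0 := by
        have := horth' (conjP r) (conjP_mem_polyLT (polyLT_mono (Nat.le_succ k) hr))
        simpa only [ev_conjP, Complex.conj_conj] using this
      have hqc' := continuous_ev (conjP q)
      have i1 : Integrable (fun x : Sph d => ev p x * ev (conjP q) x) (wMeasure P κ) :=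
        icont (F := fun x => ev p x * ev (conjP q) x) (by fun_prop)
      have i2 : Integrable (fun x : Sph d => ev p x * ev r x) (wMeasure P κ) :=
        icont (F := fun x => ev p x * ev r x) (by fun_prop)
      have i3 : Integrable (fun x : Sph d => ev (conjP q) x * ev q x) (wMeasure P κ) :=
        icont (F := fun x => ev (conjP q) x * ev q x) (by fun_prop)
      have l1 : ∫ x : Sph d, ev (conjP q) x * ((eig P κ (k + 1) : ℂ) * ev p x - ev q x)
          ∂(wMeasure P κ) = -∫ x : Sph d, ev (conjP q) x * ev q x ∂(wMeasure P κ) := by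
        have : ∀ x : Sph d, ev (conjP q) x * ((eig P κ (k + 1) : ℂ) * ev p x - ev q x) =
            (eig P κ (k + 1) : ℂ) * (ev p x * ev (conjP q) x) - ev (conjP q) x * ev q x :=
          fun x => by ring
        simp only [this]
        rw [integral_sub (i1.const_mul _) i3, integral_const_mul, z1, mul_zero, zero_sub]
      have l2 : ∫ x : Sph d, ev p x * ((eig P κ k : ℂ) * ev (conjP q) x - ev r x)
          ∂(wMeasure P κ) = 0 := by
        have : ∀ x : Sph d, ev p x * ((eig P κ k : ℂ) * ev (conjP q) x - ev r x) =
            (eig P κ k : ℂ) * (ev p x * ev (conjP q) x) - ev p x * ev r x :=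
          fun x => by ring
        simp only [this]
        rw [integral_sub (i1.const_mul _) i2, integral_const_mul, z1, z2, mul_zero, sub_zero]
      rw [l1, l2, neg_eq_zero] at e2
      refine (inner_self_eq_zero (𝕜 := ℂ)).1 ?_
      rw [inner_cls]
      simpa only [ev_conjP] using e2
  have hq0' : ∀ᵐ x : Sph d ∂(wMeasure P κ), ev q x = 0 := by
    have h1 := coeFn_cls (P := P) (κ := κ) q
    rw [hq0] at h1
    filter_upwards [h1, Lp.coeFn_zero ℂ 2 (wMeasure P κ)] with x hx hx'
    rw [← hx, hx']
    rfl
  rw [hqe f hf, ← integral_const_mul]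
  refine integral_congr_ae ?_
  filter_upwards [hq0'] with x hx
  rw [hx]
  ring

theorem energy_sum_right (hR : IsRootSystem R) (hP : IsPositiveSubsystem R P)
    {f : Space d → ℂ} (hf : ContDiff ℝ 1 f) (p : ℕ → MvPolynomial (Fin d) ℂ) (s : Finset ℕ) :
    energy P κ f (ev (∑ n ∈ s, p n)) = ∑ n ∈ s, energy P κ f (ev (p n)) := by
  classical
  induction s using Finset.induction_on with
  | empty =>
    have h0 : ev (0 : MvPolynomial (Fin d) ℂ) = (fun _ => 0) := by funext x; simp
    have h1 := energy_add_right (κ := κ) hR hP hf (contDiff_ev (0 : MvPolynomial (Fin d) ℂ))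
      (contDiff_ev (0 : MvPolynomial (Fin d) ℂ))
    have h2 : ev (0 : MvPolynomial (Fin d) ℂ) + ev 0 = ev 0 := by rw [h0]; funext x; simp
    rw [h2] at h1
    simpa using h1
  | insert a s ha ih =>
    rw [Finset.sum_insert ha, Finset.sum_insert ha, ← ih,
      ← energy_add_right hR hP hf (contDiff_ev _) (contDiff_ev _)]
    congr 1
    funext x
    simp

/-- Polynomials representing the partial sums of the expansion of a `C¹` function in
`h`-harmonics, together with their energies. -/
theorem exists_partial_sums (hR : IsRootSystem R) (hκ : IsMultiplicity R κ)
    (hP : IsPositiveSubsystem R P) (u : L2 P κ) (s : Finset ℕ) :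
    ∃ p : MvPolynomial (Fin d) ℂ, cls P κ p = ∑ n ∈ s, proj P κ n u ∧
      ∫ x : Sph d, carreSq P κ (ev p) x ∂(wMeasure P κ) =
        ∑ n ∈ s, eig P κ n * ‖proj P κ n u‖ ^ 2 ∧
      ∀ (f : C(Sph d, ℂ)) (F : Space d → ℂ), u = toL2 P κ f → ContDiff ℝ 1 F →
        (∀ x : Sph d, F x = f x) → energy P κ (cj F) (ev p) =
          ((∑ n ∈ s, eig P κ n * ‖proj P κ n u‖ ^ 2 : ℝ) : ℂ) := by
  choose p hp hpe using fun n => exists_eigen hR hκ hP (proj_mem (P := P) (κ := κ) n u)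
  have hcls : cls P κ (∑ n ∈ s, p n) = ∑ n ∈ s, proj P κ n u := by
    rw [map_sum]
    exact Finset.sum_congr rfl fun n _ => hp n
  refine ⟨∑ n ∈ s, p n, hcls, ?_, ?_⟩
  · have h1 : energy P κ (cj (ev (∑ n ∈ s, p n))) (ev (∑ n ∈ s, p n)) =
        ((∑ n ∈ s, eig P κ n * ‖proj P κ n u‖ ^ 2 : ℝ) : ℂ) := by
      rw [energy_sum_right hR hP (contDiff_cj (contDiff_ev _))]
      push_cast
      refine Finset.sum_congr rfl fun n hn => ?_
      rw [hpe n _ (contDiff_cj (contDiff_ev _))]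
      congr 1
      have h2 := inner_cls (P := P) (κ := κ) (∑ n ∈ s, p n) (p n)
      rw [hcls, hp, sum_inner, Finset.sum_eq_single_of_mem n hn
        (fun k _ hk => inner_proj_proj hk u u), inner_self_eq_norm_sq_to_K] at h2
      exact h2.symm
    rw [energy_cj (contDiff_ev _)] at h1
    exact_mod_cast h1
  · intro f F hu hF hFf
    rw [energy_sum_right hR hP (contDiff_cj hF)]
    push_cast
    refine Finset.sum_congr rfl fun n _ => ?_
    rw [hpe n _ (contDiff_cj hF)]
    congr 1
    have h2 := inner_toL2_cls (P := P) (κ := κ) f (p n)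
    rw [← hu, hp, inner_proj_right] at h2
    simp only [cj, hFf]
    rw [← h2]
    push_cast
    rfl

/-- Bessel's inequality for the form. If `p` represents the partial sum, both mixed energies and the
energy of `p` equal the left side `S`, so the energy of `F - p`, which is nonnegative, is that of
`F` minus `S`. -/
theorem sum_eig_le (hR : IsRootSystem R) (hκ : IsMultiplicity R κ)
    (hP : IsPositiveSubsystem R P) {f : C(Sph d, ℂ)} {F : Space d → ℂ} (hF : ContDiff ℝ 1 F)
    (hFf : ∀ x : Sph d, F x = f x) (s : Finset ℕ) :
    ∑ n ∈ s, eig P κ n * ‖proj P κ n (toL2 P κ f)‖ ^ 2 ≤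
      ∫ x : Sph d, carreSq P κ F x ∂(wMeasure P κ) := by
  obtain ⟨p, -, hpp, hpf⟩ := exists_partial_sums hR hκ hP (toL2 P κ f) s
  have h1 := hpf f F rfl hF hFf
  set S := ∑ n ∈ s, eig P κ n * ‖proj P κ n (toL2 P κ f)‖ ^ 2
  have hp1 : ContDiff ℝ 1 (ev p) := contDiff_ev p
  have hG : ContDiff ℝ 1 (F + -ev p) := hF.add hp1.neg
  have hcj : cj (F + -ev p) = cj F + -cj (ev p) := by
    funext x
    simp [cj]
  have h2 := energy_cj (P := P) (κ := κ) hG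
  have h3 := energy_cj (P := P) (κ := κ) hp1
  have h4 := energy_cj (P := P) (κ := κ) hF
  have h5 : energy P κ (cj (ev p)) F = (S : ℂ) := by
    have : ∀ x : Sph d, carre P κ (cj (ev p)) F x =
        starRingEnd ℂ (carre P κ (cj F) (ev p) x) := by
      intro x
      simp only [carre, gradProd, jump, angD_cj hF, angD_cj hp1, map_add, map_mul, map_sum, map_sub,
        map_div₀, map_pow, Complex.conj_ofReal, Complex.conj_conj, map_one, map_ofNat, cj]
      congr 1
      · simp only [mul_comm]
      · refine Finset.sum_congr rfl fun v _ => ?_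
        rw [mul_comm (F x - _)]
    rw [energy]
    simp only [this]
    rw [integral_conj]
    change starRingEnd ℂ (energy P κ (cj F) (ev p)) = _
    rw [h1, Complex.conj_ofReal]
  have hcp := contDiff_cj hp1
  have hcF := contDiff_cj hF
  have hn : ContDiff ℝ 1 (-ev p) := hp1.neg
  have hcn : ContDiff ℝ 1 (-cj (ev p)) := hcp.neg
  rw [energy_add_right hR hP (contDiff_cj hG) hF hn, energy_neg_right, hcj,
    energy_comm _ F, energy_comm _ (ev p), energy_add_right hR hP hF hcF hcn,
    energy_add_right hR hP hp1 hcF hcn, energy_neg_right, energy_neg_right,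
    energy_comm F, energy_comm F, energy_comm (ev p), energy_comm (ev p), h1, h3, h4, h5, hpp] at h2
  have h6 : (∫ x : Sph d, carreSq P κ F x ∂(wMeasure P κ)) - S =
      ∫ x : Sph d, carreSq P κ (F + -ev p) x ∂(wMeasure P κ) := by
    have : ((((∫ x : Sph d, carreSq P κ F x ∂(wMeasure P κ)) - S : ℝ)) : ℂ) =
        ((∫ x : Sph d, carreSq P κ (F + -ev p) x ∂(wMeasure P κ) : ℝ) : ℂ) := by
      rw [← h2]
      push_cast
      ring
    exact_mod_cast this
  linarith [integral_carreSq_nonneg (P := P) (κ := κ) (F + -ev p)]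

end SpectralEnergy

/-! ### Choice of a center and a scale adapted to the mirrors. -/

section ScaleSelection

variable {E : Type*} [NormedAddCommGroup E] [InnerProductSpace ℝ E]

theorem exists_pos_le_of_finset {ι : Type*} (s : Finset ι) (φ : ι → ℝ) (hφ : ∀ i ∈ s, 0 < φ i) :
    ∃ δ : ℝ, 0 < δ ∧ ∀ i ∈ s, δ ≤ φ i := by
  classical
  rcases s.eq_empty_or_nonempty with rfl | hs
  · exact ⟨1, one_pos, by simp⟩
  · obtain ⟨i, hi, hmin⟩ := s.exists_min_image φ hs
    exact ⟨φ i, hφ i hi, hmin⟩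

/-- The component of `v` orthogonal to the span of `Z`. -/
noncomputable def orthComp (Z : Finset E) (v : E) : E :=
  v - (Submodule.span ℝ (Z : Set E)).starProjection v

theorem inner_orthComp_of_mem {Z : Finset E} {z : E} (hz : z ∈ Z) (v : E) :
    ⟪orthComp Z v, z⟫ = 0 :=
  Submodule.starProjection_inner_eq_zero v z (Submodule.subset_span hz)

theorem inner_orthComp_self (Z : Finset E) (v : E) : ⟪orthComp Z v, v⟫ = ‖orthComp Z v‖ ^ 2 := by
  have h := Submodule.starProjection_inner_eq_zero v _
    (Submodule.starProjection_apply_mem (Submodule.span ℝ (Z : Set E)) v)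
  rw [← real_inner_self_eq_norm_sq]
  conv_rhs => rw [orthComp, inner_sub_right]
  rw [h, sub_zero, ← orthComp]

theorem orthComp_ne_zero {Z : Finset E} {y v : E} (hy : ∀ z ∈ Z, ⟪y, z⟫ = 0) (hv : ⟪y, v⟫ ≠ 0) :
    orthComp Z v ≠ 0 := by
  intro h
  rw [orthComp, sub_eq_zero] at h
  have hm : v ∈ Submodule.span ℝ (Z : Set E) := by
    rw [h]
    exact Submodule.starProjection_apply_mem _ _
  have hle : Submodule.span ℝ (Z : Set E) ≤ (ℝ ∙ y)ᗮ :=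
    Submodule.span_le.2 fun z hz => Submodule.mem_orthogonal_singleton_iff_inner_right.2 (hy z hz)
  exact hv (Submodule.mem_orthogonal_singleton_iff_inner_right.1 (hle hm))

theorem norm_sub_normalize_le {y y₁ : E} (hy : ‖y‖ = 1) (hy₁ : y₁ ≠ 0) :
    ‖y - ‖y₁‖⁻¹ • y₁‖ ≤ 2 * ‖y - y₁‖ := by
  have hn : 0 < ‖y₁‖ := norm_pos_iff.2 hy₁
  have h1 : ‖y₁ - ‖y₁‖⁻¹ • y₁‖ = |‖y₁‖ - 1| := by
    have : y₁ - ‖y₁‖⁻¹ • y₁ = (1 - ‖y₁‖⁻¹) • y₁ := by rw [sub_smul, one_smul]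
    rw [this, norm_smul, Real.norm_eq_abs]
    nth_rewrite 2 [← abs_of_pos hn]
    rw [← abs_mul, sub_mul, one_mul, inv_mul_cancel₀ hn.ne']
  have h2 : |‖y₁‖ - 1| ≤ ‖y - y₁‖ := by
    rw [← hy, norm_sub_rev y]
    exact abs_norm_sub_norm_le _ _
  calc _ = ‖(y - y₁) + (y₁ - ‖y₁‖⁻¹ • y₁)‖ := by congr 1; abel
    _ ≤ ‖y - y₁‖ + ‖y₁ - ‖y₁‖⁻¹ • y₁‖ := norm_add_le _ _
    _ ≤ _ := by rw [h1]; linarith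

/-- Induction on the number of vectors not orthogonal to `y`. If one of them is nearly orthogonal,
`y` is moved to be exactly orthogonal to it while keeping the existing orthogonalities, and the
scale grows by a fixed factor. The bound `t - r`, rather than `t`, makes successive displacements
telescope. -/
theorem exists_scale_aux (V : Finset E) {K : ℝ} (hK : 0 < K) (N : ℕ) :
    ∃ A r₀ : ℝ, 1 ≤ A ∧ 0 < r₀ ∧ ∀ y : E, ‖y‖ = 1 → ∀ r, 0 < r → r ≤ r₀ →
      (V.filter fun v => ⟪y, v⟫ ≠ 0).card ≤ N →
      ∃ y' : E, ‖y'‖ = 1 ∧ ∃ t, r ≤ t ∧ t ≤ A * r ∧ ‖y - y'‖ ≤ t - r ∧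
        ∀ v ∈ V, ⟪y', v⟫ = 0 ∨ K * t ≤ |⟪y', v⟫| := by
  classical
  induction N with
  | zero =>
    refine ⟨1, 1, le_rfl, one_pos, fun y hy r hr _ hc => ⟨y, hy, r, le_rfl, by simp, by simp, ?_⟩⟩
    intro v hv
    left
    by_contra h
    have : v ∈ V.filter fun v => ⟪y, v⟫ ≠ 0 := Finset.mem_filter.2 ⟨hv, h⟩
    rw [Finset.card_eq_zero.1 (Nat.le_zero.1 hc)] at this
    simp at this
  | succ N ih =>
    obtain ⟨A, r₀, hA, hr₀, H⟩ := ih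
    obtain ⟨δ, hδ, hδ'⟩ := exists_pos_le_of_finset (V.powerset ×ˢ V)
      (fun i => if orthComp i.1 i.2 = 0 then 1 else ‖orthComp i.1 i.2‖) fun i _ => by
        split_ifs with h
        · exact one_pos
        · exact norm_pos_iff.2 h
    -- The displacement below is at most `2 K r / δ = (M - 1) r`.
    set M : ℝ := 1 + 2 * K / δ with hM
    have hMpos : 1 ≤ M := by
      have : 0 ≤ 2 * K / δ := by positivity
      linarith
    have hM0 : 0 < M := by linarith
    have hAM : 1 ≤ A * M := by nlinarith
    -- The first bound on `r` forces `K r / δ ≤ 1/2`, hence `y₁ ≠ 0`; the second lets the induction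
    -- hypothesis be used at scale `M r`.
    refine ⟨A * M, min (δ / (2 * K)) (r₀ / M), hAM, by positivity, ?_⟩
    intro y hy r hr hrle hc
    by_cases hgood : ∀ v ∈ V, ⟪y, v⟫ = 0 ∨ K * r ≤ |⟪y, v⟫|
    · exact ⟨y, hy, r, le_rfl, le_mul_of_one_le_left hr.le hAM, by simp, hgood⟩
    push Not at hgood
    obtain ⟨v₀, hv₀, hne, hlt⟩ := hgood
    set Z := V.filter fun v => ⟪y, v⟫ = 0 with hZ
    have hyZ : ∀ z ∈ Z, ⟪y, z⟫ = 0 := fun z hz => (Finset.mem_filter.1 hz).2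
    have hw : orthComp Z v₀ ≠ 0 := orthComp_ne_zero hyZ hne
    set w := orthComp Z v₀ with hwdef
    have hδw : δ ≤ ‖w‖ := by
      have := hδ' (Z, v₀) (Finset.mem_product.2
        ⟨Finset.mem_powerset.2 (Finset.filter_subset _ _), hv₀⟩)
      simpa [← hwdef, hw] using this
    have hwpos : 0 < ‖w‖ := norm_pos_iff.2 hw
    -- As `w ⊥ Z` and `⟪w, v₀⟫ = ‖w‖²`, this makes `y₁` orthogonal to `v₀` and keeps it orthogonal
    -- to `Z`.
    set y₁ := y - (⟪y, v₀⟫ / ‖w‖ ^ 2) • w with hy₁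
    have hdist : ‖y - y₁‖ ≤ K * r / δ := by
      rw [hy₁, sub_sub_cancel, norm_smul, norm_div, norm_pow, norm_norm, Real.norm_eq_abs]
      have : |⟪y, v₀⟫| / ‖w‖ ^ 2 * ‖w‖ = |⟪y, v₀⟫| / ‖w‖ := by
        field_simp
      rw [this]
      exact div_le_div₀ (by positivity) hlt.le hδ hδw
    have hrδ : r ≤ δ / (2 * K) := hrle.trans (min_le_left _ _)
    have hhalf : K * r / δ ≤ 1 / 2 := by
      rw [div_le_iff₀ hδ]
      rw [le_div_iff₀ (by positivity)] at hrδ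
      linarith
    have hy₁0 : y₁ ≠ 0 := by
      intro h
      rw [h, sub_zero, hy] at hdist
      linarith
    have hn1 : ‖‖y₁‖⁻¹ • y₁‖ = 1 := by
      rw [norm_smul, norm_inv, norm_norm, inv_mul_cancel₀ (norm_ne_zero_iff.2 hy₁0)]
    have hinZ : ∀ z ∈ Z, ⟪y₁, z⟫ = 0 := fun z hz => by
      rw [hy₁, inner_sub_left, hyZ z hz, real_inner_smul_left, inner_orthComp_of_mem hz]
      simp
    have hinv : ⟪y₁, v₀⟫ = 0 := by
      rw [hy₁, inner_sub_left, real_inner_smul_left, inner_orthComp_self,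
        ← hwdef, div_mul_cancel₀ _ (by positivity), sub_self]
    have hcard : (V.filter fun v => ⟪‖y₁‖⁻¹ • y₁, v⟫ ≠ 0).card ≤ N := by
      refine Nat.lt_succ_iff.1 (lt_of_lt_of_le (Finset.card_lt_card ?_) hc)
      refine (Finset.ssubset_iff_of_subset ?_).2 ⟨v₀, Finset.mem_filter.2 ⟨hv₀, hne⟩, ?_⟩
      · intro v hv
        rw [Finset.mem_filter] at hv ⊢
        refine ⟨hv.1, fun h0 => hv.2 ?_⟩
        rw [real_inner_smul_left, hinZ v (Finset.mem_filter.2 ⟨hv.1, h0⟩), mul_zero]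
      · rw [Finset.mem_filter, real_inner_smul_left, hinv]
        simp
    have hr1 : M * r ≤ r₀ := by
      have := hrle.trans (min_le_right _ _)
      rw [le_div_iff₀ hM0] at this
      linarith
    obtain ⟨y', hy', t, ht1, ht2, ht3, ht4⟩ := H _ hn1 (M * r) (by positivity) hr1 hcard
    refine ⟨y', hy', t, by nlinarith, by linarith, ?_, ht4⟩
    have h1 := norm_sub_normalize_le hy hy₁0
    have h2 : M * r = r + 2 * (K * r / δ) := by
      rw [hM]
      ring
    calc ‖y - y'‖ = ‖(y - ‖y₁‖⁻¹ • y₁) + (‖y₁‖⁻¹ • y₁ - y')‖ := by congr 1; abel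
      _ ≤ ‖y - ‖y₁‖⁻¹ • y₁‖ + ‖‖y₁‖⁻¹ • y₁ - y'‖ := norm_add_le _ _
      _ ≤ t - r := by linarith

/-- Near every unit vector `y` and at every small scale `r` there are a unit vector `y'` and a
comparable scale `t` such that every `v ∈ V` is orthogonal to `y'` or far from being so. -/
theorem exists_scale (V : Finset E) {K : ℝ} (hK : 0 < K) :
    ∃ A r₀ : ℝ, 1 ≤ A ∧ 0 < r₀ ∧ ∀ y : E, ‖y‖ = 1 → ∀ r, 0 < r → r ≤ r₀ →
      ∃ y' : E, ‖y'‖ = 1 ∧ ∃ t, r ≤ t ∧ t ≤ A * r ∧ ‖y - y'‖ ≤ t ∧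
        ∀ v ∈ V, ⟪y', v⟫ = 0 ∨ K * t ≤ |⟪y', v⟫| := by
  obtain ⟨A, r₀, hA, hr₀, H⟩ := exists_scale_aux V hK V.card
  refine ⟨A, r₀, hA, hr₀, fun y hy r hr hrle => ?_⟩
  obtain ⟨y', hy', t, h1, h2, h3, h4⟩ := H y hy r hr hrle (Finset.card_filter_le _ _)
  exact ⟨y', hy', t, h1, h2, by linarith, h4⟩

end ScaleSelection

/-! ### The function `1 - ⟪x, y⟫` and cutoffs built from it. -/

section LocalUncertainty

variable {d : ℕ} {R P : Finset (Space d)} {κ : Space d → ℝ≥0}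

open MvPolynomial Filter Topology

/-- The function `x ↦ 1 - ⟪x, y⟫`. -/
noncomputable def gap (y x : Space d) : ℝ := 1 - ⟪x, y⟫

/-- The polynomial `1 - ⟪x, y⟫`. -/
noncomputable def gapP (y : Space d) : MvPolynomial (Fin d) ℂ :=
  1 - ∑ i, C ((y i : ℝ) : ℂ) * X i

theorem ev_gapP (y x : Space d) : ev (gapP y) x = (gap y x : ℂ) := by
  rw [gap, gapP, ev_sub, ev_one, ev_sum]
  push_cast
  rw [ofReal_inner]
  simp [mul_comm]

theorem pderiv_gapP (y : Space d) (i : Fin d) : pderiv i (gapP y) = -C ((y i : ℝ) : ℂ) := by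
  classical
  rw [gapP, map_sub, map_sum]
  simp only [pderiv_C_mul, pderiv_X, Pi.single_apply, pderiv_one]
  simp

theorem ev_dirP_gapP (v y x : Space d) : ev (dirP v (gapP y)) x = -((⟪y, v⟫ : ℝ) : ℂ) := by
  rw [ev_dirP, ofReal_inner]
  simp [pderiv_gapP, mul_comm]

theorem eulP_gapP (y : Space d) : eulP (gapP y) = gapP y - 1 := by
  simp only [eulP, pderiv_gapP, mul_neg, Finset.sum_neg_distrib]
  rw [gapP, sub_sub_cancel_left]
  simp only [mul_comm]

theorem ev_sphLapP_gapP (y : Space d) (x : Sph d) :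
    ev (sphLapP (gapP y)) x = ((d : ℂ) - 1) * ((⟪(x : Space d), y⟫ : ℝ) : ℂ) := by
  have h1 : eulP (gapP y - 1) = gapP y - 1 := by
    have : eulP (gapP y - 1) = eulP (gapP y) := by
      simp [eulP]
    rw [this, eulP_gapP]
  have h2 : lapP (gapP y) = 0 := by
    simp only [lapP, pderiv_gapP, map_neg, pderiv_C, neg_zero, Finset.sum_const_zero]
  rw [ev_sphLapP, eulP_gapP, h1, h2, ev_zero, ev_sub, ev_gapP, gap, ev_one]
  push_cast
  ring

/-- The left side equals `1 - ⟪x, y⟫² = gap (2 - gap)`. -/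
theorem gradSq_gapP {y : Space d} (hy : ‖y‖ = 1) (x : Sph d) :
    gradSq (ev (gapP y)) x ≤ 2 * gap y x := by
  have h1 : ((gradSq (ev (gapP y)) x : ℝ) : ℂ) = ((1 - ⟪(x : Space d), y⟫ ^ 2 : ℝ) : ℂ) := by
    rw [← gradProd_cj (contDiff_ev _), gradProd]
    simp only [angD_cj (contDiff_ev _), angD_ev, ev_angP, pderiv_gapP, ev_neg, ev_C, map_sub, map_mul,
      map_neg, Complex.conj_ofReal]
    rw [lagrange_identity, sum_ofReal_sq]
    have h2 : ∑ i, -((y i : ℝ) : ℂ) * -((y i : ℝ) : ℂ) = 1 := by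
      rw [← sum_ofReal_sq (⟨y, by simpa using hy⟩ : Sph d)]
      exact Finset.sum_congr rfl fun i _ => by ring
    have h3 : ∑ i, (((x : Space d) i : ℝ) : ℂ) * -((y i : ℝ) : ℂ) =
        -((⟪(x : Space d), y⟫ : ℝ) : ℂ) := by
      rw [ofReal_inner, ← Finset.sum_neg_distrib]
      exact Finset.sum_congr rfl fun i _ => by ring
    rw [h2, h3]
    push_cast
    ring
  have h2 : gradSq (ev (gapP y)) x = 1 - ⟪(x : Space d), y⟫ ^ 2 := by exact_mod_cast h1
  rw [h2, gap]
  nlinarith [sq_nonneg (1 - ⟪(x : Space d), y⟫)]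

theorem gap_eq {x y : Space d} (hx : ‖x‖ = 1) (hy : ‖y‖ = 1) : gap y x = ‖x - y‖ ^ 2 / 2 := by
  rw [norm_sub_sq_real, hx, hy, gap]
  ring

/-- The square of the positive part. -/
noncomputable def posSq (s : ℝ) : ℝ := max 0 s ^ 2

theorem hasDerivAt_posSq (s : ℝ) : HasDerivAt posSq (2 * max 0 s) s := by
  rcases lt_trichotomy s 0 with h | h | h
  · have h1 : HasDerivAt (fun _ : ℝ => (0 : ℝ)) 0 s := hasDerivAt_const _ _
    rw [max_eq_left h.le, mul_zero]
    refine h1.congr_of_eventuallyEq ?_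
    filter_upwards [Iio_mem_nhds h] with t ht
    simp [posSq, max_eq_left (Set.mem_Iio.1 ht).le]
  · subst h
    rw [max_self, mul_zero, hasDerivAt_iff_isLittleO]
    have h2 : (fun t : ℝ => t ^ 2) =o[𝓝 0] fun t : ℝ => t := by
      simpa using Asymptotics.isLittleO_pow_pow (𝕜 := ℝ) (one_lt_two)
    refine Asymptotics.IsBigO.trans_isLittleO ?_ (by simpa using h2)
    refine Asymptotics.IsBigO.of_bound 1 (Eventually.of_forall fun t => ?_)
    simp only [posSq, max_self, sub_zero, smul_zero, one_mul]
    rw [zero_pow two_ne_zero, sub_zero, Real.norm_eq_abs, Real.norm_eq_abs, abs_pow, abs_pow]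
    refine pow_le_pow_left₀ (abs_nonneg _) ?_ 2
    rcases le_total t 0 with h | h
    · simp [max_eq_left h]
    · rw [max_eq_right h]
  · have h1 : HasDerivAt (fun t : ℝ => t ^ 2) (2 * s) s := by simpa using hasDerivAt_pow 2 s
    rw [max_eq_right h.le]
    refine h1.congr_of_eventuallyEq ?_
    filter_upwards [Ioi_mem_nhds h] with t ht
    simp [posSq, max_eq_right (Set.mem_Ioi.1 ht).le]

theorem contDiff_posSq : ContDiff ℝ 1 posSq := by
  rw [contDiff_one_iff_deriv]
  refine ⟨fun s => (hasDerivAt_posSq s).differentiableAt, ?_⟩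
  have : deriv posSq = fun s => 2 * max 0 s := funext fun s => (hasDerivAt_posSq s).deriv
  rw [this]
  fun_prop

theorem contDiff_gap (y : Space d) : ContDiff ℝ 1 (gap y) := by
  unfold gap
  exact contDiff_const.sub (contDiff_id.inner ℝ contDiff_const)

/-- A cutoff function supported in the cap `1 - ⟪x, y⟫ ≤ b`. -/
noncomputable def cutoff (y : Space d) (b : ℝ) (x : Space d) : ℝ := posSq (1 - gap y x / b)

theorem contDiff_cutoff (y : Space d) (b : ℝ) : ContDiff ℝ 1 (cutoff y b) :=
  contDiff_posSq.comp (contDiff_const.sub ((contDiff_gap y).div_const b))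

theorem angD_mul {f g : Space d → ℂ} (hf : ContDiff ℝ 1 f) (hg : ContDiff ℝ 1 g) (i j : Fin d)
    (x : Space d) : angD i j (f * g) x = angD i j f x * g x + f x * angD i j g x := by
  rw [angD, fderiv_mul (hf.differentiable one_ne_zero x) (hg.differentiable one_ne_zero x)]
  simp [angD]
  ring

theorem angD_ofReal {g : Space d → ℝ} (hg : ContDiff ℝ 1 g) (i j : Fin d) (x : Space d) :
    angD i j (fun x => (g x : ℂ)) x = ((fderiv ℝ g x (rotGen i j x) : ℝ) : ℂ) := by
  have h : HasFDerivAt (fun x => (g x : ℂ)) (Complex.ofRealCLM.comp (fderiv ℝ g x)) x :=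
    Complex.ofRealCLM.hasFDerivAt.comp x (hg.differentiable one_ne_zero x).hasFDerivAt
  rw [angD, h.fderiv]
  rfl

theorem hasFDerivAt_cutoff (y : Space d) (b : ℝ) (x : Space d) :
    HasFDerivAt (cutoff y b)
      ((2 * max 0 (1 - gap y x / b)) • -(b⁻¹ • fderiv ℝ (gap y) x)) x := by
  have h0 := ((contDiff_gap y).differentiable one_ne_zero x).hasFDerivAt
  have h1 : HasFDerivAt (fun z => 1 - gap y z * b⁻¹) (-(b⁻¹ • fderiv ℝ (gap y) x)) x :=
    (h0.mul_const b⁻¹).const_sub 1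
  have h2 := HasDerivAt.comp_hasFDerivAt (h₂ := posSq) (f := fun z => 1 - gap y z * b⁻¹) x
    (hasDerivAt_posSq (1 - gap y x * b⁻¹)) h1
  exact h2

theorem angD_cutoff (y : Space d) (b : ℝ) (i j : Fin d) (x : Space d) :
    angD i j (fun x => (cutoff y b x : ℂ)) x =
      ((-(2 * max 0 (1 - gap y x / b) / b) : ℝ) : ℂ) * angD i j (ev (gapP y)) x := by
  have h4 : ev (gapP y) = fun z : Space d => ((gap y z : ℝ) : ℂ) := by
    funext z
    rw [ev_gapP]
  rw [angD_ofReal (contDiff_cutoff y b), h4, angD_ofReal (contDiff_gap y),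
    (hasFDerivAt_cutoff y b x).fderiv, ← Complex.ofReal_mul, Complex.ofReal_inj]
  simp only [smul_apply, neg_apply, smul_eq_mul]
  ring

theorem cutoff_nonneg (y : Space d) (b : ℝ) (x : Space d) : 0 ≤ cutoff y b x := sq_nonneg _

theorem cutoff_le_one {y : Space d} {b : ℝ} (hb : 0 < b) {x : Space d} (hx : 0 ≤ gap y x) :
    cutoff y b x ≤ 1 := by
  have h1 : max 0 (1 - gap y x / b) ≤ 1 :=
    max_le zero_le_one (sub_le_self _ (by positivity))
  exact pow_le_one₀ (le_max_left _ _) h1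

/-- This bound later removes the cutoff at the cost of a multiple of the gap. -/
theorem le_cutoff (y : Space d) (b : ℝ) (x : Space d) : 1 - 2 * gap y x / b ≤ cutoff y b x := by
  rw [cutoff, posSq, mul_div_assoc]
  rcases le_total (1 - gap y x / b) 0 with h | h
  · rw [max_eq_left h]
    linarith
  · rw [max_eq_right h]
    nlinarith [sq_nonneg (gap y x / b)]

theorem gap_lt_of_cutoff_ne_zero {y : Space d} {b : ℝ} (hb : 0 < b) {x : Space d}
    (hx : cutoff y b x ≠ 0) : gap y x < b := by
  by_contra! h
  apply hx
  rw [cutoff, posSq, max_eq_left, zero_pow two_ne_zero]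
  rw [sub_nonpos, le_div_iff₀ hb, one_mul]
  exact h

end LocalUncertainty

/-! ### The uncertainty inequality for concentrated functions. -/

section LocalUncertaintyMain

variable {d : ℕ} {R P : Finset (Space d)} {κ : Space d → ℝ≥0}

open MvPolynomial Filter Topology

theorem measurable_inv_inner (v : Space d) : Measurable fun x : Space d => ⟪x, v⟫⁻¹ :=
  Measurable.inv (Continuous.measurable (by fun_prop))

theorem integrable_inv_inner_mul {F : Space d → ℂ} (hF : Continuous F) {v : Space d} {c : ℝ}
    (hc : 0 < c) (hs : ∀ x : Sph d, F x ≠ 0 → c ≤ |⟪(x : Space d), v⟫|) :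
    Integrable (fun x : Sph d => ((⟪(x : Space d), v⟫⁻¹ : ℝ) : ℂ) * F x) (wMeasure P κ) := by
  obtain ⟨M, hM, hMb⟩ := exists_bound_sph hF
  refine integrable_of_bound (C := c⁻¹ * M) ?_ fun x => ?_
  · exact ((Complex.measurable_ofReal.comp (measurable_inv_inner v)).comp
      measurable_subtype_coe).mul (hF.measurable.comp measurable_subtype_coe)
  · rw [norm_mul, Complex.norm_real, Real.norm_eq_abs, abs_inv]
    by_cases h : F x = 0
    · rw [h, norm_zero, mul_zero]
      positivity
    · exact mul_le_mul (inv_anti₀ hc (hs x h)) (hMb x) (norm_nonneg _) (by positivity)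

theorem integrable_symIntegrand_zero (hR : IsRootSystem R)
    (hP : IsPositiveSubsystem R P) {f : Space d → ℂ} (hf : ContDiff ℝ 1 f)
    (p : MvPolynomial (Fin d) ℂ) :
    Integrable (fun x : Sph d => symIntegrand P κ f p 0 x) (wMeasure P κ) := by
  obtain ⟨C, -, hC⟩ := exists_bound_symIntegrand (κ := κ) hR hP hf p
  refine integrable_of_bound ?_ (hC 0 le_rfl)
  have hm : ∀ {g : Space d → ℂ}, Continuous g → Measurable fun x : Sph d => g x := fun hg =>
    hg.measurable.comp measurable_subtype_coe
  have hfc := hf.continuous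
  have hq : ∀ v, Measurable fun x : Sph d => ⟪(x : Space d), v⟫ / (⟪(x : Space d), v⟫ ^ 2 + 0) :=
    fun v => Measurable.div (Continuous.measurable (by fun_prop))
      (Continuous.measurable (by fun_prop))
  have hl : ∀ v, Measurable fun x : Sph d => ⟪(x : Space d), v⟫ :=
    fun v => Continuous.measurable (by fun_prop)
  have e1 := continuous_ev (eulP p)
  unfold symIntegrand
  refine ((hm (continuous_gradProd hf (contDiff_ev p))).add
    (hm (hfc.mul (continuous_ev (sphLapP p))))).add (Finset.measurable_fun_sum _ fun v _ => ?_)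
  have e2 := continuous_ev (dirP v p)
  have e3 := continuous_refl v
  refine measurable_const.mul ((Measurable.mul ?_ ?_).sub (Measurable.mul ?_ ?_))
  · exact Complex.measurable_ofReal.comp (hq v)
  · exact hm (g := fun x => f x * ev (dirP v p) x - f (refl v x) * ev (dirP v p) (refl v x))
      (by fun_prop)
  · exact measurable_const.mul (Complex.measurable_ofReal.comp ((hq v).mul (hl v)))
  · exact hm (hfc.mul e1)

/-- Here the symmetrization can be undone. If `⟪y, v⟫ ≠ 0`, then `F` is supported away from the
mirror of `v`, so `H v = F / ⟪x, v⟫` is integrable and `H v ∘ σ_v - H v` has integral zero. If `⟪y,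
v⟫ = 0`, the singular term is absent because `∂_v gap = -⟪y, v⟫`. -/
theorem integral_gap_identity (hR : IsRootSystem R) (hκ : IsMultiplicity R κ)
    (hP : IsPositiveSubsystem R P) {F : Space d → ℂ} (hF : ContDiff ℝ 1 F) (y : Space d) {c : ℝ}
    (hc : 0 < c) (hs : ∀ v ∈ P, ⟪y, v⟫ ≠ 0 → ∀ x : Sph d, F x ≠ 0 → c ≤ |⟪(x : Space d), v⟫|) :
    Integrable (fun x : Sph d => gradProd F (ev (gapP y)) x + F x *
      ((((d : ℝ) - 1 + 2 * ∑ v ∈ P, (κ v : ℝ)) * ⟪(x : Space d), y⟫ -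
        2 * ∑ v ∈ P, (κ v : ℝ) * (⟪y, v⟫ / ⟪(x : Space d), v⟫) : ℝ) : ℂ)) (wMeasure P κ) ∧
    ∫ x : Sph d, (gradProd F (ev (gapP y)) x + F x *
      ((((d : ℝ) - 1 + 2 * ∑ v ∈ P, (κ v : ℝ)) * ⟪(x : Space d), y⟫ -
        2 * ∑ v ∈ P, (κ v : ℝ) * (⟪y, v⟫ / ⟪(x : Space d), v⟫) : ℝ) : ℂ)) ∂(wMeasure P κ) = 0 := by
  set H : Space d → Space d → ℂ := fun v x => ((⟪x, v⟫⁻¹ : ℝ) : ℂ) * F x with hH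
  have hFc := hF.continuous
  have iT : ∀ v ∈ P, Integrable (fun x : Sph d => (κ v : ℂ) * ((⟪y, v⟫ : ℝ) : ℂ) *
      (H v (refl v x) - H v x)) (wMeasure P κ) ∧ ∫ x : Sph d, (κ v : ℂ) * ((⟪y, v⟫ : ℝ) : ℂ) *
      (H v (refl v x) - H v x) ∂(wMeasure P κ) = 0 := by
    intro v hv
    by_cases h0 : ⟪y, v⟫ = 0
    · simp [h0]
    have i1 : Integrable (fun x : Sph d => H v x) (wMeasure P κ) :=
      integrable_inv_inner_mul hFc hc (hs v hv h0)
    have hvR := hR.1 v (hP.subset hv)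
    have i2 : Integrable (fun x : Sph d => H v (refl v x)) (wMeasure P κ) := by
      have h := integrable_inv_inner_mul (P := P) (κ := κ) (F := fun x => F (refl v x)) (v := v)
        (hFc.comp (continuous_refl v)) hc (fun x hx => by
          have := hs v hv h0 (sphMap (refl v) x) hx
          rwa [coe_sphMap, inner_refl_self hvR, abs_neg] at this)
      refine h.neg.congr (Eventually.of_forall fun x => ?_)
      simp only [hH, inner_refl_self hvR, Pi.neg_apply, inv_neg]
      push_cast
      ring
    refine ⟨(i2.sub i1).const_mul _, ?_⟩
    rw [integral_const_mul, integral_sub i2 i1,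
      integral_wMeasure_refl hR hκ hP (hP.subset hv) (H v), sub_self, mul_zero]
  have iS := integrable_finsetSum P fun v hv => (iT v hv).1
  have hS : ∫ x : Sph d, ∑ v ∈ P, (κ v : ℂ) * ((⟪y, v⟫ : ℝ) : ℂ) * (H v (refl v x) - H v x)
      ∂(wMeasure P κ) = 0 := by
    rw [integral_finsetSum _ fun v hv => (iT v hv).1]
    exact Finset.sum_eq_zero fun v hv => (iT v hv).2
  have i0 := integrable_symIntegrand_zero (κ := κ) hR hP hF (gapP y)
  have h0 := integral_symIntegrand_zero hR hκ hP hF (gapP y)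
  have hsum : ∀ᵐ x : Sph d ∂(wMeasure P κ), ∀ v ∈ P, (κ v : ℂ) *
      ((⟪(x : Space d), v⟫⁻¹ * ⟪(x : Space d), v⟫ : ℝ) : ℂ) = (κ v : ℂ) := by
    rw [Finset.eventually_all]
    intro v hv
    by_cases hκv : κ v = 0
    · simp [hκv]
    filter_upwards [ae_inner_ne_zero hv hκv] with x hx
    rw [inv_mul_cancel₀ hx]
    simp
  have hall : ∀ᵐ x : Sph d ∂(wMeasure P κ), symIntegrand P κ F (gapP y) 0 x +
      ∑ v ∈ P, (κ v : ℂ) * ((⟪y, v⟫ : ℝ) : ℂ) * (H v (refl v x) - H v x) =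
      gradProd F (ev (gapP y)) x + F x *
      ((((d : ℝ) - 1 + 2 * ∑ v ∈ P, (κ v : ℝ)) * ⟪(x : Space d), y⟫ -
        2 * ∑ v ∈ P, (κ v : ℝ) * (⟪y, v⟫ / ⟪(x : Space d), v⟫) : ℝ) : ℂ) := by
    filter_upwards [hsum] with x hx
    have hq : ∀ a : ℝ, a / (a ^ 2 + 0) = a⁻¹ := fun a => by
      by_cases ha : a = 0
      · simp [ha]
      · rw [add_zero]; field_simp
    have e : ∑ v ∈ P, (κ v : ℂ) *
      (((⟪(x : Space d), v⟫⁻¹ : ℝ) : ℂ) *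
        (F x * -((⟪y, v⟫ : ℝ) : ℂ) - F (refl v x) * -((⟪y, v⟫ : ℝ) : ℂ)) -
      2 * ((⟪(x : Space d), v⟫⁻¹ * ⟪(x : Space d), v⟫ : ℝ) : ℂ) *
        (F x * -((⟪(x : Space d), y⟫ : ℝ) : ℂ))) +
      ∑ v ∈ P, (κ v : ℂ) * ((⟪y, v⟫ : ℝ) : ℂ) * (H v (refl v x) - H v x) =
      F x * (2 * (∑ v ∈ P, (κ v : ℂ)) * ((⟪(x : Space d), y⟫ : ℝ) : ℂ) -
        2 * ∑ v ∈ P, (κ v : ℂ) * ((⟪y, v⟫ / ⟪(x : Space d), v⟫ : ℝ) : ℂ)) := by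
      rw [mul_assoc, Finset.sum_mul, ← mul_sub, ← Finset.sum_sub_distrib, Finset.mul_sum,
        Finset.mul_sum, ← Finset.sum_add_distrib]
      refine Finset.sum_congr rfl fun v hv => ?_
      simp only [hH, inner_refl_self (hR.1 v (hP.subset hv)), inv_neg, div_eq_mul_inv]
      have h1 := hx v hv
      push_cast at h1 ⊢
      linear_combination (2 * F x * ((⟪(x : Space d), y⟫ : ℝ) : ℂ)) * h1
    have hE : ev (eulP (gapP y)) x = -((⟪(x : Space d), y⟫ : ℝ) : ℂ) := by
      rw [eulP_gapP, ev_sub, ev_gapP, gap, ev_one]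
      push_cast
      ring
    simp only [symIntegrand, hq, ev_sphLapP_gapP, ev_dirP_gapP, hE]
    rw [add_assoc, e]
    push_cast
    ring
  refine ⟨(i0.add iS).congr hall, ?_⟩
  rw [← integral_congr_ae hall, integral_add i0 iS, h0, hS, add_zero]

/-- The localized density `|f|²` times a cutoff. -/
noncomputable def locDensity (f : Space d → ℂ) (y : Space d) (b : ℝ) : Space d → ℂ :=
  cj f * f * fun x => (cutoff y b x : ℂ)

theorem contDiff_locDensity {f : Space d → ℂ} (hf : ContDiff ℝ 1 f) (y : Space d) (b : ℝ) :
    ContDiff ℝ 1 (locDensity f y b) :=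
  ((contDiff_cj hf).mul hf).mul (Complex.ofRealCLM.contDiff.comp (contDiff_cutoff y b))

theorem locDensity_apply (f : Space d → ℂ) (y : Space d) (b : ℝ) (x : Space d) :
    locDensity f y b x = ((‖f x‖ ^ 2 * cutoff y b x : ℝ) : ℂ) := by
  simp only [locDensity, Pi.mul_apply, cj, Complex.conj_mul']
  push_cast
  rfl

theorem norm_angD_locDensity_le {f : Space d → ℂ} (hf : ContDiff ℝ 1 f) {y : Space d} {b : ℝ}
    (hb : 0 < b) (i j : Fin d) {x : Space d} (hx : 0 ≤ gap y x) :
    ‖angD i j (locDensity f y b) x‖ ≤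
      2 * ‖f x‖ * ‖angD i j f x‖ + 2 / b * ‖f x‖ ^ 2 * ‖angD i j (ev (gapP y)) x‖ := by
  have h1 : ContDiff ℝ 1 (cj f * f) := (contDiff_cj hf).mul hf
  have h2 : ContDiff ℝ 1 (fun x => (cutoff y b x : ℂ)) :=
    Complex.ofRealCLM.contDiff.comp (contDiff_cutoff y b)
  have hc1 := cutoff_le_one hb hx
  have hc0 := cutoff_nonneg y b x
  have hm : |-(2 * max 0 (1 - gap y x / b) / b)| ≤ 2 / b := by
    have h3 : max 0 (1 - gap y x / b) ≤ 1 :=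
      max_le zero_le_one (sub_le_self _ (by positivity))
    have h4 : 0 ≤ max 0 (1 - gap y x / b) := le_max_left _ _
    rw [abs_neg, abs_of_nonneg (by positivity)]
    gcongr
    linarith
  rw [locDensity, angD_mul h1 h2, angD_mul (contDiff_cj hf) hf, angD_cj hf, angD_cutoff]
  refine (norm_add_le _ _).trans (add_le_add ?_ ?_)
  · rw [norm_mul, Complex.norm_real, Real.norm_of_nonneg hc0]
    calc _ ≤ ‖starRingEnd ℂ (angD i j f x) * f x + cj f x * angD i j f x‖ * 1 := by gcongr
      _ ≤ ‖starRingEnd ℂ (angD i j f x) * f x‖ + ‖cj f x * angD i j f x‖ := by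
        rw [mul_one]; exact norm_add_le _ _
      _ = 2 * ‖f x‖ * ‖angD i j f x‖ := by
        rw [norm_mul, norm_mul, cj, RCLike.norm_conj, RCLike.norm_conj]
        ring
  · rw [norm_mul, norm_mul, Complex.norm_real, Real.norm_eq_abs, Pi.mul_apply, norm_mul, cj,
      RCLike.norm_conj]
    calc _ ≤ ‖f x‖ * ‖f x‖ * (2 / b * ‖angD i j (ev (gapP y)) x‖) := by gcongr
      _ = _ := by ring

/-- The product rule gives `2 |f| |∇f| |∇gap|` plus the derivative of the cutoff. The first term is
split by the inequality of the means with free weight `a`, then `|∇gap|² ≤ 2 gap` is used. -/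
theorem norm_gradProd_locDensity_le {f : Space d → ℂ} (hf : ContDiff ℝ 1 f) {y : Space d}
    (hy : ‖y‖ = 1) {a b : ℝ} (ha : 0 < a) (hb : 0 < b) (x : Sph d) :
    ‖gradProd (locDensity f y b) (ev (gapP y)) x‖ ≤
      a * gradSq f x + (2 / a + 4 / b) * (gap y x * ‖f x‖ ^ 2) := by
  have hgap : 0 ≤ gap y x := by
    rw [gap_eq (by simp) hy]
    positivity
  have hij : ∀ i j, ‖angD i j (locDensity f y b) x * angD i j (ev (gapP y)) x‖ ≤
      a * ‖angD i j f x‖ ^ 2 + (1 / a + 2 / b) * ‖f x‖ ^ 2 * ‖angD i j (ev (gapP y)) x‖ ^ 2 := by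
    intro i j
    rw [norm_mul]
    have h1 := norm_angD_locDensity_le hf hb i j hgap (x := x)
    set D := ‖angD i j f x‖
    set E := ‖angD i j (ev (gapP y)) x‖ with hE
    have hE0 : 0 ≤ E := norm_nonneg _
    have h2 : 2 * (‖f x‖ * E) * D ≤ a * D ^ 2 + 1 / a * (‖f x‖ * E) ^ 2 := by
      have : a * D ^ 2 + 1 / a * (‖f x‖ * E) ^ 2 - 2 * (‖f x‖ * E) * D =
          1 / a * (a * D - ‖f x‖ * E) ^ 2 := by
        field_simp
        ring
      have h3 : 0 ≤ 1 / a * (a * D - ‖f x‖ * E) ^ 2 := by positivity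
      linarith
    calc _ ≤ (2 * ‖f x‖ * D + 2 / b * ‖f x‖ ^ 2 * E) * E := by gcongr
      _ = 2 * (‖f x‖ * E) * D + 2 / b * (‖f x‖ ^ 2 * E ^ 2) := by ring
      _ ≤ a * D ^ 2 + 1 / a * (‖f x‖ * E) ^ 2 + 2 / b * (‖f x‖ ^ 2 * E ^ 2) := by gcongr
      _ = _ := by ring
  have hsum : ‖gradProd (locDensity f y b) (ev (gapP y)) x‖ ≤
      a * gradSq f x + (1 / a + 2 / b) * ‖f x‖ ^ 2 * gradSq (ev (gapP y)) x := by
    rw [gradProd, norm_mul]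
    have h1 : ‖(1 / 2 : ℂ)‖ = 1 / 2 := by simp
    rw [h1]
    calc _ ≤ 1 / 2 * ∑ i, ∑ j, (a * ‖angD i j f x‖ ^ 2 +
          (1 / a + 2 / b) * ‖f x‖ ^ 2 * ‖angD i j (ev (gapP y)) x‖ ^ 2) := by
          gcongr
          refine (norm_sum_le _ _).trans (Finset.sum_le_sum fun i _ => ?_)
          exact (norm_sum_le _ _).trans (Finset.sum_le_sum fun j _ => hij i j)
      _ = _ := by
          simp only [Finset.sum_add_distrib, ← Finset.mul_sum, gradSq]
          ring
  refine hsum.trans (add_le_add le_rfl ?_)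
  calc _ ≤ (1 / a + 2 / b) * ‖f x‖ ^ 2 * (2 * gap y x) :=
        mul_le_mul_of_nonneg_left (gradSq_gapP hy x) (by positivity)
    _ = _ := by ring

theorem div_le_of_abs_sub_le {a b η : ℝ} (ha : a ≠ 0) (hη : η ≤ 1 / 2) (hη0 : 0 ≤ η)
    (h : |b - a| ≤ η * |a|) : a / b ≤ 1 + 2 * η := by
  have h1 : 1 - η ≤ b / a := by
    have h2 : |b / a - 1| ≤ η := by
      have : b / a - 1 = (b - a) / a := by field_simp
      rw [this, abs_div, div_le_iff₀ (abs_pos.2 ha)]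
      exact h
    linarith [(abs_le.1 h2).1]
  have h3 : a / b = 1 / (b / a) := by rw [one_div_div]
  have h4 : 0 < b / a := by linarith
  rw [h3, div_le_iff₀ h4]
  nlinarith

/-- On the cap `‖x - y‖ < √200 t`, and `‖v‖ = √2`, so `⟪x, v⟫` and `⟪y, v⟫` differ by at most `20
t`. The main part is at least `(d - 1 + 2|κ|) - 2|κ| ≥ 1`; replacing `⟪x, y⟫` by `1` and bounding
the quotients by `1 + 2η` cost at most `1/4` each. -/
theorem bracket_lower_bound (hR : IsRootSystem R) (hP : IsPositiveSubsystem R P) (hd : 2 ≤ d)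
    {y : Space d} (hy : ‖y‖ = 1) {t : ℝ} (ht : 0 < t)
    (hsmall : 400 * ((d : ℝ) - 1 + 2 * ∑ v ∈ P, (κ v : ℝ)) * t ^ 2 ≤ 1)
    (hsep : ∀ v ∈ P, ⟪y, v⟫ = 0 ∨ 40 * (8 * ∑ v ∈ P, (κ v : ℝ) + 1) * t ≤ |⟪y, v⟫|)
    {x : Sph d} (hx : gap y x < 100 * t ^ 2) :
    (∀ v ∈ P, ⟪y, v⟫ ≠ 0 → 20 * t ≤ |⟪(x : Space d), v⟫|) ∧
    1 / 2 ≤ ((d : ℝ) - 1 + 2 * ∑ v ∈ P, (κ v : ℝ)) * ⟪(x : Space d), y⟫ -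
        2 * ∑ v ∈ P, (κ v : ℝ) * (⟪y, v⟫ / ⟪(x : Space d), v⟫) := by
  set k : ℝ := ∑ v ∈ P, (κ v : ℝ) with hk
  have hk0 : 0 ≤ k := Finset.sum_nonneg fun v _ => (κ v).2
  have hd' : (2 : ℝ) ≤ d := by exact_mod_cast hd
  have hdist : ‖(x : Space d) - y‖ ^ 2 < 200 * t ^ 2 := by
    rw [gap_eq (by simp) hy] at hx
    linarith
  have hclose : ∀ v ∈ P, |⟪(x : Space d), v⟫ - ⟪y, v⟫| ≤ 20 * t := by
    intro v hv
    have hv2 : ‖v‖ ^ 2 = 2 := by rw [← real_inner_self_eq_norm_sq, hR.1 v (hP.subset hv)]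
    rw [← inner_sub_left]
    refine (abs_real_inner_le_norm _ _).trans ?_
    refine abs_le_of_sq_le_sq' ?_ (by positivity) |>.2
    rw [mul_pow, hv2]
    linarith
  constructor
  · intro v hv h0
    have h1 := (hsep v hv).resolve_left h0
    have h2 := hclose v hv
    have h3 : |⟪y, v⟫| ≤ |⟪(x : Space d), v⟫ - ⟪y, v⟫| + |⟪(x : Space d), v⟫| := by
      have := abs_sub_abs_le_abs_sub ⟪y, v⟫ ⟪(x : Space d), v⟫
      rw [abs_sub_comm] at this
      linarith
    nlinarith [mul_nonneg hk0 ht.le]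
  -- The relative error: `20 t` divided by the separation `40 (8k + 1) t`.
  · set η : ℝ := 1 / (2 * (8 * k + 1)) with hη
    have hη0 : 0 ≤ η := by positivity
    have hη2 : η ≤ 1 / 2 := by
      rw [hη, div_le_div_iff₀ (by positivity) (by norm_num)]
      linarith
    have hterm : ∀ v ∈ P, (κ v : ℝ) * (⟪y, v⟫ / ⟪(x : Space d), v⟫) ≤ (κ v : ℝ) * (1 + 2 * η) := by
      intro v hv
      refine mul_le_mul_of_nonneg_left ?_ (κ v).2
      by_cases h0 : ⟪y, v⟫ = 0
      · rw [h0, zero_div]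
        positivity
      · refine div_le_of_abs_sub_le h0 hη2 hη0 ((hclose v hv).trans ?_)
        have h1 := (hsep v hv).resolve_left h0
        have h2 : η * (40 * (8 * k + 1) * t) = 20 * t := by
          rw [hη]
          field_simp
          ring
        rw [← h2]
        exact mul_le_mul_of_nonneg_left h1 hη0
    have hsum := Finset.sum_le_sum hterm
    rw [← Finset.sum_mul, ← hk] at hsum
    have hkη : k * (2 * η) ≤ 1 / 8 := by
      rw [hη]
      have : k * (2 * (1 / (2 * (8 * k + 1)))) = k / (8 * k + 1) := by field_simp
      rw [this, div_le_div_iff₀ (by positivity) (by norm_num)]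
      linarith
    have hin : ⟪(x : Space d), y⟫ = 1 - gap y x := by
      rw [gap]
      ring
    rw [hin]
    have hΛ : 0 ≤ (d : ℝ) - 1 + 2 * k := by linarith
    have h5 : ((d : ℝ) - 1 + 2 * k) * gap y x ≤ 1 / 4 := by
      have := mul_le_mul_of_nonneg_left hx.le hΛ
      nlinarith
    nlinarith

theorem local_uncertainty (hR : IsRootSystem R) (hκ : IsMultiplicity R κ)
    (hP : IsPositiveSubsystem R P) (hd : 2 ≤ d) :
    ∃ c r₀ : ℝ, 0 < c ∧ 0 < r₀ ∧ ∀ f : Space d → ℂ, ContDiff ℝ 1 f → ∀ y : Sph d,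
      ∀ r, 0 < r → r ≤ r₀ →
      ∫ x : Sph d, gap (y : Space d) x * ‖f x‖ ^ 2 ∂(wMeasure P κ) ≤
        r ^ 2 * ∫ x : Sph d, ‖f x‖ ^ 2 ∂(wMeasure P κ) →
      c * ∫ x : Sph d, ‖f x‖ ^ 2 ∂(wMeasure P κ) ≤
        r ^ 2 * ∫ x : Sph d, gradSq f x ∂(wMeasure P κ) := by
  set k : ℝ := ∑ v ∈ P, (κ v : ℝ) with hk
  have hk0 : 0 ≤ k := Finset.sum_nonneg fun v _ => (κ v).2
  have hd' : (2 : ℝ) ≤ d := by exact_mod_cast hd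
  set Λ : ℝ := (d : ℝ) - 1 + 2 * k with hΛ
  have hΛ0 : 1 ≤ Λ := by linarith
  obtain ⟨A, r₁, hA, hr₁, H⟩ := exists_scale P (K := 40 * (8 * k + 1)) (by positivity)
  have hA0 : 0 < A := by linarith
  -- The second bound on `r` gives `20 Λ t ≤ 1`, hence `400 Λ t² ≤ 1` as `Λ ≥ 1`. The end of the
  -- proof has `9/40 N ≤ 48 A² r² G`, and `240` exceeds `48 · 40 / 9`.
  refine ⟨1 / (240 * A ^ 2), min r₁ (1 / (20 * A * Λ)), by positivity, by positivity, ?_⟩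
  intro f hf y r hr hrle hloc
  obtain ⟨y', hy', t, hrt, htA, hyt, hsep⟩ := H y (by simp) r hr (hrle.trans (min_le_left _ _))
  have ht : 0 < t := hr.trans_le hrt
  have hsmall : 400 * Λ * t ^ 2 ≤ 1 := by
    have h1 := hrle.trans (min_le_right _ _)
    rw [le_div_iff₀ (by positivity)] at h1
    have h2 : 20 * Λ * t ≤ 1 := by nlinarith
    have h3 : (20 * Λ * t) ^ 2 ≤ 1 := pow_le_one₀ (by positivity) h2
    nlinarith [sq_nonneg t]
  have hb : 0 < 100 * t ^ 2 := by positivity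
  -- With `Y' ≤ 3 t² N`, the choices of `b` and `a` make the gap terms cost `3 (5/100 + 2/48) N =
  -- 11/40 N`, less than the available `1/2 N`.
  set b : ℝ := 100 * t ^ 2 with hbdef
  set a : ℝ := 48 * t ^ 2 with hadef
  have ha : 0 < a := by positivity
  have hfc := hf.continuous
  have hbr : ∀ x : Sph d, cutoff y' b x ≠ 0 → _ := fun x hx =>
    bracket_lower_bound (κ := κ) hR hP hd hy' ht hsmall hsep (gap_lt_of_cutoff_ne_zero hb hx)
  obtain ⟨hint, hzero⟩ := integral_gap_identity hR hκ hP (contDiff_locDensity hf y' b) y'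
    (c := 20 * t) (by positivity) (fun v hv h0 x hx => (hbr x (by
      intro h
      rw [locDensity_apply, h, mul_zero, Complex.ofReal_zero] at hx
      exact hx rfl)).1 v hv h0)
  have hgapc : ∀ z : Space d, Continuous (gap z) := fun z => (contDiff_gap z).continuous
  have icont : ∀ {F : Space d → ℝ}, Continuous F →
      Integrable (fun x : Sph d => F x) (wMeasure P κ) := fun hF =>
    (hF.comp continuous_subtype_val).integrable_of_hasCompactSupport
      (HasCompactSupport.of_compactSpace _)
  have iN : Integrable (fun x : Sph d => ‖f x‖ ^ 2) (wMeasure P κ) :=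
    icont (F := fun x => ‖f x‖ ^ 2) (by fun_prop)
  have iG : Integrable (fun x : Sph d => gradSq f x) (wMeasure P κ) :=
    icont (continuous_gradSq hf)
  have iY : Integrable (fun x : Sph d => gap (y : Space d) x * ‖f x‖ ^ 2) (wMeasure P κ) := by
    have := hgapc y
    exact icont (F := fun x => gap (y : Space d) x * ‖f x‖ ^ 2) (by fun_prop)
  have iY' : Integrable (fun x : Sph d => gap y' x * ‖f x‖ ^ 2) (wMeasure P κ) := by
    have := hgapc y'
    exact icont (F := fun x => gap y' x * ‖f x‖ ^ 2) (by fun_prop)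
  set N := ∫ x : Sph d, ‖f x‖ ^ 2 ∂(wMeasure P κ) with hN
  set G := ∫ x : Sph d, gradSq f x ∂(wMeasure P κ) with hG
  set Y' := ∫ x : Sph d, gap y' x * ‖f x‖ ^ 2 ∂(wMeasure P κ) with hY'
  have hN0 : 0 ≤ N := integral_nonneg fun x => by positivity
  have hG0 : 0 ≤ G := integral_nonneg fun x => gradSq_nonneg f x
  have hYle : Y' ≤ 3 * t ^ 2 * N := by
    have h1 : ∀ x : Sph d, gap y' x * ‖f x‖ ^ 2 ≤
        2 * (gap (y : Space d) x * ‖f x‖ ^ 2) + t ^ 2 * ‖f x‖ ^ 2 := by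
      intro x
      -- This is `‖x - y'‖² ≤ 2 ‖x - y‖² + 2 t²`, halved.
      have h2 : gap y' x ≤ 2 * gap (y : Space d) x + t ^ 2 := by
        rw [gap_eq (by simp) hy', gap_eq (by simp) (by simp)]
        have h3 : ‖(x : Space d) - y'‖ ≤ ‖(x : Space d) - y‖ + t := by
          calc _ = ‖((x : Space d) - y) + ((y : Space d) - y')‖ := by congr 1; abel
            _ ≤ _ := (norm_add_le _ _).trans (by linarith)
        nlinarith [norm_nonneg ((x : Space d) - y'), norm_nonneg ((x : Space d) - y),
          sq_nonneg (‖(x : Space d) - y‖ - t)]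
      nlinarith [sq_nonneg ‖f x‖]
    have h2 := integral_mono iY' ((iY.const_mul 2).add (iN.const_mul (t ^ 2))) h1
    have h3 : ∫ x : Sph d, (2 * (gap (y : Space d) x * ‖f x‖ ^ 2) + t ^ 2 * ‖f x‖ ^ 2) ∂(wMeasure P κ) =
        2 * (∫ x : Sph d, gap (y : Space d) x * ‖f x‖ ^ 2 ∂(wMeasure P κ)) + t ^ 2 * N := by
      rw [integral_add (iY.const_mul 2) (iN.const_mul (t ^ 2)), integral_const_mul,
        integral_const_mul]
    have h4 : r ^ 2 * N ≤ t ^ 2 * N := by gcongr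
    have h5 := h2.trans_eq h3
    linarith
  have hmain : 1 / 2 * N - (1 / b) * Y' - a * G - (2 / a + 4 / b) * Y' ≤ 0 := by
    have hI : Integrable (fun x : Sph d => 1 / 2 * ‖f x‖ ^ 2 - 1 / b * (gap y' x * ‖f x‖ ^ 2) -
        a * gradSq f x - (2 / a + 4 / b) * (gap y' x * ‖f x‖ ^ 2)) (wMeasure P κ) :=
      (((iN.const_mul _).sub (iY'.const_mul _)).sub (iG.const_mul _)).sub (iY'.const_mul _)
    have hIv : ∫ x : Sph d, (1 / 2 * ‖f x‖ ^ 2 - 1 / b * (gap y' x * ‖f x‖ ^ 2) -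
        a * gradSq f x - (2 / a + 4 / b) * (gap y' x * ‖f x‖ ^ 2)) ∂(wMeasure P κ) =
        1 / 2 * N - (1 / b) * Y' - a * G - (2 / a + 4 / b) * Y' := by
      have i1 : Integrable (fun x : Sph d => 1 / 2 * ‖f x‖ ^ 2 - 1 / b * (gap y' x * ‖f x‖ ^ 2))
          (wMeasure P κ) := (iN.const_mul _).sub (iY'.const_mul _)
      have i2 : Integrable (fun x : Sph d => 1 / 2 * ‖f x‖ ^ 2 - 1 / b * (gap y' x * ‖f x‖ ^ 2) -
          a * gradSq f x) (wMeasure P κ) := i1.sub (iG.const_mul _)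
      rw [integral_sub i2 (iY'.const_mul _), integral_sub i1 (iG.const_mul _),
        integral_sub (iN.const_mul _) (iY'.const_mul _)]
      simp only [integral_const_mul, ← hN, ← hG, ← hY']
    rw [← hIv]
    have hre := congrArg Complex.re hzero
    rw [Complex.zero_re] at hre
    rw [← hre, ← RCLike.re_eq_complex_re, ← integral_re hint]
    refine integral_mono hI hint.re fun x => ?_
    have hpt := norm_gradProd_locDensity_le hf hy' ha hb x
    have hre2 := Complex.abs_re_le_norm (gradProd (locDensity f y' b) (ev (gapP y')) x)
    have hre3 := (abs_le.1 hre2).1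
    simp only [RCLike.re_eq_complex_re, Complex.add_re, locDensity_apply, ← Complex.ofReal_mul,
      Complex.ofReal_re]
    have hcut := le_cutoff y' b x
    have hB : 1 / 2 * (‖f x‖ ^ 2 * cutoff y' b x) ≤ ‖f x‖ ^ 2 * cutoff y' b x *
        (((d : ℝ) - 1 + 2 * k) * ⟪(x : Space d), y'⟫ -
        2 * ∑ v ∈ P, (κ v : ℝ) * (⟪y', v⟫ / ⟪(x : Space d), v⟫)) := by
      by_cases h0 : cutoff y' b x = 0
      · simp [h0]
      · have h1 := (hbr x h0).2
        have h2 : 0 ≤ ‖f x‖ ^ 2 * cutoff y' b x :=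
          mul_nonneg (sq_nonneg _) (cutoff_nonneg _ _ _)
        nlinarith
    have hcut2 : 1 / 2 * ‖f x‖ ^ 2 - 1 / b * (gap y' x * ‖f x‖ ^ 2) ≤
        1 / 2 * (‖f x‖ ^ 2 * cutoff y' b x) := by
      have := mul_le_mul_of_nonneg_left hcut (sq_nonneg ‖f x‖)
      have e : ‖f x‖ ^ 2 * (1 - 2 * gap y' x / b) =
        2 * (1 / 2 * ‖f x‖ ^ 2 - 1 / b * (gap y' x * ‖f x‖ ^ 2)) := by ring
      linarith
    linarith
  have hcoef : (1 / b + (2 / a + 4 / b)) * Y' ≤ 11 / 40 * N := by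
    have h1 : 0 ≤ 1 / b + (2 / a + 4 / b) := by positivity
    have h2 : (1 / b + (2 / a + 4 / b)) * (3 * t ^ 2 * N) = 11 / 40 * N := by
      rw [hbdef, hadef]
      field_simp
      ring
    rw [← h2]
    exact mul_le_mul_of_nonneg_left hYle h1
  have h9 : 9 / 40 * N ≤ a * G := by linarith
  have h10 : a * G ≤ 48 * (A ^ 2 * r ^ 2) * G := by
    have : t ^ 2 ≤ (A * r) ^ 2 := by gcongr
    rw [hadef]
    gcongr
    linarith [mul_pow A r 2]
  have h11 : 1 / (240 * A ^ 2) * N = N / 240 / A ^ 2 := by field_simp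
  rw [h11, div_le_iff₀ (by positivity)]
  linarith

end LocalUncertaintyMain

/-! ### Extension of `C¹` functions from the sphere to the space. -/

section Extension

open Filter Topology

variable {m : ℕ}

theorem contDiffAt_normalize {x : Space (m + 1)} (hx : x ≠ 0) :
    ContDiffAt ℝ 1 (fun x : Space (m + 1) => ‖x‖⁻¹ • x) x :=
  ((contDiffAt_norm ℝ hx).inv (norm_ne_zero_iff.2 hx)).smul contDiffAt_id

/-- A `C¹` function on the sphere is the restriction of a `C¹` function on the space. -/
theorem exists_contDiff_extension {f : Sph (m + 1) → ℂ} (hf : ContMDiff (𝓡 m) 𝓘(ℝ, ℂ) 1 f) :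
    ∃ F : Space (m + 1) → ℂ, ContDiff ℝ 1 F ∧ ∀ x : Sph (m + 1), F x = f x := by
  classical
  let U : TopologicalSpace.Opens (Space (m + 1)) := ⟨{0}ᶜ, isOpen_compl_singleton⟩
  have hmem : ∀ x : U, ‖(x : Space (m + 1))‖⁻¹ • (x : Space (m + 1)) ∈
      Metric.sphere (0 : Space (m + 1)) 1 := by
    intro x
    have hx : ‖(x : Space (m + 1))‖ ≠ 0 := norm_ne_zero_iff.2 x.2
    rw [mem_sphere_zero_iff_norm, norm_smul, norm_inv, norm_norm, inv_mul_cancel₀ hx]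
  have hφ : ContMDiff 𝓘(ℝ, Space (m + 1)) 𝓘(ℝ, Space (m + 1)) 1
      (fun x : U => ‖(x : Space (m + 1))‖⁻¹ • (x : Space (m + 1))) := fun x =>
    contMDiffAt_subtype_iff.2 (contDiffAt_normalize x.2).contMDiffAt
  have hψ : ContMDiff 𝓘(ℝ, Space (m + 1)) (𝓡 m) 1 (Set.codRestrict _ _ hmem) :=
    have : Fact (Module.finrank ℝ (Space (m + 1)) = m + 1) := ⟨finrank_euclideanSpace_fin⟩
    hφ.codRestrict_sphere hmem
  -- The extension constant along rays, singular only at the origin.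
  let F₀ : Space (m + 1) → ℂ := fun x =>
    if h : x ∈ U then f (Set.codRestrict _ _ hmem ⟨x, h⟩) else 0
  have hF₀ : ∀ x ∈ U, ContDiffAt ℝ 1 F₀ x := by
    intro x hx
    rw [← contMDiffAt_iff_contDiffAt]
    refine (contMDiffAt_subtype_iff (U := U) (x := ⟨x, hx⟩)).1 ?_
    have h1 : (fun z : U => F₀ z) = f ∘ Set.codRestrict _ _ hmem := by
      funext z
      exact dif_pos z.2
    rw [h1]
    exact (hf.comp hψ) _
  -- The factor `1 - χ` vanishes near the origin and equals `1` on the sphere.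
  let χ : ContDiffBump (0 : Space (m + 1)) := ⟨1 / 4, 1 / 2, by norm_num, by norm_num⟩
  refine ⟨fun x => ((1 - χ x : ℝ) : ℂ) * F₀ x, contDiff_iff_contDiffAt.2 fun x => ?_, fun x => ?_⟩
  · by_cases hx : x = 0
    · refine (contDiffAt_const (c := (0 : ℂ))).congr_of_eventuallyEq ?_
      subst hx
      filter_upwards [χ.eventuallyEq_one] with z hz
      simp [hz]
    · refine ContDiffAt.mul ?_ (hF₀ x hx)
      exact Complex.ofRealCLM.contDiff.contDiffAt.comp x
        (contDiffAt_const.sub χ.contDiffAt)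
  · have hx1 : ‖(x : Space (m + 1))‖ = 1 := by simp
    have hx0 : (x : Space (m + 1)) ∈ U := norm_ne_zero_iff.1 (by rw [hx1]; exact one_ne_zero)
    have hχ : χ (x : Space (m + 1)) = 0 := χ.zero_of_le_dist (by
      rw [dist_zero_right, hx1]
      norm_num [χ])
    have h1 : F₀ x = f x := by
      refine (dif_pos hx0).trans (congrArg f (Subtype.ext ?_))
      change ‖(x : Space (m + 1))‖⁻¹ • (x : Space (m + 1)) = x
      rw [hx1, inv_one, one_smul]
    simp [hχ, h1]

end Extension

/-! ### The square root of the Dunkl Laplacian and the global inequality. -/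

section FractionalPower

open MvPolynomial Filter Topology

variable {d : ℕ} {R P : Finset (Space d)} {κ : Space d → ℝ≥0}

theorem lam_nonneg (hd : 2 ≤ d) : 0 ≤ lam P κ := by
  have h1 : (2 : ℝ) ≤ d := by exact_mod_cast hd
  have h2 : 0 ≤ ∑ v ∈ P, (κ v : ℝ) := Finset.sum_nonneg fun v _ => (κ v).2
  rw [lam]
  linarith

theorem eig_nonneg (hd : 2 ≤ d) (n : ℕ) : 0 ≤ eig P κ n := by
  have := lam_nonneg (P := P) (κ := κ) hd
  rw [eig]
  positivity

theorem one_le_eig (hd : 2 ≤ d) {n : ℕ} (hn : n ≠ 0) : 1 ≤ eig P κ n := by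
  have h1 := lam_nonneg (P := P) (κ := κ) hd
  have h2 : (1 : ℝ) ≤ n := by exact_mod_cast Nat.one_le_iff_ne_zero.2 hn
  rw [eig]
  nlinarith

theorem norm_sq_sqrt_eig_smul (hd : 2 ≤ d) (n : ℕ) (w : L2 P κ) :
    ‖((eig P κ n ^ (1 / 2 : ℝ) : ℝ) : ℂ) • w‖ ^ 2 = eig P κ n * ‖w‖ ^ 2 := by
  rw [norm_smul, mul_pow, Complex.norm_real, Real.norm_eq_abs, sq_abs, ← Real.sqrt_eq_rpow,
    Real.sq_sqrt (eig_nonneg hd n)]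

theorem norm_sq_proj_of_isFracPow (hd : 2 ≤ d) {u g : L2 P κ} (h : IsFracPow P κ (1 / 2) u g)
    (n : ℕ) : ‖proj P κ n g‖ ^ 2 = eig P κ n * ‖proj P κ n u‖ ^ 2 := by
  rw [h n]
  exact norm_sq_sqrt_eig_smul hd n _

theorem isFracPow_unique {u g g' : L2 P κ} {α : ℝ} (h : IsFracPow P κ α u g)
    (h' : IsFracPow P κ α u g') : g' = g :=
  sub_eq_zero.1 (eq_zero_of_proj_eq_zero fun n => by rw [map_sub, h n, h' n, sub_self])

theorem exists_isFracPow (hR : IsRootSystem R) (hκ : IsMultiplicity R κ)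
    (hP : IsPositiveSubsystem R P) (hd : 2 ≤ d) {f : C(Sph d, ℂ)} {F : Space d → ℂ}
    (hF : ContDiff ℝ 1 F) (hFf : ∀ x : Sph d, F x = f x) :
    ∃ g, IsFracPow P κ (1 / 2) (toL2 P κ f) g := by
  have hs : Summable fun n => ‖((eig P κ n ^ (1 / 2 : ℝ) : ℝ) : ℂ) •
      proj P κ n (toL2 P κ f)‖ ^ 2 := by
    simp only [norm_sq_sqrt_eig_smul hd]
    exact summable_of_sum_le (fun n => mul_nonneg (eig_nonneg hd n) (sq_nonneg _))
      (sum_eig_le hR hκ hP hF hFf)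
  obtain ⟨g, -, hg⟩ := exists_hasSum_smul_proj (toL2 P κ f) _ hs
  exact ⟨g, hg⟩

theorem sum_eig_le_of_isFracPow (hd : 2 ≤ d) {u g : L2 P κ} (h : IsFracPow P κ (1 / 2) u g)
    (s : Finset ℕ) : ∑ n ∈ s, eig P κ n * ‖proj P κ n u‖ ^ 2 ≤ ‖g‖ ^ 2 := by
  simpa only [norm_sq_proj_of_isFracPow hd h] using bessel g s

theorem integral_norm_sq (g : L2 P κ) : ∫ x, ‖g x‖ ^ 2 ∂(wMeasure P κ) = ‖g‖ ^ 2 := by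
  have h1 := inner_self_eq_norm_sq_to_K (𝕜 := ℂ) g
  rw [L2.inner_def] at h1
  simp only [inner_self_eq_norm_sq_to_K, ← RCLike.ofReal_pow] at h1
  rw [integral_ofReal] at h1
  exact RCLike.ofReal_injective h1

theorem coeFn_toL2 (f : C(Sph d, ℂ)) : ∀ᵐ x ∂(wMeasure P κ), toL2 P κ f x = f x :=
  ContinuousMap.coeFn_toLp (E := ℂ) (p := 2) (𝕜 := ℂ) (wMeasure P κ) f

theorem norm_sq_toL2 (f : C(Sph d, ℂ)) :
    ‖toL2 P κ f‖ ^ 2 = ∫ x, ‖f x‖ ^ 2 ∂(wMeasure P κ) := by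
  rw [← integral_norm_sq]
  refine integral_congr_ae ?_
  filter_upwards [coeFn_toL2 (P := P) (κ := κ) f] with x hx
  rw [hx]

theorem proj_zero_eq_zero {f : C(Sph d, ℂ)} (hf : ∫ x, f x ∂(wMeasure P κ) = 0) :
    proj P κ 0 (toL2 P κ f) = 0 := by
  have h1 := proj_mem (P := P) (κ := κ) 0 (toL2 P κ f)
  obtain ⟨p, hp, hpe⟩ := h1
  have hpC : p = C (coeff 0 p) := totalDegree_eq_zero_iff_eq_C.1
    (Nat.le_zero.1 ((mem_restrictTotalDegree _ _ _).1 hp))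
  have h2 := inner_proj_right 0 (toL2 P κ f)
  rw [← hpe] at h2
  change inner ℂ (toL2 P κ f) (cls P κ p) = _ at h2
  rw [inner_toL2_cls] at h2
  have h4 : ∀ x : Sph d, ev p x = coeff 0 p := fun x => by
    conv_lhs => rw [hpC, ev_C]
  simp only [h4] at h2
  rw [integral_mul_const, integral_conj, hf, map_zero, zero_mul] at h2
  rw [← hpe]
  have h3 : ‖(toL2 P κ ∘ₗ (restrictPoly d).toLinearMap) p‖ ^ 2 = 0 := by
    exact_mod_cast h2.symm
  simpa using h3

/-- The spectral gap: the degree `0` part vanishes by mean zero, and `eig n ≥ 1` for `n ≥ 1`. -/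
theorem norm_sq_le_of_isFracPow (hd : 2 ≤ d) {f : C(Sph d, ℂ)} {g : L2 P κ}
    (hf : ∫ x, f x ∂(wMeasure P κ) = 0) (h : IsFracPow P κ (1 / 2) (toL2 P κ f) g) :
    ‖toL2 P κ f‖ ^ 2 ≤ ‖g‖ ^ 2 := by
  have h1 := ((hasSum_proj (toL2 P κ f)).tendsto_sum_nat.norm).pow 2
  refine le_of_tendsto' h1 fun N => ?_
  have h2 := norm_sq_sum_proj (toL2 P κ f) (fun _ => 1) (Finset.range N)
  simp only [one_smul] at h2
  rw [h2]
  refine le_trans (Finset.sum_le_sum fun n _ => ?_) (sum_eig_le_of_isFracPow hd h (Finset.range N))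
  rcases eq_or_ne n 0 with rfl | hn
  · rw [proj_zero_eq_zero hf]
    simp
  · exact le_mul_of_one_le_left (sq_nonneg _) (one_le_eig hd hn)

theorem gap_nonneg {x y : Space d} (hx : ‖x‖ = 1) (hy : ‖y‖ = 1) : 0 ≤ gap y x := by
  rw [gap_eq hx hy]
  positivity

theorem gap_le_two {x y : Space d} (hx : ‖x‖ = 1) (hy : ‖y‖ = 1) : gap y x ≤ 2 := by
  have h1 : ‖x - y‖ ≤ 2 := (norm_sub_le x y).trans (by rw [hx, hy]; norm_num)
  rw [gap_eq hx hy]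
  nlinarith [norm_nonneg (x - y)]

theorem norm_sq_le_add {z w : ℂ} {ε : ℝ} (hε : 0 < ε) :
    ‖z‖ ^ 2 ≤ (1 + ε) * ‖w‖ ^ 2 + (1 + 1 / ε) * ‖w - z‖ ^ 2 := by
  have h1 : ‖z‖ ≤ ‖w‖ + ‖w - z‖ := by
    calc ‖z‖ = ‖w - (w - z)‖ := by rw [sub_sub_cancel]
      _ ≤ _ := norm_sub_le _ _
  have h2 : 2 * (‖w‖ * ‖w - z‖) ≤ ε * ‖w‖ ^ 2 + 1 / ε * ‖w - z‖ ^ 2 := by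
    have h3 : ε * ‖w‖ ^ 2 + 1 / ε * ‖w - z‖ ^ 2 - 2 * (‖w‖ * ‖w - z‖) =
        1 / ε * (ε * ‖w‖ - ‖w - z‖) ^ 2 := by
      field_simp
      ring
    have h4 : 0 ≤ 1 / ε * (ε * ‖w‖ - ‖w - z‖) ^ 2 := by positivity
    linarith
  nlinarith [norm_nonneg z, norm_nonneg w, norm_nonneg (w - z)]

/-- Carries concentration near `y` from `f` to an `L²`-close polynomial; the factor `2` is the
maximum of the gap. -/
theorem integral_gap_le (f : C(Sph d, ℂ)) (p : MvPolynomial (Fin d) ℂ) (y : Sph d) {ε : ℝ}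
    (hε : 0 < ε) :
    ∫ x : Sph d, gap (y : Space d) x * ‖ev p x‖ ^ 2 ∂(wMeasure P κ) ≤
      (1 + ε) * ∫ x : Sph d, gap (y : Space d) x * ‖f x‖ ^ 2 ∂(wMeasure P κ) +
        2 * (1 + 1 / ε) * ‖toL2 P κ f - cls P κ p‖ ^ 2 := by
  have hc : ‖toL2 P κ f - cls P κ p‖ ^ 2 = ∫ x : Sph d, ‖f x - ev p x‖ ^ 2 ∂(wMeasure P κ) := by
    have h : toL2 P κ f - cls P κ p = toL2 P κ (f - restrictPoly d p) := (map_sub _ _ _).symm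
    rw [h, norm_sq_toL2]
    simp only [ContinuousMap.sub_apply, restrictPoly_apply]
  have hg : Continuous fun x : Sph d => gap (y : Space d) x :=
    (contDiff_gap (y : Space d)).continuous.comp continuous_subtype_val
  have hp : Continuous fun x : Sph d => ev p x := (continuous_ev p).comp continuous_subtype_val
  have i1 : Integrable (fun x : Sph d => gap (y : Space d) x * ‖f x‖ ^ 2) (wMeasure P κ) :=
    Continuous.integrable_of_hasCompactSupport (by fun_prop) (HasCompactSupport.of_compactSpace _)
  have i2 : Integrable (fun x : Sph d => ‖f x - ev p x‖ ^ 2) (wMeasure P κ) :=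
    Continuous.integrable_of_hasCompactSupport (by fun_prop) (HasCompactSupport.of_compactSpace _)
  have i3 : Integrable (fun x : Sph d => gap (y : Space d) x * ‖ev p x‖ ^ 2) (wMeasure P κ) :=
    Continuous.integrable_of_hasCompactSupport (by fun_prop) (HasCompactSupport.of_compactSpace _)
  rw [hc, ← integral_const_mul, ← integral_const_mul, ← integral_add (i1.const_mul _)
    (i2.const_mul _)]
  refine integral_mono i3 ((i1.const_mul _).add (i2.const_mul _)) fun x => ?_
  have h0 := gap_nonneg (x := (x : Space d)) (y := (y : Space d)) (by simp) (by simp)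
  have h2 := gap_le_two (x := (x : Space d)) (y := (y : Space d)) (by simp) (by simp)
  have h3 := mul_le_mul_of_nonneg_left (norm_sq_le_add (z := ev p x) (w := f x) hε) h0
  have h4 : gap (y : Space d) x * ((1 + 1 / ε) * ‖f x - ev p x‖ ^ 2) ≤
      2 * ((1 + 1 / ε) * ‖f x - ev p x‖ ^ 2) := mul_le_mul_of_nonneg_right h2 (by positivity)
  dsimp only
  linarith

/-- The local inequality is applied to partial sums instead of `f`: for them the energy is exactly a
partial spectral sum, hence at most `‖g‖²`, while for `f` only the opposite comparison `sum_eig_le`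
has been established. -/
theorem exists_uncertainty_const (hR : IsRootSystem R) (hκ : IsMultiplicity R κ)
    (hP : IsPositiveSubsystem R P) (hd : 2 ≤ d) :
    ∃ C : ℝ, 0 < C ∧ ∀ (f : C(Sph d, ℂ)) (g : L2 P κ),
      ∫ x, f x ∂(wMeasure P κ) = 0 → ∫ x, ‖f x‖ ^ 2 ∂(wMeasure P κ) = 1 →
      IsFracPow P κ (1 / 2) (toL2 P κ f) g → ∀ y : Sph d,
      C ≤ (∫ x : Sph d, gap (y : Space d) x * ‖f x‖ ^ 2 ∂(wMeasure P κ)) *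
        ∫ x, ‖g x‖ ^ 2 ∂(wMeasure P κ) := by
  obtain ⟨c, r₀, hc, hr₀, H⟩ := local_uncertainty hR hκ hP hd
  refine ⟨min c (r₀ ^ 2), by positivity, fun f g hf0 hf1 hfg y => ?_⟩
  rw [integral_norm_sq]
  have hg1 := norm_sq_le_of_isFracPow hd hf0 hfg
  rw [norm_sq_toL2, hf1] at hg1
  set M := ∫ x : Sph d, gap (y : Space d) x * ‖f x‖ ^ 2 ∂(wMeasure P κ) with hM
  have hM0 : 0 ≤ M := integral_nonneg fun x =>
    mul_nonneg (gap_nonneg (by simp) (by simp)) (sq_nonneg _)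
  -- The strict inequality `M < s` leaves room for the error of approximating `f` by partial sums;
  -- afterwards `s` decreases to `M`.
  have key : ∀ s, M < s → s ≤ r₀ ^ 2 → c ≤ s * ‖g‖ ^ 2 := by
    intro s hs hsr
    have hs0 : 0 < s := hM0.trans_lt hs
    have hsq : √s ^ 2 = s := Real.sq_sqrt hs0.le
    have hsr' : √s ≤ r₀ := Real.sqrt_le_iff.2 ⟨hr₀.le, hsr⟩
    choose p hp hpe _ using fun N : ℕ =>
      exists_partial_sums hR hκ hP (toL2 P κ f) (Finset.range N)
    have hlim : Tendsto (fun N => cls P κ (p N)) atTop (𝓝 (toL2 P κ f)) := by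
      simpa only [hp] using (hasSum_proj (toL2 P κ f)).tendsto_sum_nat
    have hn : ∀ N, ∫ x : Sph d, ‖ev (p N) x‖ ^ 2 ∂(wMeasure P κ) = ‖cls P κ (p N)‖ ^ 2 :=
      fun N => by
        rw [← integral_norm_sq]
        refine integral_congr_ae ?_
        filter_upwards [coeFn_cls (P := P) (κ := κ) (p N)] with x hx
        rw [hx]
    have hlim1 : Tendsto (fun N => ‖cls P κ (p N)‖ ^ 2) atTop (𝓝 1) := by
      have := hlim.norm.pow 2
      rwa [norm_sq_toL2, hf1] at this
    have hlim0 : Tendsto (fun N => ‖toL2 P κ f - cls P κ (p N)‖ ^ 2) atTop (𝓝 0) := by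
      simpa using ((tendsto_const_nhds (x := toL2 P κ f)).sub hlim).norm.pow 2
    -- Chosen so that `ε M < s - M`; the `+ 1` avoids division by zero.
    set ε : ℝ := (s - M) / (2 * (M + 1)) with hεdef
    have hε : 0 < ε := div_pos (by linarith) (by linarith)
    have hεM : (1 + ε) * M < s := by
      have h1 : ε * (2 * (M + 1)) = s - M := div_mul_cancel₀ _ (by linarith)
      nlinarith
    have hev : ∀ᶠ N in atTop, (1 + ε) * M + 2 * (1 + 1 / ε) * ‖toL2 P κ f - cls P κ (p N)‖ ^ 2 <
        s * ‖cls P κ (p N)‖ ^ 2 := by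
      refine Tendsto.eventually_lt ((hlim0.const_mul _).const_add _) (hlim1.const_mul s) ?_
      simpa using hεM
    have hev2 : ∀ᶠ N in atTop, c * ‖cls P κ (p N)‖ ^ 2 ≤ s * ‖g‖ ^ 2 := by
      filter_upwards [hev] with N hN
      have h1 := H (ev (p N)) (contDiff_ev _) y (√s) (Real.sqrt_pos.2 hs0) hsr'
      rw [hsq, hn] at h1
      refine (h1 ((integral_gap_le f (p N) y hε).trans hN.le)).trans
        (mul_le_mul_of_nonneg_left ?_ hs0.le)
      refine le_trans ?_ ((hpe N).trans_le (sum_eig_le_of_isFracPow hd hfg (Finset.range N)))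
      exact integral_mono (((continuous_gradSq (contDiff_ev _)).comp
        continuous_subtype_val).integrable_of_hasCompactSupport
        (HasCompactSupport.of_compactSpace _)) (integrable_carreSq hR hP (contDiff_ev _))
        fun x => gradSq_le_carreSq _ _
    simpa using le_of_tendsto (hlim1.const_mul c) hev2
  rcases lt_or_ge M (r₀ ^ 2) with h | h
  · refine (min_le_left _ _).trans ?_
    have hlim : Tendsto (fun s : ℝ => s * ‖g‖ ^ 2) (𝓝[>] M) (𝓝 (M * ‖g‖ ^ 2)) :=
      ((continuous_id.mul continuous_const).tendsto M).mono_left nhdsWithin_le_nhds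
    refine ge_of_tendsto hlim ?_
    filter_upwards [Ioc_mem_nhdsGT h] with s hs
    exact key s hs.1 hs.2
  · refine (min_le_right _ _).trans ?_
    nlinarith [sq_nonneg r₀]

theorem exists_isLeast_integral_gap (hd : 2 ≤ d) (f : C(Sph d, ℂ)) :
    ∃ M, IsLeast (Set.range fun y : Sph d =>
      ∫ x : Sph d, gap (y : Space d) x * ‖f x‖ ^ 2 ∂(wMeasure P κ)) M := by
  have hne : Nonempty (Sph d) := by
    have : Nontrivial (Space d) := by
      have : Nonempty (Fin d) := ⟨⟨0, by omega⟩⟩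
      infer_instance
    exact ((NormedSpace.sphere_nonempty (x := (0 : Space d))).2 zero_le_one).to_subtype
  have hcont : Continuous fun y : Sph d =>
      ∫ x : Sph d, gap (y : Space d) x * ‖f x‖ ^ 2 ∂(wMeasure P κ) := by
    have hi : Integrable (fun x : Sph d => 2 * ‖f x‖ ^ 2) (wMeasure P κ) :=
      Continuous.integrable_of_hasCompactSupport (by fun_prop)
        (HasCompactSupport.of_compactSpace _)
    refine continuous_of_dominated (fun y => ?_) (fun y => ?_) hi ?_
    · have hg : Continuous fun x : Sph d => gap (y : Space d) x :=
        (contDiff_gap (y : Space d)).continuous.comp continuous_subtype_val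
      exact Continuous.aestronglyMeasurable (by fun_prop)
    · refine Filter.Eventually.of_forall fun x => ?_
      rw [Real.norm_of_nonneg (mul_nonneg (gap_nonneg (by simp) (by simp)) (sq_nonneg _))]
      exact mul_le_mul_of_nonneg_right (gap_le_two (by simp) (by simp)) (sq_nonneg _)
    · refine Filter.Eventually.of_forall fun x => ?_
      unfold gap
      fun_prop
  obtain ⟨y, -, hy⟩ := isCompact_univ.exists_isMinOn Set.univ_nonempty hcont.continuousOn
  exact ⟨_, ⟨y, rfl⟩, by rintro _ ⟨z, rfl⟩; exact hy (Set.mem_univ z)⟩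

/-- The constant can be chosen independently of the positive subsystem. -/
theorem exists_uncertainty_const_uniform (hR : IsRootSystem R) (hκ : IsMultiplicity R κ)
    (hd : 2 ≤ d) :
    ∃ C : ℝ, 0 < C ∧ ∀ P : Finset (Space d), IsPositiveSubsystem R P →
      ∀ (f : C(Sph d, ℂ)) (g : L2 P κ),
      ∫ x, f x ∂(wMeasure P κ) = 0 → ∫ x, ‖f x‖ ^ 2 ∂(wMeasure P κ) = 1 →
      IsFracPow P κ (1 / 2) (toL2 P κ f) g → ∀ y : Sph d,
      C ≤ (∫ x : Sph d, gap (y : Space d) x * ‖f x‖ ^ 2 ∂(wMeasure P κ)) *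
        ∫ x, ‖g x‖ ^ 2 ∂(wMeasure P κ) := by
  classical
  choose φ hφ H using fun P : {P : Finset (Space d) // IsPositiveSubsystem R P} =>
    exists_uncertainty_const hR hκ P.2 hd
  obtain ⟨C, hC, hle⟩ := exists_pos_le_of_finset R.powerset
    (fun P => if h : IsPositiveSubsystem R P then φ ⟨P, h⟩ else 1) fun P _ => by
      split_ifs with h
      · exact hφ _
      · exact one_pos
  refine ⟨C, hC, fun P hP f g h0 h1 hfg y => ?_⟩
  have h2 := hle P (Finset.mem_powerset.2 hP.subset)
  rw [dif_pos hP] at h2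
  exact h2.trans (H ⟨P, hP⟩ f g h0 h1 hfg y)

end FractionalPower

end DunklSphere

/-- Uncertainty principle on the weighted sphere `S^{d-1}`, `d = m + 1 ≥ 2`. -/
theorem theorem1p1 (m : ℕ) (hm : 1 ≤ m)
    (R : Finset (DunklSphere.Space (m + 1))) (hR : DunklSphere.IsRootSystem R)
    (κ : DunklSphere.Space (m + 1) → ℝ≥0) (hκ : DunklSphere.IsMultiplicity R κ) :
    ∃ C : ℝ, 0 < C ∧
      ∀ P : Finset (DunklSphere.Space (m + 1)), DunklSphere.IsPositiveSubsystem R P →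
      ∀ f : C(DunklSphere.Sph (m + 1), ℂ), ContMDiff (𝓡 m) 𝓘(ℝ, ℂ) 1 f →
        ∫ x, f x ∂(DunklSphere.wMeasure P κ) = 0 →
        ∫ x, ‖f x‖ ^ 2 ∂(DunklSphere.wMeasure P κ) = 1 →
        ∃ g : DunklSphere.L2 P κ,
          DunklSphere.IsFracPow P κ (1 / 2) (DunklSphere.toL2 P κ f) g ∧
          (∀ g' : DunklSphere.L2 P κ,
            DunklSphere.IsFracPow P κ (1 / 2) (DunklSphere.toL2 P κ f) g' → g' = g) ∧
          ∃ μ : ℝ,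
            IsLeast (Set.range fun y : DunklSphere.Sph (m + 1) =>
              ∫ x : DunklSphere.Sph (m + 1),
                (1 - ⟪(x : DunklSphere.Space (m + 1)), (y : DunklSphere.Space (m + 1))⟫) *
                  ‖f x‖ ^ 2 ∂(DunklSphere.wMeasure P κ)) μ ∧
            C ≤ μ * ∫ x, ‖g x‖ ^ 2 ∂(DunklSphere.wMeasure P κ) := by
  have hd : 2 ≤ m + 1 := Nat.succ_le_succ hm
  obtain ⟨C, hC, H⟩ := DunklSphere.exists_uncertainty_const_uniform hR hκ hd
  refine ⟨C, hC, fun P hP f hf h0 h1 => ?_⟩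
  obtain ⟨F, hF, hFf⟩ := DunklSphere.exists_contDiff_extension hf
  obtain ⟨g, hg⟩ := DunklSphere.exists_isFracPow hR hκ hP hd hF hFf
  obtain ⟨M, ⟨y, hy⟩, hM⟩ := DunklSphere.exists_isLeast_integral_gap (P := P) (κ := κ) hd f
  refine ⟨g, hg, fun g' hg' => DunklSphere.isFracPow_unique hg hg', M, ⟨⟨y, hy⟩, hM⟩, ?_⟩
  rw [← hy]
  exact H P hP f g h0 h1 hg y
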